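/- **Setting.** Let $\mathbb{E}=\mathbb{R}^d$ and $\mathcal{C}(\mathbb{E})=C^\infty(\mathbb{E},\mathbb{R})$ with its Fréchet topology. A functional $F:\mathcal{C}(\mathbb{E})\to\mathbb{C}$ is *smooth* if it has functional derivatives $F^{(n)}(\varphi)\in\mathcal{E}'(\mathbb{E}^n)$ of all orders, i.e. symmetric compactly supported distributions with $F^{(0)}=F$ and $\frac{d}{dt}\big|_{t=0}\langle F^{(n)}(\varphi+th),f\rangle=\langle F^{(n+1)}(\varphi),h\otimes f\rangle$ for all $h\in\mathcal C(\mathbb E)$, $f\in C^\infty(\mathbb{E}^n)$ (so $\langle F^{(n)}(\varphi),h^{\otimes n}\rangle=\frac{d^n}{dt^n}\big|_{t=0}F(\varphi+th)$), such that $(\varphi,f)\mapsto\langle F^{(n)}(\varphi),f\rangle$ is jointly continuous on $\mathcal C(\mathbb E)\times C^\infty(\mathbb E^n)$ for each $n$. The support $\mathrm{supp}(F)$ is the smallest closed set such that $F(\varphi+h)=F(\varphi)$ for all $\varphi$ and all $h$ supported near a point of its complement. $\mathcal{F}(\mathbb{E})$ is the space of smooth functionals with compact support. Let $\mathrm{Diag}(\mathbb{E}^n)=\{x_1=\dots=x_n\}$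 be the thin diagonal. $\mathcal{F}_{\mathrm{loc}}(\mathbb{E})\subset\mathcal{F}(\mathbb{E})$ is the space of local functionals: for all $n$ and $\varphi$, $\mathrm{supp}\,F^{(n)}(\varphi)\subset\mathrm{Diag}(\mathbb{E}^n)$ and $\mathrm{WF}(F^{(n)}(\varphi))\subset(T\,\mathrm{Diag}(\mathbb{E}^n))^{\perp}$. The support of a formal power series in $\hbar$ of functionals is the closure of the union of the supports of its coefficients. Tensor products and linear maps below are over $\mathbb{C}[[\hbar]]$. Let $P$ be the fundamental solution of $-\Delta+m^2$ on $\mathbb{E}$ that is invariant under the Euclidean group and tends to $0$ at infinity, given by a locally integrable function that is continuous off the origin. For $F,G\in\mathcal{F}(\mathbb{E})[[\hbar]]$ with disjoint supports let $$F\cdot_{E}G=\sum_{k\ge0}\frac{\hbar^k}{k!}\langle F^{(k)},P^{\otimes k}G^{(k)}\rangle ,$$ extended $\hbar$-linearly, where $P^{\otimes k}$ has the kernel $\prod_i P(x_i-y_i)$. **Induction hypothesis at order $n$.** Let $n\ge2$ and let $E_k:\mathcal{F}_{\mathrm{loc}}(\mathbb{E})[[\hbar]]^{\otimes k}\to\mathcal{F}(\mathbb{E})[[\hbar]]$,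 $k<n$, be linear maps such that $E_0(1)=1$, $E_1(F)=F$, and for all $k<n$ and all $F_1,\dots,F_k\in\mathcal F_{\mathrm{loc}}(\mathbb E)[[\hbar]]$: 1. $\mathrm{supp}\,E_k(F_1\otimes\dots\otimes F_k)\subset\bigcup_i\mathrm{supp}(F_i)$; 2. (symmetry) $E_k(F_{\pi(1)}\otimes\dots\otimes F_{\pi(k)})=E_k(F_1\otimes\dots\otimes F_k)$ for all permutations $\pi$; 3. (Euclidean causality) if $\emptyset\ne I\subsetneq\{1,\dots,k\}$ and $\mathrm{supp}(F_i)\cap\mathrm{supp}(F_j)=\emptyset$ for all $i\in I$, $j\in I^c$, then $$E_k(F_1\otimes\cdots\otimes F_k)=E_{|I|}\Big(\bigotimes_{i\in I}F_i\Big)\cdot_{E}E_{|I^c|}\Big(\bigotimes_{j\in I^c}F_j\Big).$$ **Proposition.** Let $\mathcal{D}_n\subset\mathcal{F}_{\mathrm{loc}}(\mathbb{E})[[\hbar]]^{\otimes n}$ be the space of all finite sums $\sum_iF_1^i\otimes\dots\otimes F_n^i$ with $\mathrm{supp}(F_1^i\otimes\dots\otimes F_n^i)\cap\mathrm{Diag}(\mathbb{E}^n)=\emptyset$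 for all $i$, where $\mathrm{supp}(F_1\otimes\dots\otimes F_n)=\mathrm{supp}(F_1)\times\dots\times\mathrm{supp}(F_n)$. Under the induction hypothesis there is one and only one linear map $E_n^0:\mathcal{D}_n\to\mathcal{F}(\mathbb{E})[[\hbar]]$ that satisfies Euclidean causality 3 (for $k=n$, with the given $E_{|I|}$, $E_{|I^c|}$, on the tensors $F_1\otimes\cdots\otimes F_n$ in question). This $E_n^0$ is symmetric (2 for $k=n$) and satisfies the support property 1 for $k=n$. In particular every linear map $E_n:\mathcal{F}_{\mathrm{loc}}(\mathbb{E})[[\hbar]]^{\otimes n}\to\mathcal{F}(\mathbb{E})[[\hbar]]$ that satisfies Euclidean causality 3 for $k=n$ restricts to $E_n^0$ on $\mathcal{D}_n$, so its values on $\mathcal D_n$ are uniquely determined by $(E_k)_{k<n}$. -/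

import Mathlib

open scoped ContDiff Topology TensorProduct PowerSeries

noncomputable section

namespace EuclideanEG

/-- `d`-dimensional Euclidean space. -/
abbrev Space (d : ℕ) : Type := EuclideanSpace ℝ (Fin d)

/-! ### Smooth functions with their Fréchet topology -/

/-- The `𝕜`-vector space of smooth functions on a real normed space, as a subspace. -/
def smoothSubmodule (𝕜 V : Type) [RCLike 𝕜] [NormedAddCommGroup V] [NormedSpace ℝ V] :
    Submodule 𝕜 (V → 𝕜) where
  carrier := {f | ContDiff ℝ ∞ f}
  add_mem' := by
    intro f g hf hg
    rw [Set.mem_ofPred_eq] at hf hg ⊢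
    exact hf.add hg
  zero_mem' := by
    rw [Set.mem_ofPred_eq]
    exact contDiff_const
  smul_mem' := by
    intro c f hf
    rw [Set.mem_ofPred_eq] at hf ⊢
    exact contDiff_const.mul hf

/-- `C^∞(V)` with values in `𝕜` (real or complex). -/
def SmoothFn (𝕜 V : Type) [RCLike 𝕜] [NormedAddCommGroup V] [NormedSpace ℝ V] : Type :=
  smoothSubmodule 𝕜 V

section SmoothFn

variable {𝕜 V : Type} [RCLike 𝕜] [NormedAddCommGroup V] [NormedSpace ℝ V]

instance : AddCommGroup (SmoothFn 𝕜 V) := inferInstanceAs (AddCommGroup (smoothSubmodule 𝕜 V))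

instance : Module 𝕜 (SmoothFn 𝕜 V) := inferInstanceAs (Module 𝕜 (smoothSubmodule 𝕜 V))

instance : FunLike (SmoothFn 𝕜 V) V 𝕜 where
  coe f := f.1
  coe_injective := Subtype.val_injective

/-- A smooth function, bundled. -/
def SmoothFn.of (f : V → 𝕜) (hf : ContDiff ℝ ∞ f) : SmoothFn 𝕜 V := ⟨f, hf⟩

theorem SmoothFn.contDiff (f : SmoothFn 𝕜 V) : ContDiff ℝ ∞ f := f.2

/-- The `j`-th derivative of a smooth function, as a continuous map. -/
def SmoothFn.derivMap (j : ℕ) (f : SmoothFn 𝕜 V) : C(V, V [×j]→L[ℝ] 𝕜) :=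
  ⟨iteratedFDeriv ℝ j f,
    f.contDiff.continuous_iteratedFDeriv (by exact_mod_cast le_top)⟩

/-- The usual topology of `C^∞(V)`: uniform convergence of all derivatives on compact sets. -/
instance : TopologicalSpace (SmoothFn 𝕜 V) :=
  ⨅ j : ℕ, TopologicalSpace.induced (SmoothFn.derivMap j) inferInstance

end SmoothFn

/-- `E'(V)`, the compactly supported distributions: the continuous dual of `C^∞(V)`. -/
abbrev CDist (V : Type) [NormedAddCommGroup V] [NormedSpace ℝ V] : Type :=
  SmoothFn ℂ V →L[ℂ] ℂ

/-- A compactly supported distribution applied to an unbundled smooth function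
(and `0` if the function is not smooth). -/
def CDist.eval {V : Type} [NormedAddCommGroup V] [NormedSpace ℝ V] (u : CDist V) (f : V → ℂ) : ℂ :=
  open Classical in if hf : ContDiff ℝ ∞ f then u (SmoothFn.of f hf) else 0

/-! ### The thin diagonal, wave front sets -/

/-- The thin diagonal of the `n`-fold power of Euclidean space. -/
def thinDiag (d n : ℕ) : Set (Fin n → Space d) := {x | ∀ i j, x i = x j}

/-- The annihilator of the tangent bundle of the thin diagonal, in the cotangent bundle; the
tangent space of the thin diagonal consists of the vectors `(v, …, v)`. -/
def conormalDiag (d n : ℕ) : Set ((Fin n → Space d) × (Fin n → Space d)) :=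
  {p | p.1 ∈ thinDiag d n ∧ ∀ v : Space d, ∑ i, inner ℝ (p.2 i) v = 0}

/-- The function `χ(x) exp(-i⟨ξ, x⟩)`. -/
def waveTest {d n : ℕ} (χ : SmoothFn ℂ (Fin n → Space d)) (ξ : Fin n → Space d) :
    SmoothFn ℂ (Fin n → Space d) :=
  SmoothFn.of
    (fun x => χ x * Complex.exp (-Complex.I * ((∑ i, inner ℝ (ξ i) (x i) : ℝ) : ℂ))) (by
      refine χ.contDiff.mul (ContDiff.cexp (contDiff_const.mul ?_))
      refine Complex.ofRealCLM.contDiff.comp ?_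
      have h : ∀ i ∈ Finset.univ, ContDiff ℝ ∞ fun x : Fin n → Space d => inner ℝ (ξ i) (x i) :=
        fun i _ => contDiff_const.inner ℝ (contDiff_apply ℝ (Space d) i)
      exact ContDiff.sum h)

/-- The wave front set. A covector `ξ ≠ 0` at `x` is not in it iff there are a neighbourhood `U` of
`x` and a conic neighbourhood `Γ` of `ξ` such that for every `χ ∈ C_c^∞(U)` the Fourier transform
of `χ u` decreases rapidly in `Γ`. -/
def waveFrontSet {d n : ℕ} (u : CDist (Fin n → Space d)) :
    Set ((Fin n → Space d) × (Fin n → Space d)) :=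
  {p | p.2 ≠ 0 ∧ ¬ ∃ U ∈ 𝓝 p.1, ∃ Γ ∈ 𝓝 p.2,
    (∀ η ∈ Γ, ∀ s : ℝ, 0 < s → s • η ∈ Γ) ∧
    ∀ χ : SmoothFn ℂ (Fin n → Space d), HasCompactSupport χ → tsupport χ ⊆ U →
      ∀ N : ℕ, ∃ C : ℝ, ∀ η ∈ Γ, (1 + ‖η‖) ^ N * ‖u (waveTest χ η)‖ ≤ C}

/-! ### Smooth functionals and their functional derivatives -/

/-- The configuration space `C^∞(𝔼)` of a real scalar field. -/
abbrev Config (d : ℕ) : Type := SmoothFn ℝ (Space d)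

/-- All functionals on the configuration space. -/
abbrev Functional (d : ℕ) : Type := Config d → ℂ

/-- The function `(x₀, x₁, …, xₙ) ↦ h(x₀) f(x₁, …, xₙ)`. -/
def headTensor {d n : ℕ} (h : Config d) (f : SmoothFn ℂ (Fin n → Space d)) :
    SmoothFn ℂ (Fin (n + 1) → Space d) :=
  SmoothFn.of (fun x => (h (x 0) : ℂ) * f (Fin.tail x)) (by
    refine ContDiff.mul (Complex.ofRealCLM.contDiff.comp
      (h.contDiff.comp (contDiff_apply ℝ (Space d) 0))) (f.contDiff.comp ?_)
    exact contDiff_pi.2 fun i => contDiff_apply ℝ (Space d) i.succ)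

/-- The function `x ↦ f(x_{σ(1)}, …, x_{σ(n)})`. -/
def permute {d n : ℕ} (σ : Equiv.Perm (Fin n)) (f : SmoothFn ℂ (Fin n → Space d)) :
    SmoothFn ℂ (Fin n → Space d) :=
  SmoothFn.of (fun x => f (x ∘ σ)) (by
    refine f.contDiff.comp ?_
    exact contDiff_pi.2 fun i => contDiff_apply ℝ (Space d) (σ i))

/-- `D n φ` is the `n`-th functional derivative `F^{(n)}(φ)`, for all `n` and `φ`: symmetric
distributions with `F^{(0)} = F` and
`⟨F^{(n+1)}(φ), h ⊗ f⟩ = d/dt|_{t=0} ⟨F^{(n)}(φ + t h), f⟩`, jointly continuous in the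
configuration and the test function. In particular
`⟨F^{(n)}(φ), h^{⊗n}⟩ = dⁿ/dtⁿ|_{t=0} F(φ + t h)`. -/
structure IsFunDeriv {d : ℕ} (F : Functional d)
    (D : (n : ℕ) → Config d → CDist (Fin n → Space d)) : Prop where
  zero : ∀ φ f, D 0 φ f = F φ * f ![]
  succ : ∀ n φ (h : Config d) f,
    HasDerivAt (fun t : ℝ => D n (φ + t • h) f) (D (n + 1) φ (headTensor h f)) 0
  symm : ∀ n φ (σ : Equiv.Perm (Fin n)) f, D n φ (permute σ f) = D n φ f
  cont : ∀ n, Continuous fun p : Config d × SmoothFn ℂ (Fin n → Space d) => D n p.1 p.2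

/-- The `n`-th functional derivative of a smooth functional
(and `0` if the functional is not smooth). -/
def funDeriv {d : ℕ} (F : Functional d) : (n : ℕ) → Config d → CDist (Fin n → Space d) :=
  open Classical in if h : ∃ D, IsFunDeriv F D then h.choose else fun _ _ => 0

/-- The support of a functional: the smallest closed set such that variations of the field with
support outside of it do not change the value of the functional. -/
def funSupport {d : ℕ} (F : Functional d) : Set (Space d) :=
  {x | ∀ U ∈ 𝓝 x, ∃ φ h : Config d, tsupport h ⊆ U ∧ F (φ + h) ≠ F φ}

/-- Smooth functionals of compact support, `F(𝔼)`. -/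
def IsCompactFunctional {d : ℕ} (F : Functional d) : Prop :=
  (∃ D, IsFunDeriv F D) ∧ ∃ K, IsCompact K ∧ funSupport F ⊆ K

/-- Local functionals, `F_loc(𝔼)`: smooth functionals of compact support all of whose functional
derivatives are supported on the thin diagonal and have a wave front set perpendicular to its
tangent bundle. -/
def IsLocalFunctional {d : ℕ} (F : Functional d) : Prop :=
  IsCompactFunctional F ∧ ∃ D, IsFunDeriv F D ∧ ∀ n φ,
    Distribution.dsupport (D n φ : SmoothFn ℂ (Fin n → Space d) → ℂ) ⊆ thinDiag d n ∧
    waveFrontSet (D n φ) ⊆ conormalDiag d n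

/-! ### The spaces of functionals are vector spaces -/

section Linear

variable {d : ℕ}

theorem IsFunDeriv.add {F G : Functional d} {D D' : (n : ℕ) → Config d → CDist (Fin n → Space d)}
    (hF : IsFunDeriv F D) (hG : IsFunDeriv G D') :
    IsFunDeriv (F + G) (fun n φ => D n φ + D' n φ) where
  zero φ f := by
    simp [hF.zero, hG.zero, add_mul]
  succ n φ h f := (hF.succ n φ h f).add (hG.succ n φ h f)
  symm n φ σ f := by
    simp [hF.symm, hG.symm]
  cont n := (hF.cont n).add (hG.cont n)

theorem IsFunDeriv.smul {F : Functional d} {D : (n : ℕ) → Config d → CDist (Fin n → Space d)}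
    (c : ℂ) (hF : IsFunDeriv F D) : IsFunDeriv (c • F) (fun n φ => c • D n φ) where
  zero φ f := by
    simp [hF.zero, mul_assoc]
  succ n φ h f := (hF.succ n φ h f).const_smul c
  symm n φ σ f := by
    simp [hF.symm]
  cont n := (hF.cont n).const_smul c

theorem IsFunDeriv.of_zero :
    IsFunDeriv (0 : Functional d) (fun n _ => (0 : CDist (Fin n → Space d))) where
  zero φ f := by simp
  succ n φ h f := by simpa using hasDerivAt_const (0 : ℝ) (0 : ℂ)
  symm n φ σ f := by simp
  cont n := by simpa using continuous_const

theorem funSupport_zero : funSupport (0 : Functional d) = ∅ := by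
  ext x
  simp only [funSupport, Set.mem_ofPred_eq, Set.mem_empty_iff_false, iff_false]
  intro h
  obtain ⟨φ, h, -, hne⟩ := h Set.univ Filter.univ_mem
  exact hne rfl

theorem funSupport_add (F G : Functional d) :
    funSupport (F + G) ⊆ funSupport F ∪ funSupport G := by
  intro x hx
  by_contra hcon
  simp only [funSupport, Set.mem_union, Set.mem_ofPred_eq, not_or, not_forall] at hcon
  obtain ⟨⟨U, hU, hFU⟩, ⟨U', hU', hGU⟩⟩ := hcon
  obtain ⟨φ, h, hh, hne⟩ := hx (U ∩ U') (Filter.inter_mem hU hU')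
  push Not at hFU hGU
  exact hne (congrArg₂ (· + ·) (hFU φ h (hh.trans Set.inter_subset_left))
    (hGU φ h (hh.trans Set.inter_subset_right)))

theorem funSupport_smul (c : ℂ) (F : Functional d) : funSupport (c • F) ⊆ funSupport F := by
  intro x hx U hU
  obtain ⟨φ, h, hh, hne⟩ := hx U hU
  exact ⟨φ, h, hh, fun e => hne (congrArg (c • ·) e)⟩

theorem IsCompactFunctional.add {F G : Functional d} (hF : IsCompactFunctional F)
    (hG : IsCompactFunctional G) : IsCompactFunctional (F + G) := by
  obtain ⟨⟨D, hD⟩, K, hK, hFK⟩ := hF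
  obtain ⟨⟨D', hD'⟩, K', hK', hGK⟩ := hG
  exact ⟨⟨_, hD.add hD'⟩, K ∪ K', hK.union hK',
    (funSupport_add F G).trans (Set.union_subset_union hFK hGK)⟩

theorem IsCompactFunctional.smul {F : Functional d} (c : ℂ) (hF : IsCompactFunctional F) :
    IsCompactFunctional (c • F) := by
  obtain ⟨⟨D, hD⟩, K, hK, hFK⟩ := hF
  exact ⟨⟨_, hD.smul c⟩, K, hK, (funSupport_smul c F).trans hFK⟩

theorem IsCompactFunctional.of_zero : IsCompactFunctional (0 : Functional d) :=
  ⟨⟨_, IsFunDeriv.of_zero⟩, ∅, isCompact_empty, funSupport_zero.subset⟩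

theorem dsupport_add {n : ℕ} (u v : CDist (Fin n → Space d)) :
    Distribution.dsupport ((u + v : CDist (Fin n → Space d)) : SmoothFn ℂ (Fin n → Space d) → ℂ) ⊆
      Distribution.dsupport (u : SmoothFn ℂ (Fin n → Space d) → ℂ) ∪
        Distribution.dsupport (v : SmoothFn ℂ (Fin n → Space d) → ℂ) := by
  intro x hx
  by_contra hcon
  rw [Set.mem_union, not_or, Distribution.notMem_dsupport_iff,
    Distribution.notMem_dsupport_iff] at hcon
  obtain ⟨⟨s, hs, hso, hxs⟩, ⟨t, ht, hto, hxt⟩⟩ := hcon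
  refine (Distribution.notMem_dsupport_iff x).2
    ⟨s ∩ t, fun f hf => ?_, hso.inter hto, hxs, hxt⟩ hx
  have h1 := hs f (hf.trans Set.inter_subset_left)
  have h2 := ht f (hf.trans Set.inter_subset_right)
  rw [add_apply, h1, h2, add_zero]

theorem dsupport_smul {n : ℕ} (c : ℂ) (u : CDist (Fin n → Space d)) :
    Distribution.dsupport ((c • u : CDist (Fin n → Space d)) : SmoothFn ℂ (Fin n → Space d) → ℂ) ⊆
      Distribution.dsupport (u : SmoothFn ℂ (Fin n → Space d) → ℂ) := by
  intro x hx
  by_contra hcon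
  rw [Distribution.notMem_dsupport_iff] at hcon
  obtain ⟨s, hs, hso, hxs⟩ := hcon
  refine (Distribution.notMem_dsupport_iff x).2 ⟨s, fun f hf => ?_, hso, hxs⟩ hx
  rw [smul_apply, hs f hf, smul_zero]

theorem waveFrontSet_add {n : ℕ} (u v : CDist (Fin n → Space d)) :
    waveFrontSet (u + v) ⊆ waveFrontSet u ∪ waveFrontSet v := by
  rintro p ⟨hp, hx⟩
  by_contra hcon
  simp only [waveFrontSet, Set.mem_union, Set.mem_ofPred_eq, not_or, not_and, not_not] at hcon
  obtain ⟨U, hU, Γ, hΓ, hc, h1⟩ := hcon.1 hp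
  obtain ⟨U', hU', Γ', hΓ', hc', h2⟩ := hcon.2 hp
  refine hx ⟨U ∩ U', Filter.inter_mem hU hU', Γ ∩ Γ', Filter.inter_mem hΓ hΓ',
    fun η hη s hs => ⟨hc η hη.1 s hs, hc' η hη.2 s hs⟩, fun χ hχ hχU N => ?_⟩
  obtain ⟨C, hC⟩ := h1 χ hχ (hχU.trans Set.inter_subset_left) N
  obtain ⟨C', hC'⟩ := h2 χ hχ (hχU.trans Set.inter_subset_right) N
  refine ⟨C + C', fun η hη => ?_⟩
  calc (1 + ‖η‖) ^ N * ‖(u + v) (waveTest χ η)‖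
      ≤ (1 + ‖η‖) ^ N * (‖u (waveTest χ η)‖ + ‖v (waveTest χ η)‖) := by
        gcongr
        exact norm_add_le _ _
    _ ≤ C + C' := by
        rw [mul_add]
        exact add_le_add (hC η hη.1) (hC' η hη.2)

theorem waveFrontSet_smul {n : ℕ} (c : ℂ) (u : CDist (Fin n → Space d)) :
    waveFrontSet (c • u) ⊆ waveFrontSet u := by
  rintro p ⟨hp, hx⟩
  refine ⟨hp, fun ⟨U, hU, Γ, hΓ, hc, h⟩ => hx ⟨U, hU, Γ, hΓ, hc, fun χ hχ hχU N => ?_⟩⟩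
  obtain ⟨C, hC⟩ := h χ hχ hχU N
  refine ⟨‖c‖ * C, fun η hη => ?_⟩
  rw [smul_apply, norm_smul, mul_left_comm]
  exact mul_le_mul_of_nonneg_left (hC η hη) (norm_nonneg c)

theorem dsupport_zero (n : ℕ) : Distribution.dsupport
    ((0 : CDist (Fin n → Space d)) : SmoothFn ℂ (Fin n → Space d) → ℂ) = ∅ := by
  ext x
  rw [Set.mem_empty_iff_false, iff_false, Distribution.notMem_dsupport_iff]
  exact ⟨Set.univ, fun f _ => rfl, isOpen_univ, Set.mem_univ x⟩

theorem waveFrontSet_zero (n : ℕ) : waveFrontSet (0 : CDist (Fin n → Space d)) = ∅ := by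
  ext p
  rw [Set.mem_empty_iff_false, iff_false]
  rintro ⟨-, h⟩
  refine h ⟨Set.univ, Filter.univ_mem, Set.univ, Filter.univ_mem,
    fun _ _ _ _ => Set.mem_univ _, fun χ _ _ N => ⟨0, fun η _ => ?_⟩⟩
  rw [zero_apply, norm_zero, mul_zero]

end Linear

/-- `F(𝔼)` as a vector space. -/
def compactFunctionals (d : ℕ) : Submodule ℂ (Functional d) where
  carrier := {F | IsCompactFunctional F}
  add_mem' := by
    intro F G hF hG
    exact IsCompactFunctional.add hF hG
  zero_mem' := IsCompactFunctional.of_zero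
  smul_mem' := by
    intro c F hF
    exact IsCompactFunctional.smul c hF

/-- `F_loc(𝔼)` as a vector space. -/
def localFunctionals (d : ℕ) : Submodule ℂ (Functional d) where
  carrier := {F | IsLocalFunctional F}
  add_mem' := by
    rintro F G ⟨hF, D, hD, h⟩ ⟨hG, D', hD', h'⟩
    exact ⟨hF.add hG, _, hD.add hD', fun n φ =>
      ⟨(dsupport_add _ _).trans (Set.union_subset (h n φ).1 (h' n φ).1),
        (waveFrontSet_add _ _).trans (Set.union_subset (h n φ).2 (h' n φ).2)⟩⟩
  zero_mem' := ⟨IsCompactFunctional.of_zero, _, IsFunDeriv.of_zero, fun n _ =>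
    ⟨(dsupport_zero n).subset.trans (Set.empty_subset _),
      (waveFrontSet_zero n).subset.trans (Set.empty_subset _)⟩⟩
  smul_mem' := by
    rintro c F ⟨hF, D, hD, h⟩
    exact ⟨hF.smul c, _, hD.smul c, fun n φ =>
      ⟨(dsupport_smul c _).trans (h n φ).1, (waveFrontSet_smul c _).trans (h n φ).2⟩⟩

/-! ### Formal power series in `ħ` -/

/-- For a vector space `S` of functionals, the `ℂ⟦ħ⟧`-module `S⟦ħ⟧` of formal power series with
coefficients in `S`. -/
def seriesIn {d : ℕ} (S : Submodule ℂ (Functional d)) : Submodule ℂ⟦X⟧ (Functional d)⟦X⟧ where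
  carrier := {F | ∀ j, PowerSeries.coeff j F ∈ S}
  add_mem' := by
    intro F G hF hG j
    rw [map_add]
    exact S.add_mem (hF j) (hG j)
  zero_mem' := by
    intro j
    rw [map_zero]
    exact S.zero_mem
  smul_mem' := by
    intro a F hF j
    have h : a • F = PowerSeries.map (algebraMap ℂ (Functional d)) a * F := rfl
    rw [h, PowerSeries.coeff_mul]
    refine S.sum_mem fun p _ => ?_
    rw [PowerSeries.coeff_map, ← Algebra.smul_def]
    exact S.smul_mem _ (hF p.2)

/-- `F(𝔼)⟦ħ⟧`. -/
abbrev CompactSeries (d : ℕ) : Type := seriesIn (compactFunctionals d)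

/-- `F_loc(𝔼)⟦ħ⟧`. -/
abbrev LocalSeries (d : ℕ) : Type := seriesIn (localFunctionals d)

/-- The support of a formal power series of functionals. -/
def seriesSupport {d : ℕ} (F : (Functional d)⟦X⟧) : Set (Space d) :=
  closure (⋃ j, funSupport (PowerSeries.coeff j F))

/-! ### The Euclidean time-ordered product -/

/-- `P` is the function (continuous off the origin) that represents the fundamental solution of the
Helmholtz operator `-Δ + m²` which is invariant under the Euclidean group and vanishes at infinity;
its integral kernel is `P(x, y) = P(x - y)`. -/
structure IsHelmholtzKernel (d : ℕ) (m : ℝ) (P : Space d → ℝ) : Prop where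
  locallyIntegrable : MeasureTheory.LocallyIntegrable P
  continuousOn : ContinuousOn P {0}ᶜ
  fundamental : ∀ f : Space d → ℝ, ContDiff ℝ ∞ f → HasCompactSupport f →
    ∫ x, P x * (-Laplacian.laplacian f x + m ^ 2 * f x) = f 0
  invariant : ∀ (R : Space d ≃ₗᵢ[ℝ] Space d) (x : Space d), P (R x) = P x
  vanishing : Filter.Tendsto P (Filter.cocompact (Space d)) (𝓝 0)

/-- The kernel `P` cut off near the origin: it vanishes for `|x| ≤ ε` and agrees with `P` for
`|x|² ≥ 2 ε²`. -/
def cutKernel {d : ℕ} (P : Space d → ℝ) (ε : ℝ) (x : Space d) : ℝ :=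
  Real.smoothTransition (‖x‖ ^ 2 / ε ^ 2 - 1) * P x

/-- The functional `φ ↦ ⟨F^{(k)}(φ), P^{⊗k} G^{(k)}(φ)⟩` for `F`, `G` with disjoint supports. As the
distributions `F^{(k)}(φ)` and `G^{(k)}(φ)` live on the powers of these supports, only the values
of `P(x - y)` for `x` and `y` with a positive distance matter: the expression with `P` cut off near
the origin does not depend on `ε` once `ε` is small, and its value is taken. -/
def contraction {d : ℕ} (P : Space d → ℝ) (k : ℕ) (F G : Functional d) : Functional d := fun φ =>
  Filter.limUnder (𝓝[>] (0 : ℝ)) fun ε =>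
    (funDeriv F k φ).eval fun x => (funDeriv G k φ).eval fun y =>
      ((∏ i, cutKernel P ε (x i - y i) : ℝ) : ℂ)

/-- The Euclidean time-ordered product
`F ·_E G = ∑_k ħ^k / k! ⟨F^{(k)}, P^{⊗k} G^{(k)}⟩` of series with disjoint supports. -/
def timeProd {d : ℕ} (P : Space d → ℝ) (F G : (Functional d)⟦X⟧) : (Functional d)⟦X⟧ :=
  PowerSeries.mk fun N => ∑ q ∈ Finset.HasAntidiagonal.antidiagonal N,
    ∑ p ∈ Finset.HasAntidiagonal.antidiagonal q.2,
      ((q.1.factorial : ℂ)⁻¹) •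
        contraction P q.1 (PowerSeries.coeff p.1 F) (PowerSeries.coeff p.2 G)

/-! ### Time-ordered products of local functionals -/

/-- `F_loc(𝔼)⟦ħ⟧^{⊗k}`, the tensor product over `ℂ⟦ħ⟧`. -/
abbrev LocalTensor (d k : ℕ) : Type := ⨂[ℂ⟦X⟧] _ : Fin k, LocalSeries d

/-- The tensor `F_1 ⊗ ⋯ ⊗ F_k`. -/
abbrev tensor {d k : ℕ} (F : Fin k → LocalSeries d) : LocalTensor d k :=
  PiTensorProduct.tprod ℂ⟦X⟧ F

/-- The tensor `⨂_{i ∈ I} F_i`, with the factors in increasing order of their indices. -/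
abbrev subTensor {d k : ℕ} (F : Fin k → LocalSeries d) (I : Finset (Fin k)) :
    LocalTensor d I.card :=
  tensor fun j => F (I.orderEmbOfFin rfl j)

/-- The `ℂ⟦ħ⟧`-linear maps `F_loc(𝔼)⟦ħ⟧^{⊗k} → F(𝔼)⟦ħ⟧`. -/
abbrev OrderMap (d k : ℕ) : Type := LocalTensor d k →ₗ[ℂ⟦X⟧] CompactSeries d

/-- The factorization property in Euclidean causality, for the value `A` at `F_1 ⊗ ⋯ ⊗ F_k`: if the
supports of `F_i`, `i ∈ I`, are disjoint from those of `F_j`, `j ∈ Iᶜ`, then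
`A = E_{|I|}(⨂_{i ∈ I} F_i) ·_E E_{|Iᶜ|}(⨂_{j ∈ Iᶜ} F_j)`. -/
def Factorizes {d k : ℕ} (P : Space d → ℝ) (E : (j : ℕ) → OrderMap d j)
    (F : Fin k → LocalSeries d) (A : CompactSeries d) : Prop :=
  ∀ I : Finset (Fin k), I.Nonempty → Iᶜ.Nonempty →
    (∀ i ∈ I, ∀ j ∈ Iᶜ, Disjoint (seriesSupport (F i).1) (seriesSupport (F j).1)) →
    A.1 = timeProd P (E I.card (subTensor F I)).1 (E Iᶜ.card (subTensor F Iᶜ)).1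

/-- The induction hypothesis at order `n` on the maps `E_k`, `k < n` (the maps `E_k` with `k ≥ n`
are not restricted and play no role). -/
structure InductionHypothesis {d : ℕ} (P : Space d → ℝ) (n : ℕ)
    (E : (k : ℕ) → OrderMap d k) : Prop where
  order_zero : (E 0 (tensor Fin.elim0)).1 = 1
  order_one : ∀ F : LocalSeries d, (E 1 (tensor fun _ => F)).1 = F.1
  support : ∀ k < n, ∀ F : Fin k → LocalSeries d,
    seriesSupport (E k (tensor F)).1 ⊆ ⋃ i, seriesSupport (F i).1
  symmetric : ∀ k < n, ∀ (π : Equiv.Perm (Fin k)) (F : Fin k → LocalSeries d),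
    E k (tensor (F ∘ π)) = E k (tensor F)
  causal : ∀ k < n, ∀ F : Fin k → LocalSeries d, Factorizes P E F (E k (tensor F))

/-- The support of `F_1 ⊗ ⋯ ⊗ F_n` does not meet the thin diagonal. -/
def OffDiagonal {d n : ℕ} (F : Fin n → LocalSeries d) : Prop :=
  Disjoint (Set.univ.pi fun i => seriesSupport (F i).1) (thinDiag d n)

/-- The space of the finite sums of tensors `F_1 ⊗ ⋯ ⊗ F_n` whose supports do not meet the thin
diagonal. -/
def offDiagTensors (d n : ℕ) : Submodule ℂ⟦X⟧ (LocalTensor d n) :=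
  Submodule.span ℂ⟦X⟧ {t | ∃ F : Fin n → LocalSeries d, OffDiagonal F ∧ tensor F = t}

/-- The tensor `F_1 ⊗ ⋯ ⊗ F_n` as an element of `offDiagTensors`. -/
def offTensor {d n : ℕ} (F : Fin n → LocalSeries d) (hF : OffDiagonal F) : offDiagTensors d n :=
  ⟨tensor F, Submodule.subset_span ⟨F, hF, rfl⟩⟩

end EuclideanEG

end

noncomputable section

namespace EuclideanEG

/-! ### Directional derivatives and the topology of `C^∞` -/

namespace SmoothFn

variable {𝕜 V W : Type} [RCLike 𝕜] [NormedAddCommGroup V] [NormedSpace ℝ V]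
  [NormedAddCommGroup W] [NormedSpace ℝ W]

/-! Two facts carry the proof: causal factorizations along different splittings agree, and local
functionals can be cut into small pieces.

Consistency (`timeProd_partE_eq`). If both `I` and `J` separate the supports, the induction
hypothesis factorizes all four factors further along `I ∩ J`, `I ∩ Jᶜ`, `Iᶜ ∩ J`, `Iᶜ ∩ Jᶜ`. The two
time-ordered products become products of the same four factors, so they agree as soon as the product
is associative and commutative. To a finite order in `ħ` only finitely many compact supports with
positive distances enter, hence `P(x - y)` may be cut off near the diagonal (`timeProd_eventually`).
The result is a smooth kernel, because `P` is smooth off the origin (`IsHelmholtzKernel.contDiffOn`: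
it is radial, and its radial profile is a weak solution of an ordinary differential equation). A
smooth kernel `K` defines a star product for all supports. If `K = ∑ fᵢ ⊗ gᵢ`, it is multiplication
after `exp(ħ ∑ ∂_{fᵢ} ⊗ ∂_{gᵢ})`, and associativity is the exponential law for commuting operators
(`contrBilin_assoc_tensor`); such kernels are dense and contractions depend continuously on `K`
(`contrBilin_assoc`).

Cutting. A tensor whose support misses the thin diagonal need not be separated by any `I`. A local
functional, however, is additive in fields with disjoint supports (`IsLocalFunctional.additive`), so
a partition of unity cuts it into pieces supported in small patches (`funSupport_piece`). If a
choice of patches does not fall into two groups at a positive distance, they all lie in one small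
ball. The supports have no common point, so the ball misses one of them, and the corresponding piece
is zero (`exists_piece_eq_zero`).

Consequently, to every order in `ħ`, a causal map equals the sum `theta` of the products that can be
split (`causal_eqTo_theta`), which gives uniqueness. Conversely `theta` is linear on all tensors
and, by consistency, causal and independent of the partition to order `N` once the partition is fine
enough. Along a sequence of finer and finer partitions it stabilizes in each order, and the limit is
the required map (`exists_causal`). Its support property is inherited from `theta`, its symmetry
follows from uniqueness. -/

@[ext] theorem ext {f g : SmoothFn 𝕜 V} (h : ∀ x, f x = g x) : f = g := DFunLike.ext f g h

@[simp] theorem of_apply (f : V → 𝕜) (hf : ContDiff ℝ ∞ f) (x : V) : of f hf x = f x := rfl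
@[simp] theorem add_apply (f g : SmoothFn 𝕜 V) (x : V) : (f + g) x = f x + g x := rfl
@[simp] theorem sub_apply (f g : SmoothFn 𝕜 V) (x : V) : (f - g) x = f x - g x := rfl
@[simp] theorem neg_apply (f : SmoothFn 𝕜 V) (x : V) : (-f) x = -f x := rfl
@[simp] theorem zero_apply (x : V) : (0 : SmoothFn 𝕜 V) x = 0 := rfl
@[simp] theorem smul_apply (c : 𝕜) (f : SmoothFn 𝕜 V) (x : V) : (c • f) x = c * f x := rfl

/-- Evaluation at a point, as an additive map. -/
def evalHom (x : V) : SmoothFn 𝕜 V →+ 𝕜 where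
  toFun f := f x
  map_zero' := rfl
  map_add' _ _ := rfl

theorem sum_apply {ι : Type*} (s : Finset ι) (f : ι → SmoothFn 𝕜 V) (x : V) :
    (∑ i ∈ s, f i) x = ∑ i ∈ s, f i x := map_sum (evalHom x) f s

theorem differentiable (f : SmoothFn 𝕜 V) : Differentiable ℝ f :=
  f.contDiff.differentiable (by simp)

protected theorem continuous (f : SmoothFn 𝕜 V) : Continuous f := f.contDiff.continuous

/-- The directional derivative. -/
def lineD (v : V) : SmoothFn 𝕜 V →ₗ[𝕜] SmoothFn 𝕜 V where
  toFun f := of (fun x => fderiv ℝ f x v)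
    ((f.contDiff.fderiv_right (m := ∞) (by exact_mod_cast le_rfl)).clm_apply contDiff_const)
  map_add' f g := by
    ext x
    change fderiv ℝ (⇑f + ⇑g) x v = _
    rw [fderiv_add (f.differentiable x) (g.differentiable x)]
    rfl
  map_smul' c f := by
    ext x
    change fderiv ℝ (c • ⇑f) x v = _
    rw [fderiv_const_smul (f.differentiable x)]
    rfl

theorem lineD_apply (v : V) (f : SmoothFn 𝕜 V) (x : V) : lineD v f x = fderiv ℝ f x v := rfl

theorem hasDerivAt_line (f : SmoothFn 𝕜 V) (x v : V) (t : ℝ) :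
    HasDerivAt (fun s : ℝ => f (x + s • v)) (lineD v f (x + t • v)) t := by
  have h1 : HasDerivAt (fun s : ℝ => x + s • v) v t := by
    simpa using ((hasDerivAt_id t).smul_const v).const_add x
  exact (f.differentiable _).hasFDerivAt.comp_hasDerivAt t h1

theorem lineD_eq_of_hasDerivAt {f : SmoothFn 𝕜 V} {x v : V} {a : 𝕜}
    (h : HasDerivAt (fun s : ℝ => f (x + s • v)) a 0) : lineD v f x = a := by
  have := f.hasDerivAt_line x v 0
  rw [zero_smul, add_zero] at this
  exact this.unique h

/-- Iterated directional derivatives. -/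
def lineDs : List V → SmoothFn 𝕜 V →ₗ[𝕜] SmoothFn 𝕜 V
  | [] => LinearMap.id
  | v :: L => lineDs L ∘ₗ lineD v

@[simp] theorem lineDs_nil (f : SmoothFn 𝕜 V) : lineDs [] f = f := rfl
@[simp] theorem lineDs_cons (v : V) (L : List V) (f : SmoothFn 𝕜 V) :
    lineDs (v :: L) f = lineDs L (lineD v f) := rfl

theorem iteratedFDeriv_lineD (f : SmoothFn 𝕜 V) (v : V) (n : ℕ) (x : V) (m : Fin n → V) :
    iteratedFDeriv ℝ n (lineD v f) x m = iteratedFDeriv ℝ (n + 1) f x (Fin.snoc m v) := by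
  rw [iteratedFDeriv_succ_apply_right, Fin.init_snoc, Fin.snoc_last]
  have h : (⇑(lineD v f) : V → 𝕜) =
      (ContinuousLinearMap.apply ℝ 𝕜 v) ∘ (fun y => fderiv ℝ f y) := rfl
  rw [h, ContinuousLinearMap.iteratedFDeriv_comp_left (n := ∞) _
    (f.contDiff.fderiv_right (m := ∞) (by exact_mod_cast le_rfl)).contDiffAt
    (by exact_mod_cast le_top)]
  rfl

/-- In finite dimensions pointwise and norm continuity of linear maps coincide; currying off one
variable at a time extends this to multilinear maps. -/
theorem continuous_multilinear_apply {T : Type*} [TopologicalSpace T] [FiniteDimensional ℝ V]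
    {n : ℕ} {g : T → V [×n]→L[ℝ] 𝕜} (h : ∀ m, Continuous fun t => g t m) : Continuous g := by
  induction n with
  | zero =>
    have : g = fun t => (continuousMultilinearCurryFin0 ℝ V 𝕜).symm (g t ![]) := by
      funext t
      rw [LinearIsometryEquiv.eq_symm_apply]
      simp [Matrix.empty_eq]
    rw [this]
    exact (LinearIsometryEquiv.continuous _).comp (h _)
  | succ n ih =>
    have h2 : Continuous fun t => continuousMultilinearCurryLeftEquiv ℝ (fun _ => V) 𝕜 (g t) := by
      rw [continuous_clm_apply]
      intro v
      refine ih fun m => ?_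
      simpa using h (Fin.cons v m)
    have h3 := (continuousMultilinearCurryLeftEquiv ℝ
      (fun _ : Fin (n + 1) => V) 𝕜).symm.continuous.comp h2
    exact h3.congr fun t => LinearIsometryEquiv.symm_apply_apply _ _

/-- The exponential law for the compact-open topology: since `V` is locally compact, continuity into
`C(V, ·)` is joint continuity of the uncurried map. -/
theorem continuous_iff_iteratedFDeriv {T : Type*} [TopologicalSpace T] [FiniteDimensional ℝ V]
    {Φ : T → SmoothFn 𝕜 V} : Continuous Φ ↔
      ∀ n (m : Fin n → V), Continuous fun p : T × V => iteratedFDeriv ℝ n (Φ p.1) p.2 m := by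
  constructor
  · intro h n m
    have h1 : Continuous (derivMap (𝕜 := 𝕜) (V := V) n) :=
      continuous_iInf_dom (i := n) continuous_induced_dom
    have h2 : Continuous fun p : T × V => (derivMap n (Φ p.1)) p.2 :=
      continuous_eval.comp ((h1.comp (h.comp continuous_fst)).prodMk continuous_snd)
    exact (ContinuousMultilinearMap.apply ℝ (fun _ => V) 𝕜 m).continuous.comp h2
  · intro h
    refine continuous_iInf_rng.2 fun n => continuous_induced_rng.2 ?_
    exact ContinuousMap.continuous_of_continuous_uncurry _ (continuous_multilinear_apply (h n))

/-- The working criterion for the Fréchet topology. Iterated directional derivatives determine the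
full derivatives, and unlike these they commute well with products, compositions and slices, so that
continuity proofs become inductions on the list `L`. -/
theorem continuous_iff {T : Type*} [TopologicalSpace T] [FiniteDimensional ℝ V]
    {Φ : T → SmoothFn 𝕜 V} : Continuous Φ ↔
      ∀ L : List V, Continuous fun p : T × V => lineDs L (Φ p.1) p.2 := by
  rw [continuous_iff_iteratedFDeriv]
  constructor
  · intro h L
    induction L generalizing Φ with
    | nil => simpa using h 0 ![]
    | cons v L ih =>
      refine ih (Φ := fun t => lineD v (Φ t)) fun n m => ?_
      simpa [iteratedFDeriv_lineD] using h (n + 1) (Fin.snoc m v)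
  · intro h n m
    induction n generalizing Φ with
    | zero => simpa using h []
    | succ n ih =>
      have := ih (Φ := fun t => lineD (m (Fin.last n)) (Φ t)) (fun L => h (_ :: L)) (Fin.init m)
      simpa [iteratedFDeriv_lineD] using this

variable {T : Type*} [TopologicalSpace T] [FiniteDimensional ℝ V] [FiniteDimensional ℝ W]

theorem continuous_eval_prod {Φ : T → SmoothFn 𝕜 V} (h : Continuous Φ) :
    Continuous fun p : T × V => Φ p.1 p.2 := continuous_iff.1 h []

theorem continuous_lineD (v : V) : Continuous (lineD v : SmoothFn 𝕜 V → SmoothFn 𝕜 V) :=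
  continuous_iff.2 fun L => continuous_iff.1 continuous_id (v :: L)

theorem continuous_lineDs (L : List V) : Continuous (lineDs L : SmoothFn 𝕜 V → SmoothFn 𝕜 V) := by
  induction L with
  | nil => exact continuous_id
  | cons v L ih => exact ih.comp (continuous_lineD v)

instance : ContinuousAdd (SmoothFn 𝕜 V) := ⟨continuous_iff.2 fun L => by
  simp only [map_add, add_apply]
  exact ((continuous_iff.1 continuous_id L).comp
    ((continuous_fst.comp continuous_fst).prodMk continuous_snd)).add
    ((continuous_iff.1 continuous_id L).comp
    ((continuous_snd.comp continuous_fst).prodMk continuous_snd))⟩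

instance : ContinuousSMul 𝕜 (SmoothFn 𝕜 V) := ⟨continuous_iff.2 fun L => by
  simp only [map_smul, smul_apply]
  exact (continuous_fst.comp continuous_fst).mul ((continuous_iff.1 continuous_id L).comp
    ((continuous_snd.comp continuous_fst).prodMk continuous_snd))⟩

instance : IsTopologicalAddGroup (SmoothFn 𝕜 V) where
  continuous_neg := by
    have : (fun f : SmoothFn 𝕜 V => -f) = fun f => (-1 : 𝕜) • f := by funext f; simp
    rw [this]
    exact continuous_const_smul _

/-! ### Multiplication and composition -/

instance : Mul (SmoothFn 𝕜 V) := ⟨fun f g => of (fun x => f x * g x) (f.contDiff.mul g.contDiff)⟩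
instance : One (SmoothFn 𝕜 V) := ⟨of (fun _ => 1) contDiff_const⟩

omit [FiniteDimensional ℝ V] in
@[simp] theorem mul_apply (f g : SmoothFn 𝕜 V) (x : V) : (f * g) x = f x * g x := rfl
omit [FiniteDimensional ℝ V] in
@[simp] theorem one_apply (x : V) : (1 : SmoothFn 𝕜 V) x = 1 := rfl

omit [FiniteDimensional ℝ V] in
theorem lineD_mul (v : V) (f g : SmoothFn 𝕜 V) :
    lineD v (f * g) = lineD v f * g + f * lineD v g := by
  ext x
  refine lineD_eq_of_hasDerivAt ?_
  have := (f.hasDerivAt_line x v 0).mul (g.hasDerivAt_line x v 0)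
  simp only [zero_smul, add_zero] at this
  exact this

theorem continuous_mul {Φ Ψ : T → SmoothFn 𝕜 V} (hΦ : Continuous Φ) (hΨ : Continuous Ψ) :
    Continuous fun t => Φ t * Ψ t := by
  refine continuous_iff.2 fun L => ?_
  induction L generalizing Φ Ψ with
  | nil => exact (continuous_eval_prod hΦ).mul (continuous_eval_prod hΨ)
  | cons v L ih =>
    simp only [lineDs_cons, lineD_mul, map_add, add_apply]
    exact (ih ((continuous_lineD v).comp hΦ) hΨ).add (ih hΦ ((continuous_lineD v).comp hΨ))

/-- Composition with a linear map. -/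
def comp (ρ : V →L[ℝ] W) : SmoothFn 𝕜 W →ₗ[𝕜] SmoothFn 𝕜 V where
  toFun f := of (fun x => f (ρ x)) (f.contDiff.comp ρ.contDiff)
  map_add' _ _ := rfl
  map_smul' _ _ := rfl

omit [FiniteDimensional ℝ V] [FiniteDimensional ℝ W] in
@[simp] theorem comp_apply (ρ : V →L[ℝ] W) (f : SmoothFn 𝕜 W) (x : V) : comp ρ f x = f (ρ x) := rfl

omit [FiniteDimensional ℝ V] [FiniteDimensional ℝ W] in
theorem lineD_comp (ρ : V →L[ℝ] W) (v : V) (f : SmoothFn 𝕜 W) :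
    lineD v (comp ρ f) = comp ρ (lineD (ρ v) f) := by
  ext x
  refine lineD_eq_of_hasDerivAt ?_
  simpa using f.hasDerivAt_line (ρ x) (ρ v) 0

omit [FiniteDimensional ℝ V] [FiniteDimensional ℝ W] in
theorem lineDs_comp (ρ : V →L[ℝ] W) (L : List V) (f : SmoothFn 𝕜 W) :
    lineDs L (comp ρ f) = comp ρ (lineDs (L.map ρ) f) := by
  induction L generalizing f with
  | nil => rfl
  | cons v L ih => simp only [lineDs_cons, lineD_comp, ih, List.map_cons]

theorem continuous_comp (ρ : V →L[ℝ] W) :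
    Continuous (comp ρ : SmoothFn 𝕜 W → SmoothFn 𝕜 V) := by
  refine continuous_iff.2 fun L => ?_
  simp only [lineDs_comp, comp_apply]
  exact (continuous_iff.1 continuous_id (L.map ρ)).comp
    (continuous_fst.prodMk (ρ.continuous.comp continuous_snd))

end SmoothFn
end EuclideanEG

/-! ### Calculus along lines -/

namespace EuclideanEG
open Filter

/-- The mean value inequality on the segment from `x` to `x + w`, applied to `G` minus its candidate
linear part, whose derivative is small because `l` is norm continuous. -/
theorem hasFDerivAt_of_continuous_directional {V : Type} [NormedAddCommGroup V] [NormedSpace ℝ V]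
    [FiniteDimensional ℝ V] {G : V → ℂ} {l : V → V →L[ℝ] ℂ} (hl : ∀ w, Continuous fun x => l x w)
    (h : ∀ x w, HasDerivAt (fun t : ℝ => G (x + t • w)) (l x w) 0) (x : V) :
    HasFDerivAt G (l x) x := by
  have hlc : Continuous l := continuous_clm_apply.2 hl
  rw [hasFDerivAt_iff_isLittleO_nhds_zero, Asymptotics.isLittleO_iff]
  intro c hc
  obtain ⟨δ, hδ, hball⟩ := Metric.continuousAt_iff.1 hlc.continuousAt c hc
  filter_upwards [Metric.ball_mem_nhds (0 : V) hδ] with w hw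
  rw [mem_ball_zero_iff] at hw
  have hd : ∀ t : ℝ, HasDerivAt (fun t : ℝ => G (x + t • w) - t • l x w)
      (l (x + t • w) w - l x w) t := by
    intro t
    have h1 := h (x + t • w) w
    have h2 : HasDerivAt (fun s : ℝ => G (x + s • w)) (l (x + t • w) w) t := by
      have h3 : HasDerivAt (fun s : ℝ => s - t) 1 t := by simpa using (hasDerivAt_id t).sub_const t
      have h4 := HasDerivAt.scomp (h := fun s : ℝ => s - t) t (by simpa using h1) h3
      rw [one_smul] at h4
      refine h4.congr_of_eventuallyEq (Eventually.of_forall fun s => ?_)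
      simp only [Function.comp]
      congr 1
      rw [sub_smul]
      abel
    exact (h2.sub ((hasDerivAt_id t).smul_const (l x w))).congr_deriv (by simp)
  have key := (convex_Icc (0 : ℝ) 1).norm_image_sub_le_of_norm_hasDerivWithin_le
    (C := c * ‖w‖) (fun t _ => (hd t).hasDerivWithinAt) (fun t ht => ?_)
    (Set.left_mem_Icc.2 zero_le_one) (Set.right_mem_Icc.2 zero_le_one)
  · simpa [sub_right_comm] using key
  · rw [← sub_apply]
    refine (ContinuousLinearMap.le_opNorm _ _).trans ?_
    gcongr
    have := hball (x := x + t • w) (by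
      rw [dist_eq_norm, add_sub_cancel_left, norm_smul, Real.norm_of_nonneg ht.1]
      exact (mul_le_of_le_one_left (norm_nonneg _) ht.2).trans_lt hw)
    rw [dist_eq_norm] at this
    exact this.le

/-- Hadamard's formula: the difference quotient is the integral of `a'(s t, x)` over `s` in the unit
interval, which is jointly continuous also across `t = 0`. -/
theorem continuous_dslope_of_hasDerivAt {X : Type*} [TopologicalSpace X] {a a' : ℝ → X → ℂ}
    (h : ∀ t x, HasDerivAt (fun s => a s x) (a' t x) t)
    (h' : Continuous fun p : ℝ × X => a' p.1 p.2) :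
    Continuous fun p : ℝ × X => dslope (fun s => a s p.2) 0 p.1 := by
  have key : (fun p : ℝ × X => dslope (fun s => a s p.2) 0 p.1) =
      fun p : ℝ × X => ∫ s in (0 : ℝ)..1, a' (s * p.1) p.2 := by
    funext ⟨t, x⟩
    rcases eq_or_ne t 0 with rfl | ht
    · simp [dslope_same, (h 0 x).deriv]
    · have hc : Continuous fun s : ℝ => a' s x := h'.comp (by fun_prop : Continuous fun s => (s, x))
      have := intervalIntegral.integral_unitInterval_deriv_eq_sub (𝕜 := ℝ)
        (f := fun s => a s x) (f' := fun s => a' s x) (z₀ := 0) (z₁ := t)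
        (hc.comp (by fun_prop)).continuousOn (fun s _ => h _ x)
      simp only [zero_add, smul_eq_mul] at this
      rw [dslope_of_ne _ ht, slope_def_module, sub_zero, ← this, smul_smul, inv_mul_cancel₀ ht,
        one_smul]
  rw [key]
  refine intervalIntegral.continuous_parametric_intervalIntegral_of_continuous' ?_ 0 1
  exact h'.comp (by fun_prop : Continuous fun p : (ℝ × X) × ℝ => (p.2 * p.1.1, p.1.2))

/-! ### Functions of two variables and curves in the space of smooth functions -/

namespace SmoothFn

variable {𝕜 V W : Type} [RCLike 𝕜] [NormedAddCommGroup V] [NormedSpace ℝ V]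
  [NormedAddCommGroup W] [NormedSpace ℝ W]

theorem lineD_comm (v w : V) (f : SmoothFn 𝕜 V) : lineD v (lineD w f) = lineD w (lineD v f) := by
  have key : ∀ v w x, lineD v (lineD w f) x = fderiv ℝ (fderiv ℝ f) x v w := by
    intro v w x
    have hd : DifferentiableAt ℝ (fderiv ℝ f) x :=
      (f.contDiff.fderiv_right (m := ∞) (by exact_mod_cast le_rfl)).differentiable (by simp) x
    have : HasFDerivAt (fun y => fderiv ℝ f y w)
        ((ContinuousLinearMap.apply ℝ 𝕜 w).comp (fderiv ℝ (fderiv ℝ f) x)) x :=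
      (ContinuousLinearMap.apply ℝ 𝕜 w).hasFDerivAt.comp x hd.hasFDerivAt
    change fderiv ℝ (fun y => fderiv ℝ f y w) x v = _
    rw [this.fderiv]
    rfl
  ext x
  rw [key, key]
  exact (f.contDiff.contDiffAt.isSymmSndFDerivAt (by
    simp only [minSmoothness_of_isRCLikeNormedField]
    exact WithTop.coe_le_coe.2 (le_top : (2 : ℕ∞) ≤ ⊤))) v w

theorem lineDs_lineD (v : V) (L : List V) (f : SmoothFn 𝕜 V) :
    lineDs L (lineD v f) = lineD v (lineDs L f) := by
  induction L generalizing f with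
  | nil => rfl
  | cons w L ih => rw [lineDs_cons, lineDs_cons, lineD_comm, ih]

/-- The function `f(x, ·)`. -/
def snd (x : V) : SmoothFn 𝕜 (V × W) →ₗ[𝕜] SmoothFn 𝕜 W where
  toFun f := of (fun y => f (x, y)) (f.contDiff.comp (contDiff_const.prodMk contDiff_id))
  map_add' _ _ := rfl
  map_smul' _ _ := rfl

@[simp] theorem snd_apply (x : V) (f : SmoothFn 𝕜 (V × W)) (y : W) : snd x f y = f (x, y) := rfl

theorem lineD_snd (x : V) (w : W) (f : SmoothFn 𝕜 (V × W)) :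
    lineD w (snd x f) = snd x (lineD (0, w) f) := by
  ext y
  refine lineD_eq_of_hasDerivAt ?_
  simpa using f.hasDerivAt_line (x, y) (0, w) 0

theorem lineDs_snd (x : V) (L : List W) (f : SmoothFn 𝕜 (V × W)) :
    lineDs L (snd x f) = snd x (lineDs (L.map fun w => (0, w)) f) := by
  induction L generalizing f with
  | nil => rfl
  | cons v L ih => simp only [lineDs_cons, lineD_snd, ih, List.map_cons]

variable {T : Type*} [TopologicalSpace T] [FiniteDimensional ℝ V] [FiniteDimensional ℝ W]

theorem continuous_snd {Φ : T → SmoothFn 𝕜 (V × W)} (hΦ : Continuous Φ) {ξ : T → V}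
    (hξ : Continuous ξ) : Continuous fun t => snd (ξ t) (Φ t) := by
  refine continuous_iff.2 fun L => ?_
  simp only [lineDs_snd, snd_apply]
  exact (continuous_iff.1 hΦ _).comp
    (continuous_fst.prodMk ((hξ.comp continuous_fst).prodMk _root_.continuous_snd))

/-- By Hadamard's formula for each iterated directional derivative, the difference quotient extends
continuously to `t = 0`. Thus pointwise differentiability with a continuous derivative gives
convergence in the Fréchet topology. -/
theorem tendsto_slope {c c' : ℝ → SmoothFn ℂ V} (hc' : Continuous c')
    (h : ∀ L t x, HasDerivAt (fun s => lineDs L (c s) x) (lineDs L (c' t) x) t) :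
    Tendsto (fun t : ℝ => (t : ℂ)⁻¹ • (c t - c 0)) (𝓝[≠] 0) (𝓝 (c' 0)) := by
  set q : ℝ → SmoothFn ℂ V := fun t => if t = 0 then c' 0 else (t : ℂ)⁻¹ • (c t - c 0) with hq
  have hqc : Continuous q := by
    refine continuous_iff.2 fun L => ?_
    convert continuous_dslope_of_hasDerivAt (h L) (continuous_iff.1 hc' L) using 2 with p
    rcases eq_or_ne p.1 0 with hp | hp
    · simp [hq, hp, (h L 0 p.2).deriv]
    · simp [hq, hp, dslope_of_ne, slope_def_module]
  have : Tendsto q (𝓝[≠] 0) (𝓝 (q 0)) := hqc.continuousAt.continuousWithinAt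
  simp only [hq, if_true] at this
  refine this.congr' ?_
  filter_upwards [self_mem_nhdsWithin] with t ht
  exact if_neg ht

/-- The product rule for the pairing: the increment is `(D t - D 0)(c 0) + D t (c t - c 0)`, and
joint continuity gives the limit of the second quotient. -/
theorem hasDerivAt_apply {D : ℝ → CDist V}
    (hD : Continuous fun p : ℝ × SmoothFn ℂ V => D p.1 p.2) {c c' : ℝ → SmoothFn ℂ V}
    (hc' : Continuous c')
    (h : ∀ L t x, HasDerivAt (fun s => lineDs L (c s) x) (lineDs L (c' t) x) t) {a : ℂ}
    (ha : HasDerivAt (fun t => D t (c 0)) a 0) :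
    HasDerivAt (fun t => D t (c t)) (a + D 0 (c' 0)) 0 := by
  rw [hasDerivAt_iff_tendsto_slope] at ha ⊢
  have h1 : Tendsto (fun t : ℝ => D t ((t : ℂ)⁻¹ • (c t - c 0))) (𝓝[≠] 0) (𝓝 (D 0 (c' 0))) :=
    (hD.tendsto (0, c' 0)).comp
      ((tendsto_id.mono_left nhdsWithin_le_nhds).prodMk_nhds (tendsto_slope hc' h))
  refine (ha.add h1).congr fun t => ?_
  simp only [slope_def_module, map_smul, map_sub, smul_eq_mul, sub_zero, Complex.real_smul,
    Complex.ofReal_inv]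
  ring

/-! ### Distributions applied to one of two variables -/

omit [FiniteDimensional ℝ V] [FiniteDimensional ℝ W] in
theorem hasDerivAt_lineDs_snd (f : SmoothFn 𝕜 (V × W)) (x w : V) (L : List W) (t : ℝ) (y : W) :
    HasDerivAt (fun s : ℝ => lineDs L (snd (x + s • w) f) y)
      (lineDs L (snd (x + t • w) (lineD (w, 0) f)) y) t := by
  simp only [lineDs_snd, snd_apply, lineDs_lineD]
  simpa using (lineDs (L.map fun w => ((0 : V), w)) f).hasDerivAt_line (x, y) (w, 0) t

theorem hasDerivAt_apply_snd (u : CDist W) (f : SmoothFn ℂ (V × W)) (x w : V) :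
    HasDerivAt (fun t : ℝ => u (snd (x + t • w) f)) (u (snd x (lineD (w, 0) f))) 0 := by
  have := hasDerivAt_apply (D := fun _ => u) (u.continuous.comp _root_.continuous_snd)
    (c := fun t : ℝ => snd (x + t • w) f) (c' := fun t : ℝ => snd (x + t • w) (lineD (w, 0) f))
    (continuous_snd continuous_const (by fun_prop))
    (fun L t y => hasDerivAt_lineDs_snd f x w L t y) (hasDerivAt_const _ _)
  simpa using this

omit [FiniteDimensional ℝ V] [FiniteDimensional ℝ W] in
theorem lineD_add_left (v w : V) (f : SmoothFn 𝕜 V) : lineD (v + w) f = lineD v f + lineD w f := by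
  ext x
  simp [lineD_apply]

omit [FiniteDimensional ℝ V] [FiniteDimensional ℝ W] in
theorem lineD_smul_left (c : ℝ) (v : V) (f : SmoothFn 𝕜 V) :
    lineD (c • v) f = (c : 𝕜) • lineD v f := by
  ext x
  simp [lineD_apply, RCLike.real_smul_eq_coe_mul]

/-- Differentiation under the distribution: a directional derivative in `x` is again of the form `u
(snd x g)` with another smooth `g`, so one derivative at a time suffices. -/
theorem contDiff_apply_snd (u : CDist W) (f : SmoothFn ℂ (V × W)) :
    ContDiff ℝ ∞ fun x => u (snd x f) := by
  have hd : ∀ f : SmoothFn ℂ (V × W), ∀ x, ∃ l : V →L[ℝ] ℂ,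
      (∀ w, l w = u (snd x (lineD (w, 0) f))) ∧ HasFDerivAt (fun x => u (snd x f)) l x := by
    intro f
    let l : V → V →L[ℝ] ℂ := fun x => LinearMap.toContinuousLinearMap
      { toFun := fun w => u (snd x (lineD (w, 0) f))
        map_add' := fun v w => by
          rw [← map_add, ← map_add, ← lineD_add_left, Prod.mk_add_mk, add_zero]
        map_smul' := fun c w => by
          rw [RingHom.id_apply, Complex.real_smul, ← smul_eq_mul, ← map_smul, ← map_smul]
          have := lineD_smul_left c (w, (0 : W)) f
          rw [Prod.smul_mk, smul_zero] at this
          rw [this]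
          rfl }
    -- The candidate `l` is linear because directional derivatives are linear in the direction; its
    -- continuity in `x` makes it the Fréchet derivative.
    refine fun x => ⟨l x, fun w => rfl, hasFDerivAt_of_continuous_directional ?_ ?_ x⟩
    · intro w
      exact u.continuous.comp (continuous_snd continuous_const continuous_id)
    · intro x w
      exact hasDerivAt_apply_snd u f x w
  refine contDiff_infty.2 fun n => ?_
  induction n generalizing f with
  | zero =>
    refine contDiff_zero.2 (continuous_iff_continuousAt.2 fun x => ?_)
    obtain ⟨l, -, hl⟩ := hd f x
    exact hl.continuousAt
  | succ n ih =>
    push_cast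
    refine contDiff_succ_iff_fderiv_apply.2 ⟨fun x => ?_, by simp, fun y => ?_⟩
    · obtain ⟨l, -, hl⟩ := hd f x
      exact hl.differentiableAt
    · have : (fun x => fderiv ℝ (fun x => u (snd x f)) x y) =
          fun x => u (snd x (lineD (y, 0) f)) := by
        funext x
        obtain ⟨l, hl', hl⟩ := hd f x
        rw [hl.fderiv, hl']
      rw [this]
      exact ih _

/-- A distribution in the second variable applied to a function of two variables. -/
def slice (u : CDist W) : SmoothFn ℂ (V × W) →ₗ[ℂ] SmoothFn ℂ V where
  toFun f := of (fun x => u (snd x f)) (contDiff_apply_snd u f)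
  map_add' f g := by ext x; simp
  map_smul' c f := by ext x; simp

@[simp] theorem slice_apply (u : CDist W) (f : SmoothFn ℂ (V × W)) (x : V) :
    slice u f x = u (snd x f) := rfl

theorem lineD_slice (u : CDist W) (v : V) (f : SmoothFn ℂ (V × W)) :
    lineD v (slice u f) = slice u (lineD (v, 0) f) := by
  ext x
  exact lineD_eq_of_hasDerivAt (hasDerivAt_apply_snd u f x v)

theorem lineDs_slice (u : CDist W) (L : List V) (f : SmoothFn ℂ (V × W)) :
    lineDs L (slice u f) = slice u (lineDs (L.map fun v => (v, 0)) f) := by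
  induction L generalizing f with
  | nil => rfl
  | cons v L ih => simp only [lineDs_cons, lineD_slice, ih, List.map_cons]

theorem continuous_slice {D : T → CDist W}
    (hD : Continuous fun p : T × SmoothFn ℂ W => D p.1 p.2) {Φ : T → SmoothFn ℂ (V × W)}
    (hΦ : Continuous Φ) : Continuous fun t => slice (D t) (Φ t) := by
  refine continuous_iff.2 fun L => ?_
  simp only [lineDs_slice, slice_apply]
  exact hD.comp (continuous_fst.prodMk
    (continuous_snd ((continuous_lineDs _).comp (hΦ.comp continuous_fst)) _root_.continuous_snd))

/-! ### Cutoffs -/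

/-- A real-valued function as a `𝕜`-valued one. -/
def ofReal (f : SmoothFn ℝ V) : SmoothFn 𝕜 V :=
  of (fun x => (f x : 𝕜)) ((RCLike.ofRealCLM (K := 𝕜)).contDiff.comp f.contDiff)

omit [FiniteDimensional ℝ V] in
@[simp] theorem ofReal_apply (f : SmoothFn ℝ V) (x : V) : (ofReal f : SmoothFn 𝕜 V) x = f x := rfl

/-- A bump function with the given inner and outer radius. -/
def bump (c : V) (r R : ℝ) (hr : 0 < r) (hR : r < R) : SmoothFn ℝ V :=
  of (⟨r, R, hr, hR⟩ : ContDiffBump c) (ContDiffBump.contDiff _)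

theorem tsupport_bump (c : V) (r R : ℝ) (hr : 0 < r) (hR : r < R) :
    tsupport (bump c r R hr hR) = Metric.closedBall c R :=
  ContDiffBump.tsupport_eq (⟨r, R, hr, hR⟩ : ContDiffBump c)

theorem bump_eq_one (c : V) (r R : ℝ) (hr : 0 < r) (hR : r < R) {x : V}
    (hx : x ∈ Metric.closedBall c r) : bump c r R hr hR x = 1 :=
  ContDiffBump.one_of_mem_closedBall (⟨r, R, hr, hR⟩ : ContDiffBump c) hx

/-- The cutoffs `χ(s x)` are smooth jointly in `s` and `x`, so the convergence of `χ(s ·) f` to `f`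
as `s → 0` is continuity at `s = 0`, where `χ(0) = 1`. -/
theorem tendsto_cutoff (f : SmoothFn 𝕜 V) : ∃ c : ℝ → SmoothFn 𝕜 V, Tendsto c (𝓝[≠] 0) (𝓝 f) ∧
    ∀ s ≠ 0, HasCompactSupport (c s) ∧ tsupport (c s) ⊆ tsupport f := by
  let χ : SmoothFn ℝ V := bump 0 1 2 one_pos one_lt_two
  let g : SmoothFn ℝ (ℝ × V) := of (fun p => χ (p.1 • p.2)) (χ.contDiff.comp (by fun_prop))
  let g' : SmoothFn 𝕜 (ℝ × V) := ofReal g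
  refine ⟨fun s => snd s g' * f, ?_, fun s hs => ⟨?_, tsupport_mul_subset_right⟩⟩
  · have h : Continuous fun s : ℝ => snd s g' * f :=
      continuous_mul (continuous_snd continuous_const continuous_id) continuous_const
    have h0 : snd (0 : ℝ) g' * f = f := by
      ext x
      have : χ 0 = 1 := bump_eq_one _ _ _ _ _ (by simp)
      simp [g', g, this]
    exact Filter.Tendsto.mono_left (by simpa only [h0] using h.tendsto 0) nhdsWithin_le_nhds
  · refine HasCompactSupport.mul_right (f' := f) ?_
    have hχ : HasCompactSupport χ := by
      rw [HasCompactSupport, tsupport_bump]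
      exact isCompact_closedBall _ _
    have := (hχ.comp_homeomorph (Homeomorph.smulOfNeZero s hs)).comp_left
      (g := fun r : ℝ => (r : 𝕜)) (by simp)
    exact this

omit [FiniteDimensional ℝ V] in
theorem tsupport_mul_one_sub (b c : SmoothFn ℝ V) :
    tsupport (b + c * (1 - b) : SmoothFn ℝ V) ⊆ tsupport b ∪ tsupport c :=
  (tsupport_add _ _).trans (Set.union_subset_union_right _ tsupport_mul_subset_left)

/-- Induction over compact sets. The combination `b + c (1 - b)` is `1` wherever `b` or `c` is, and
its product with `h` splits into the pieces of `h` and of `(1 - b) h`. -/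
theorem exists_decomposition {S : Set V} (hS : IsCompact S) {U : V → Set V}
    (hU : ∀ x ∈ S, U x ∈ 𝓝 x) : ∃ b : SmoothFn ℝ V, (∀ᶠ x in 𝓝ˢ S, b x = 1) ∧
      tsupport b ⊆ (⋃ x ∈ S, U x) ∧ ∀ h : SmoothFn 𝕜 V,
        ofReal b * h ∈ AddSubmonoid.closure {g : SmoothFn 𝕜 V | ∃ x ∈ S, tsupport g ⊆ U x} := by
  refine hS.induction_on (p := fun S' => ∃ b : SmoothFn ℝ V, (∀ᶠ x in 𝓝ˢ S', b x = 1) ∧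
      tsupport b ⊆ (⋃ x ∈ S, U x) ∧ ∀ h : SmoothFn 𝕜 V,
        ofReal b * h ∈ AddSubmonoid.closure {g : SmoothFn 𝕜 V | ∃ x ∈ S, tsupport g ⊆ U x})
    ?_ ?_ ?_ ?_
  · refine ⟨0, by simp, ?_, fun h => ?_⟩
    · have : (⇑(0 : SmoothFn ℝ V)) = fun _ => 0 := rfl
      simp [this, tsupport]
    · convert AddSubmonoid.zero_mem _
      ext x
      simp
  · rintro s t hst ⟨b, h1, h2⟩
    exact ⟨b, h1.filter_mono (nhdsSet_mono hst), h2⟩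
  · rintro s t ⟨b, h1, h2, h3⟩ ⟨c, h1', h2', h3'⟩
    refine ⟨b + c * (1 - b), ?_, (tsupport_mul_one_sub b c).trans (Set.union_subset h2 h2'),
      fun h => ?_⟩
    · rw [nhdsSet_union, eventually_sup]
      refine ⟨h1.mono fun x hx => by simp [hx], h1'.mono fun x hx => by simp [hx]⟩
    · have : (ofReal (b + c * (1 - b)) * h : SmoothFn 𝕜 V) =
          ofReal b * h + ofReal c * (ofReal (1 - b) * h) := by
        ext x
        simp
        ring
      rw [this]
      exact AddSubmonoid.add_mem _ (h3 _) (h3' _)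
  · intro x hx
    obtain ⟨R, hR, hRU⟩ := Metric.nhds_basis_closedBall.mem_iff.1 (hU x hx)
    have hsupp := tsupport_bump x (R / 2) R (half_pos hR) (half_lt_self hR)
    refine ⟨Metric.ball x (R / 2), mem_nhdsWithin_of_mem_nhds
      (Metric.ball_mem_nhds x (half_pos hR)), bump x (R / 2) R (half_pos hR) (half_lt_self hR),
      ?_, ?_, fun h => ?_⟩
    · rw [Metric.isOpen_ball.nhdsSet_eq]
      exact fun y hy => bump_eq_one _ _ _ _ _ (Metric.ball_subset_closedBall hy)
    · rw [hsupp]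
      exact hRU.trans (Set.subset_biUnion_of_mem hx)
    · refine AddSubmonoid.subset_closure ⟨x, hx, ?_⟩
      refine (tsupport_mul_subset_left (f := fun y => ((bump x (R / 2) R (half_pos hR)
        (half_lt_self hR) y : ℝ) : 𝕜)) (g := h)).trans ((closure_mono ?_).trans (hsupp.subset.trans hRU))
      exact Function.support_comp_subset (by simp) _

theorem exists_cutoff {S O : Set V} (hS : IsCompact S) (hO : IsOpen O) (h : S ⊆ O) :
    ∃ b : SmoothFn ℝ V, (∀ᶠ x in 𝓝ˢ S, b x = 1) ∧ tsupport b ⊆ O := by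
  obtain ⟨b, h1, h2, -⟩ := exists_decomposition (𝕜 := ℝ) hS (U := fun _ => O)
    fun x hx => hO.mem_nhds (h hx)
  exact ⟨b, h1, h2.trans (by simp)⟩

/-- This passes from test functions with small supports to all compactly supported ones, both for
supports of functionals and for supports of distributions. -/
theorem mem_addSubmonoid_closure {h : SmoothFn 𝕜 V} (hh : HasCompactSupport h) {U : V → Set V}
    (hU : ∀ x ∈ tsupport h, U x ∈ 𝓝 x) :
    h ∈ AddSubmonoid.closure {g : SmoothFn 𝕜 V | ∃ x ∈ tsupport h, tsupport g ⊆ U x} := by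
  obtain ⟨b, h1, -, h3⟩ := exists_decomposition (𝕜 := 𝕜) hh hU
  have : ofReal b * h = h := by
    ext x
    by_cases hx : x ∈ tsupport h
    · simp [h1.self_of_nhdsSet x hx]
    · simp [image_eq_zero_of_notMem_tsupport hx]
  have h3' := h3 h
  rw [this] at h3'
  exact h3'

end SmoothFn
end EuclideanEG

namespace EuclideanEG
open Filter MeasureTheory

namespace SmoothFn

/-! ### Density of tensor products -/

section Convolution

variable {𝕜 V : Type} [RCLike 𝕜] [NormedAddCommGroup V] [NormedSpace ℝ V]

theorem hasCompactSupport_lineD {f : SmoothFn 𝕜 V} (hf : HasCompactSupport f) (v : V) :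
    HasCompactSupport (lineD v f) :=
  (hf.fderiv ℝ).comp_left (g := fun l : V →L[ℝ] 𝕜 => l v) rfl

theorem hasCompactSupport_lineDs {f : SmoothFn 𝕜 V} (hf : HasCompactSupport f) (L : List V) :
    HasCompactSupport (lineDs L f) := by
  induction L generalizing f with
  | nil => exact hf
  | cons v L ih => exact ih (hasCompactSupport_lineD hf v)

variable [FiniteDimensional ℝ V] [MeasurableSpace V] [BorelSpace V] (μ : Measure V)
  [μ.IsAddHaarMeasure]

/-- The convolution with a compactly supported function. -/
def conv (ρ : SmoothFn ℝ V) (f : SmoothFn 𝕜 V) (hf : HasCompactSupport f) : SmoothFn 𝕜 V :=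
  of (convolution ρ f (ContinuousLinearMap.lsmul ℝ ℝ) μ)
    (hf.contDiff_convolution_right _ ρ.continuous.locallyIntegrable f.contDiff)

theorem conv_apply (ρ : SmoothFn ℝ V) (f : SmoothFn 𝕜 V) (hf : HasCompactSupport f) (x : V) :
    conv μ ρ f hf x = ∫ t, ρ t • f (x - t) ∂μ := rfl

theorem conv_apply' (ρ : SmoothFn ℝ V) (f : SmoothFn 𝕜 V) (hf : HasCompactSupport f) (x : V) :
    conv μ ρ f hf x = ∫ t, ρ (x - t) • f t ∂μ :=
  convolution_lsmul_swap

theorem lineD_conv (ρ : SmoothFn ℝ V) (f : SmoothFn 𝕜 V) (hf : HasCompactSupport f) (v : V) :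
    lineD v (conv μ ρ f hf) = conv μ ρ (lineD v f) (hasCompactSupport_lineD hf v) := by
  ext x
  have h := hf.hasFDerivAt_convolution_right (𝕜 := ℝ) (μ := μ) (ContinuousLinearMap.lsmul ℝ ℝ)
    ρ.continuous.locallyIntegrable (f.contDiff.of_le (by exact_mod_cast le_top)) x
  change fderiv ℝ (convolution ρ f (ContinuousLinearMap.lsmul ℝ ℝ) μ) x v = _
  rw [h.fderiv, convolution_precompR_apply _ ρ.continuous.locallyIntegrable (hf.fderiv ℝ)
    (f.contDiff.continuous_fderiv (by simp))]
  rfl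

/-- Derivatives may fall on either factor. On `f` they show that mollification converges
(`tendsto_conv`); on `ρ` they show that the convolution is a superposition of translates of `ρ` in
all derivatives (`conv_mem_closure`). -/
theorem lineD_conv' (ρ : SmoothFn ℝ V) (hρ : HasCompactSupport ρ) (f : SmoothFn 𝕜 V)
    (hf : HasCompactSupport f) (v : V) :
    lineD v (conv μ ρ f hf) = conv μ (lineD v ρ) f hf := by
  ext x
  have h := hρ.hasFDerivAt_convolution_right (𝕜 := ℝ) (μ := μ)
    (ContinuousLinearMap.lsmul ℝ ℝ : ℝ →L[ℝ] 𝕜 →L[ℝ] 𝕜).flip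
    f.continuous.locallyIntegrable (ρ.contDiff.of_le (by exact_mod_cast le_top)) x
  rw [convolution_flip] at h
  change fderiv ℝ (convolution ρ f (ContinuousLinearMap.lsmul ℝ ℝ) μ) x v = _
  rw [h.fderiv, convolution_precompR_apply _ f.continuous.locallyIntegrable (hρ.fderiv ℝ)
    (ρ.contDiff.continuous_fderiv (by simp)), convolution_flip]
  rfl

theorem lineDs_conv (ρ : SmoothFn ℝ V) (f : SmoothFn 𝕜 V) (hf : HasCompactSupport f) (L : List V) :
    lineDs L (conv μ ρ f hf) = conv μ ρ (lineDs L f) (hasCompactSupport_lineDs hf L) := by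
  induction L generalizing f with
  | nil => rfl
  | cons v L ih => simp only [lineDs_cons, lineD_conv, ih]

theorem lineDs_conv' (ρ : SmoothFn ℝ V) (hρ : HasCompactSupport ρ) (f : SmoothFn 𝕜 V)
    (hf : HasCompactSupport f) (L : List V) :
    lineDs L (conv μ ρ f hf) = conv μ (lineDs L ρ) f hf := by
  induction L generalizing ρ with
  | nil => rfl
  | cons v L ih =>
    simp only [lineDs_cons, lineD_conv' μ ρ hρ, ih _ (hasCompactSupport_lineD hρ v)]

end Convolution

section Density

variable {𝕜 V W : Type} [RCLike 𝕜] [NormedAddCommGroup V] [NormedSpace ℝ V]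
  [NormedAddCommGroup W] [NormedSpace ℝ W]

/-- The function `f(· - b)`. -/
def shift (b : V) (f : SmoothFn 𝕜 V) : SmoothFn 𝕜 V :=
  of (fun x => f (x - b)) (f.contDiff.comp (contDiff_id.sub contDiff_const))

@[simp] theorem shift_apply (b : V) (f : SmoothFn 𝕜 V) (x : V) : shift b f x = f (x - b) := rfl

theorem lineDs_shift (b : V) (L : List V) (f : SmoothFn 𝕜 V) :
    lineDs L (shift b f) = shift b (lineDs L f) := by
  induction L generalizing f with
  | nil => rfl
  | cons v L ih =>
    rw [lineDs_cons, lineDs_cons, ← ih]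
    congr 1
    ext x
    refine lineD_eq_of_hasDerivAt ?_
    have := f.hasDerivAt_line (x - b) v 0
    simpa [sub_add_eq_add_sub] using this

theorem lineDs_ofReal (L : List V) (f : SmoothFn ℝ V) :
    lineDs L (ofReal f : SmoothFn 𝕜 V) = ofReal (lineDs L f) := by
  induction L generalizing f with
  | nil => rfl
  | cons v L ih =>
    rw [lineDs_cons, lineDs_cons, ← ih]
    congr 1
    ext x
    refine lineD_eq_of_hasDerivAt ?_
    have := (RCLike.ofRealCLM (K := 𝕜)).hasFDerivAt.comp_hasDerivAt 0 (f.hasDerivAt_line x v 0)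
    simp only [zero_smul, add_zero] at this
    exact this

variable [FiniteDimensional ℝ V] [FiniteDimensional ℝ W]

/-- By `continuous_iff`, the topology induced by all iterated directional derivatives, as continuous
functions, is at least as fine as that of `C^∞(V)`. -/
theorem tendsto_of_locallyUniformly {ι : Type*} {l : Filter ι} {Φ : ι → SmoothFn 𝕜 V}
    {f : SmoothFn 𝕜 V}
    (h : ∀ L, TendstoLocallyUniformly (fun i x => lineDs L (Φ i) x) (lineDs L f) l) :
    Tendsto Φ l (𝓝 f) := by
  let J : SmoothFn 𝕜 V → List V → C(V, 𝕜) := fun f L => ⟨lineDs L f, (lineDs L f).continuous⟩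
  have hJ : @Continuous _ _ (TopologicalSpace.induced J inferInstance) inferInstance
      (id : SmoothFn 𝕜 V → SmoothFn 𝕜 V) := by
    let := TopologicalSpace.induced J inferInstance
    refine continuous_iff.2 fun L => ?_
    have h1 : Continuous fun f => J f L := (continuous_apply L).comp
      (continuous_induced_dom (f := J))
    exact continuous_eval.comp ((h1.comp continuous_fst).prodMk _root_.continuous_snd)
  have h2 := @Continuous.tendsto _ _ (TopologicalSpace.induced J inferInstance) _ _ hJ f
  refine h2.comp (f := Φ) ?_
  rw [nhds_induced, tendsto_comap_iff, tendsto_pi_nhds]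
  exact fun L => ContinuousMap.tendsto_iff_tendstoLocallyUniformly.2 (h L)

theorem mem_closure_of_approx {M : Set (SmoothFn 𝕜 V)} {f : SmoothFn 𝕜 V}
    (h : ∀ (S : Finset (List V)) (K : Set V), IsCompact K → ∀ ε > 0, ∃ g ∈ M, ∀ L ∈ S, ∀ x ∈ K,
      ‖lineDs L g x - lineDs L f x‖ < ε) : f ∈ closure M := by
  classical
  choose g hgM hg using fun p : Finset (List V) × ℕ =>
    h p.1 (Metric.closedBall 0 p.2) (isCompact_closedBall _ _) (1 / ((p.2 : ℝ) + 1)) (by positivity)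
  refine mem_closure_of_tendsto (f := g) (b := atTop) (tendsto_of_locallyUniformly fun L => ?_)
    (Eventually.of_forall hgM)
  rw [tendstoLocallyUniformly_iff_forall_isCompact]
  intro K hK
  rw [Metric.tendstoUniformlyOn_iff]
  intro ε hε
  obtain ⟨R, hR⟩ := hK.isBounded.subset_closedBall 0
  obtain ⟨n, hn⟩ := exists_nat_one_div_lt hε
  obtain ⟨n', hn'⟩ := exists_nat_ge R
  filter_upwards [eventually_ge_atTop (({L} : Finset (List V)), max n n')] with p hp x hx
  rw [dist_comm, dist_eq_norm]
  refine (hg p L (hp.1 (Finset.mem_singleton_self L)) x ?_).trans ?_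
  · refine Metric.closedBall_subset_closedBall ?_ (hR hx)
    exact hn'.trans (by exact_mod_cast (le_max_right n n').trans hp.2)
  · refine lt_of_le_of_lt ?_ hn
    have : (n : ℝ) ≤ p.2 := by exact_mod_cast (le_max_left n n').trans hp.2
    gcongr

/-- The convolution is the integral of the translates `ρ(· - b)` with weights `f(b)`, and an
integral of elements of a closed subspace stays in it. -/
theorem conv_mem_closure [MeasurableSpace V] [BorelSpace V] (μ : Measure V) [μ.IsAddHaarMeasure]
    (ρ : SmoothFn ℝ V) (hρ : HasCompactSupport ρ) (f : SmoothFn 𝕜 V) (hf : HasCompactSupport f)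
    (M : Submodule 𝕜 (SmoothFn 𝕜 V)) (hM : ∀ b, (ofReal (shift b ρ) : SmoothFn 𝕜 V) ∈ M) :
    conv μ ρ f hf ∈ closure (M : Set (SmoothFn 𝕜 V)) := by
  refine mem_closure_of_approx fun S K hK ε hε => ?_
  have : CompactSpace K := isCompact_iff_compactSpace.1 hK
  -- Only finitely many derivatives on one compact set are observed, so the integral can be taken in
  -- a Banach space of continuous functions.
  let J : SmoothFn 𝕜 V →ₗ[𝕜] (S → C(K, 𝕜)) :=
    { toFun := fun g L => ⟨fun x => lineDs L.1 g x, (lineDs L.1 g).continuous.comp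
        continuous_subtype_val⟩
      map_add' := fun g h => by ext L x; simp
      map_smul' := fun c g => by ext L x; simp }
  let N : Submodule 𝕜 (S → C(K, 𝕜)) := (M.map J).topologicalClosure
  let Φ : V → SmoothFn 𝕜 V := fun b => f b • ofReal (shift b ρ)
  have hΦ : ∀ b, J (Φ b) ∈ N := fun b => Submodule.le_topologicalClosure _
    (Submodule.mem_map_of_mem (M.smul_mem _ (hM b)))
  have happly : ∀ b (L : S) (x : K), J (Φ b) L x = f b * ((lineDs L.1 ρ (x - b) : ℝ) : 𝕜) := by
    intro b L x
    change lineDs L.1 (Φ b) x = _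
    simp only [Φ, map_smul, lineDs_ofReal, lineDs_shift, smul_apply, ofReal_apply, shift_apply]
  let Ψ : V → N := fun b => ⟨J (Φ b), hΦ b⟩
  have hΨ : Continuous Ψ := by
    refine Continuous.subtype_mk (continuous_pi fun L =>
      ContinuousMap.continuous_of_continuous_uncurry _ ?_) _
    have : (Function.uncurry fun b (x : K) => J (Φ b) L x) =
        fun p : V × K => f p.1 * ((lineDs L.1 ρ (p.2 - p.1) : ℝ) : 𝕜) := by
      funext p
      exact happly _ _ _
    rw [this]
    have h1 := f.continuous
    have h2 := (lineDs L.1 ρ).continuous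
    fun_prop
  have hΨc : HasCompactSupport Ψ := by
    refine HasCompactSupport.intro hf fun b hb => Subtype.ext ?_
    change J (f b • _) = 0
    rw [image_eq_zero_of_notMem_tsupport hb, zero_smul, map_zero]
  have hint : Integrable Ψ μ := hΨ.integrable_of_hasCompactSupport hΨc
  have : CompleteSpace N := (Submodule.isClosed_topologicalClosure _).completeSpace_coe
  have key : J (conv μ ρ f hf) = ((∫ b, Ψ b ∂μ : N) : S → C(K, 𝕜)) := by
    funext L
    ext x
    let ev : N →L[𝕜] 𝕜 := (ContinuousMap.evalCLM 𝕜 x).comp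
      ((ContinuousLinearMap.proj L).comp N.subtypeL)
    have := ev.integral_comp_comm hint
    change _ = ev (∫ b, Ψ b ∂μ)
    rw [← this]
    change lineDs L.1 (conv μ ρ f hf) x = ∫ b, J (Φ b) L x ∂μ
    rw [lineDs_conv' μ ρ hρ, conv_apply']
    refine integral_congr_ae (Eventually.of_forall fun b => ?_)
    simp only [happly, RCLike.real_smul_eq_coe_mul]
    ring
  have hmem : J (conv μ ρ f hf) ∈ closure (M.map J : Set (S → C(K, 𝕜))) :=
    key ▸ (∫ b, Ψ b ∂μ : N).2
  obtain ⟨_, ⟨g, hg, rfl⟩, hd⟩ := Metric.mem_closure_iff.1 hmem ε hε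
  refine ⟨g, hg, fun L hL x hx => ?_⟩
  rw [dist_comm, dist_eq_norm] at hd
  have h1 := (norm_le_pi_norm (J g - J (conv μ ρ f hf)) ⟨L, hL⟩).trans_lt hd
  exact (ContinuousMap.norm_coe_le_norm ((J g - J (conv μ ρ f hf)) ⟨L, hL⟩) ⟨x, hx⟩).trans_lt h1

theorem tendsto_conv [MeasurableSpace V] [BorelSpace V] (μ : Measure V) [μ.IsAddHaarMeasure]
    {ρ : ℕ → SmoothFn ℝ V} (h0 : ∀ n x, 0 ≤ ρ n x) (h1 : ∀ n, ∫ x, ρ n x ∂μ = 1) {R : ℕ → ℝ}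
    (hR : Tendsto R atTop (𝓝 0)) (hρR : ∀ n, Function.support (ρ n) ⊆ Metric.ball 0 (R n))
    (f : SmoothFn 𝕜 V) (hf : HasCompactSupport f) :
    Tendsto (fun n => conv μ (ρ n) f hf) atTop (𝓝 f) := by
  refine tendsto_of_locallyUniformly fun L => TendstoUniformly.tendstoLocallyUniformly ?_
  have huc := (hasCompactSupport_lineDs hf L).uniformContinuous_of_continuous
    (lineDs L f).continuous
  rw [Metric.tendstoUniformly_iff]
  intro ε hε
  obtain ⟨δ, hδ, hd⟩ := Metric.uniformContinuous_iff.1 huc (ε / 2) (half_pos hε)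
  filter_upwards [hR.eventually (gt_mem_nhds hδ)] with n hn x
  rw [lineDs_conv, dist_comm]
  refine (dist_convolution_le (half_pos hε).le (hρR n) (h0 n) (h1 n)
    (lineDs L f).continuous.aestronglyMeasurable fun y hy => (hd ?_).le).trans_lt (half_lt_self hε)
  exact (Metric.mem_ball.1 hy).trans hn

/-- The function `g(x) h(y)`. -/
def tensorMul (g : SmoothFn ℝ V) (h : SmoothFn 𝕜 W) : SmoothFn 𝕜 (V × W) :=
  comp (ContinuousLinearMap.fst ℝ V W) (ofReal g) * comp (ContinuousLinearMap.snd ℝ V W) h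

omit [FiniteDimensional ℝ V] [FiniteDimensional ℝ W] in
@[simp] theorem tensorMul_apply (g : SmoothFn ℝ V) (h : SmoothFn 𝕜 W) (p : V × W) :
    tensorMul g h p = g p.1 * h p.2 := rfl

/-- Mollification with a product of two bump functions: all translates of such a mollifier are again
products, so the mollified functions lie in the closed span of the tensors. -/
theorem mem_closure_tensors_of_hasCompactSupport (f : SmoothFn 𝕜 (V × W))
    (hf : HasCompactSupport f) :
    f ∈ closure (Submodule.span 𝕜 (Set.range fun p : SmoothFn ℝ V × SmoothFn 𝕜 W =>
      tensorMul p.1 p.2) : Set (SmoothFn 𝕜 (V × W))) := by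
  set M := Submodule.span 𝕜 (Set.range fun p : SmoothFn ℝ V × SmoothFn 𝕜 W =>
      tensorMul p.1 p.2) with hM
  let : MeasurableSpace (V × W) := borel _
  have : BorelSpace (V × W) := ⟨rfl⟩
  let μ : Measure (V × W) := Measure.addHaar
  let r : ℕ → ℝ := fun n => 1 / ((n : ℝ) + 1)
  have hr : ∀ n, 0 < r n := fun n => by positivity
  let bV : ℕ → SmoothFn ℝ V := fun n => bump 0 (r n) (2 * r n) (hr n) (by linarith [hr n])
  let bW : ℕ → SmoothFn ℝ W := fun n => bump 0 (r n) (2 * r n) (hr n) (by linarith [hr n])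
  let τ : ℕ → SmoothFn ℝ (V × W) := fun n => tensorMul (bV n) (bW n)
  have hτs : ∀ n, Function.support (τ n) ⊆ Metric.closedBall 0 (2 * r n) := by
    intro n p hp
    have h1 : bV n p.1 ≠ 0 := fun h => hp (by simp [τ, h])
    have h2 : bW n p.2 ≠ 0 := fun h => hp (by simp [τ, h])
    have h1' : p.1 ∈ Metric.closedBall 0 (2 * r n) :=
      tsupport_bump (0 : V) (r n) (2 * r n) (hr n) (by linarith [hr n]) ▸ subset_tsupport _ h1
    have h2' : p.2 ∈ Metric.closedBall 0 (2 * r n) :=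
      tsupport_bump (0 : W) (r n) (2 * r n) (hr n) (by linarith [hr n]) ▸ subset_tsupport _ h2
    rw [mem_closedBall_zero_iff] at h1' h2' ⊢
    exact max_le h1' h2'
  have hτc : ∀ n, HasCompactSupport (τ n) := fun n =>
    HasCompactSupport.of_support_subset_isCompact (isCompact_closedBall _ _) (hτs n)
  have hτ0 : ∀ n x, 0 ≤ τ n x := fun n x => mul_nonneg (ContDiffBump.nonneg _)
    (ContDiffBump.nonneg _)
  have hI : ∀ n, 0 < ∫ x, τ n x ∂μ := fun n =>
    (τ n).continuous.integral_pos_of_hasCompactSupport_nonneg_nonzero (hτc n) (hτ0 n) (x := 0) (by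
      have h1 : bV n 0 = 1 := bump_eq_one _ _ _ _ _ (by simp [(hr n).le])
      have h2 : bW n 0 = 1 := bump_eq_one _ _ _ _ _ (by simp [(hr n).le])
      simp [τ, h1, h2])
  let ρ : ℕ → SmoothFn ℝ (V × W) := fun n => (∫ x, τ n x ∂μ)⁻¹ • τ n
  have hlim : Tendsto (fun n => conv μ (ρ n) f hf) atTop (𝓝 f) := by
    -- The bump functions live in closed balls of radius `2 r n`; the factor `3` provides the open
    -- ball that is required.
    refine tendsto_conv μ (fun n x => mul_nonneg (inv_nonneg.2 (hI n).le) (hτ0 n x)) (fun n => ?_)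
      (R := fun n => 3 * r n) ?_ (fun n => ?_) f hf
    · change ∫ x, (∫ x, τ n x ∂μ)⁻¹ * τ n x ∂μ = 1
      rw [integral_const_mul, inv_mul_cancel₀ (hI n).ne']
    · simpa [r] using tendsto_one_div_add_atTop_nhds_zero_nat.const_mul (3 : ℝ)
    · refine (Function.support_const_smul_subset _ _).trans ((hτs n).trans ?_)
      exact Metric.closedBall_subset_ball (by linarith [hr n])
  refine isClosed_closure.mem_of_tendsto hlim (Eventually.of_forall fun n => ?_)
  refine conv_mem_closure μ (ρ n) ?_ f hf M fun b => ?_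
  · exact (hτc n).mono (Function.support_const_smul_subset _ _)
  · have : (ofReal (shift b (ρ n)) : SmoothFn 𝕜 (V × W)) = (((∫ x, τ n x ∂μ : ℝ)⁻¹ : ℝ) : 𝕜) •
        tensorMul (shift b.1 (bV n)) (ofReal (shift b.2 (bW n))) := by
      ext x
      simp [ρ, τ]
    rw [this]
    exact M.smul_mem _ (Submodule.subset_span ⟨(_, _), rfl⟩)

theorem dense_tensors : Dense (Submodule.span 𝕜 (Set.range fun p : SmoothFn ℝ V × SmoothFn 𝕜 W =>
      tensorMul p.1 p.2) : Set (SmoothFn 𝕜 (V × W))) := by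
  intro f
  obtain ⟨c, hc, hs⟩ := tendsto_cutoff f
  refine isClosed_closure.mem_of_tendsto hc ?_
  filter_upwards [self_mem_nhdsWithin] with s hs'
  exact mem_closure_tensors_of_hasCompactSupport _ (hs s hs').1

end Density

end SmoothFn
end EuclideanEG

namespace EuclideanEG
open Filter SmoothFn

variable {d : ℕ}

/-! ### Uniqueness of functional derivatives -/

/-- Splitting off the first variable. -/
def splitHead (d n : ℕ) : (Fin (n + 1) → Space d) →L[ℝ] Space d × (Fin n → Space d) :=
  (ContinuousLinearMap.proj 0).prod (ContinuousLinearMap.pi fun i => ContinuousLinearMap.proj i.succ)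

/-- Adding a first variable. -/
def joinHead (d n : ℕ) : Space d × (Fin n → Space d) →L[ℝ] (Fin (n + 1) → Space d) :=
  ContinuousLinearMap.pi (Fin.cons (ContinuousLinearMap.fst ℝ _ _)
    fun i => (ContinuousLinearMap.proj i).comp (ContinuousLinearMap.snd ℝ _ _))

@[simp] theorem splitHead_apply {n : ℕ} (x : Fin (n + 1) → Space d) :
    splitHead d n x = (x 0, Fin.tail x) := rfl

@[simp] theorem joinHead_apply {n : ℕ} (p : Space d × (Fin n → Space d)) :
    joinHead d n p = Fin.cons p.1 p.2 := by
  funext i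
  refine Fin.cases ?_ (fun i => ?_) i <;> rfl

@[simp] theorem headTensor_apply {n : ℕ} (h : Config d) (f : SmoothFn ℂ (Fin n → Space d))
    (x : Fin (n + 1) → Space d) : headTensor h f x = h (x 0) * f (Fin.tail x) := rfl

/-- Density of the products `k ⊗ f`, transported along the splitting of the first variable. -/
theorem CDist.ext_headTensor {n : ℕ} {u v : CDist (Fin (n + 1) → Space d)}
    (h : ∀ k f, u (headTensor k f) = v (headTensor k f)) : u = v := by
  have hc : Continuous (comp (𝕜 := ℂ) (splitHead d n)) := continuous_comp _
  have key : (fun g => u (comp (splitHead d n) g)) = fun g => v (comp (splitHead d n) g) := by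
    refine Continuous.ext_on dense_tensors (u.continuous.comp hc) (v.continuous.comp hc) ?_
    intro g hg
    induction hg using Submodule.span_induction with
    | mem g hg =>
      obtain ⟨⟨k, f⟩, rfl⟩ := hg
      exact h k f
    | zero => simp
    | add g g' _ _ h1 h2 => simp only [map_add, h1, h2]
    | smul c g _ h1 => simp only [map_smul, h1]
  ext f
  have hf : comp (splitHead d n) (comp (joinHead d n) f) = f := by
    ext x
    simp
  rw [← hf]
  exact congrFun key _

namespace IsFunDeriv

variable {F G : Functional d} {D D' : (n : ℕ) → Config d → CDist (Fin n → Space d)}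

theorem hasDerivAt (hD : IsFunDeriv F D) (n : ℕ) (φ h : Config d)
    (f : SmoothFn ℂ (Fin n → Space d)) (t : ℝ) :
    HasDerivAt (fun s : ℝ => D n (φ + s • h) f) (D (n + 1) (φ + t • h) (headTensor h f)) t := by
  have h1 := hD.succ n (φ + t • h) h f
  have h3 : HasDerivAt (fun s : ℝ => s - t) 1 t := by simpa using (hasDerivAt_id t).sub_const t
  have h4 := HasDerivAt.scomp (h := fun s : ℝ => s - t) t (by simpa using h1) h3
  rw [one_smul] at h4
  refine h4.congr_of_eventuallyEq (Eventually.of_forall fun s => ?_)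
  simp only [Function.comp]
  congr 2
  rw [sub_smul]
  abel

/-- The defining relation fixes the next derivative on all products `k ⊗ f`, and these determine it.
Hence the choice in `funDeriv` does not matter, and identities between functional derivatives follow
by exhibiting a second family of derivatives. -/
theorem unique (hD : IsFunDeriv F D) (hD' : IsFunDeriv F D') : D = D' := by
  funext n
  induction n with
  | zero =>
    funext φ
    ext f
    rw [hD.zero, hD'.zero]
  | succ n ih =>
    funext φ
    refine CDist.ext_headTensor fun k f => ?_
    have h1 := hD.succ n φ k f
    rw [ih] at h1
    exact h1.unique (hD'.succ n φ k f)

theorem funDeriv_eq (hD : IsFunDeriv F D) : funDeriv F = D := by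
  have h : ∃ D, IsFunDeriv F D := ⟨D, hD⟩
  rw [funDeriv, dif_pos h]
  exact h.choose_spec.unique hD

theorem apply_eq (hD : IsFunDeriv F D) (φ : Config d) : F φ = D 0 φ 1 := by
  rw [hD.zero]
  simp

theorem continuous (hD : IsFunDeriv F D) : Continuous F := by
  have : F = fun φ => D 0 φ 1 := funext hD.apply_eq
  rw [this]
  exact (hD.cont 0).comp (continuous_id.prodMk continuous_const)

theorem hasDerivAt_apply (hD : IsFunDeriv F D) (φ h : Config d) (t : ℝ) :
    HasDerivAt (fun s : ℝ => F (φ + s • h)) (D 1 (φ + t • h) (headTensor h 1)) t := by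
  simpa only [hD.apply_eq] using hD.hasDerivAt 0 φ h 1 t

end IsFunDeriv

theorem funDeriv_spec {F : Functional d} (h : ∃ D, IsFunDeriv F D) : IsFunDeriv F (funDeriv F) := by
  obtain ⟨D, hD⟩ := h
  rwa [hD.funDeriv_eq]

/-! ### Supports -/

theorem isClosed_funSupport (F : Functional d) : IsClosed (funSupport F) := by
  rw [← isOpen_compl_iff, isOpen_iff_mem_nhds]
  intro x hx
  simp only [funSupport, Set.mem_compl_iff, Set.mem_ofPred_eq, not_forall] at hx
  obtain ⟨U, hU, h⟩ := hx
  filter_upwards [eventually_mem_nhds_iff.2 hU] with y hy hy'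
  exact h (hy' U hy)

theorem IsCompactFunctional.isCompact {F : Functional d} (hF : IsCompactFunctional F) :
    IsCompact (funSupport F) := by
  obtain ⟨-, K, hK, h⟩ := hF
  exact hK.of_isClosed_subset (isClosed_funSupport F) h

/-- The definition of the support controls only variations near one point. A partition of unity
writes a compactly supported `h` as a finite sum of such variations; a general `h` is a limit of
cutoffs supported in `tsupport h`, and `F` is continuous. -/
theorem apply_add_of_disjoint {F : Functional d} (hF : Continuous F) {h : Config d}
    (hd : Disjoint (tsupport h) (funSupport F)) (φ : Config d) : F (φ + h) = F φ := by
  have hcpt : ∀ h : Config d, HasCompactSupport h → Disjoint (tsupport h) (funSupport F) →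
      ∀ φ, F (φ + h) = F φ := by
    intro h hh hd
    have : ∀ x ∈ tsupport h, ∃ U ∈ 𝓝 x, ∀ φ g : Config d, tsupport g ⊆ U → F (φ + g) = F φ := by
      intro x hx
      have := Set.disjoint_left.1 hd hx
      simp only [funSupport, Set.mem_ofPred_eq, not_forall] at this
      obtain ⟨U, hU, hUF⟩ := this
      push Not at hUF
      exact ⟨U, hU, hUF⟩
    choose! U hU hUF using this
    refine AddSubmonoid.closure_induction (motive := fun g _ => ∀ φ, F (φ + g) = F φ) ?_ ?_ ?_
      (mem_addSubmonoid_closure hh hU)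
    · rintro g ⟨x, hx, hg⟩ φ
      exact hUF x hx φ g hg
    · intro φ
      rw [add_zero]
    · intro g g' _ _ h1 h2 φ
      rw [← add_assoc, h2, h1]
  obtain ⟨c, hc, hs⟩ := tendsto_cutoff h
  have h1 : Tendsto (fun s => F (φ + c s)) (𝓝[≠] 0) (𝓝 (F (φ + h))) :=
    (hF.tendsto _).comp (hc.const_add φ)
  refine tendsto_nhds_unique h1 (tendsto_const_nhds.congr' ?_)
  filter_upwards [self_mem_nhdsWithin] with s hs'
  exact (hcpt _ (hs s hs').1 (hd.mono_left (hs s hs').2) φ).symm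

theorem CDist.apply_eq_zero {V : Type} [NormedAddCommGroup V] [NormedSpace ℝ V]
    [FiniteDimensional ℝ V] (u : CDist V) {f : SmoothFn ℂ V}
    (hd : Disjoint (tsupport f) (Distribution.dsupport (u : SmoothFn ℂ V → ℂ))) : u f = 0 := by
  have hcpt : ∀ f : SmoothFn ℂ V, HasCompactSupport f →
      Disjoint (tsupport f) (Distribution.dsupport (u : SmoothFn ℂ V → ℂ)) → u f = 0 := by
    intro f hf hd
    have : ∀ x ∈ tsupport f, ∃ U ∈ 𝓝 x, ∀ g : SmoothFn ℂ V, tsupport g ⊆ U → u g = 0 := by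
      intro x hx
      obtain ⟨s, hs, hso, hxs⟩ := (Distribution.notMem_dsupport_iff x).1 (Set.disjoint_left.1 hd hx)
      exact ⟨s, hso.mem_nhds hxs, hs⟩
    choose! U hU hUF using this
    refine AddSubmonoid.closure_induction (motive := fun g _ => u g = 0) ?_ ?_ ?_
      (mem_addSubmonoid_closure hf hU)
    · rintro g ⟨x, hx, hg⟩
      exact hUF x hx g hg
    · exact map_zero u
    · intro g g' _ _ h1 h2
      rw [map_add, h1, h2, add_zero]
  obtain ⟨c, hc, hs⟩ := tendsto_cutoff f
  refine tendsto_nhds_unique ((u.continuous.tendsto _).comp hc) (tendsto_const_nhds.congr' ?_)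
  filter_upwards [self_mem_nhdsWithin] with s hs'
  exact (hcpt _ (hs s hs').1 (hd.mono_left (hs s hs').2)).symm

/-- The derivatives at the shifted field are also functional derivatives of `F`, which does not
change under the shift; uniqueness applies. -/
theorem IsFunDeriv.apply_add_of_disjoint {F : Functional d}
    {D : (n : ℕ) → Config d → CDist (Fin n → Space d)} (hD : IsFunDeriv F D) {h : Config d}
    (hd : Disjoint (tsupport h) (funSupport F)) (n : ℕ) (φ : Config d) : D n (φ + h) = D n φ := by
  have hF := EuclideanEG.apply_add_of_disjoint hD.continuous hd
  have : IsFunDeriv F (fun n φ => D n (φ + h)) :=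
    { zero := fun φ f => by rw [hD.zero, hF]
      succ := fun n φ k f => by
        have := hD.succ n (φ + h) k f
        simpa only [add_right_comm] using this
      symm := fun n φ σ f => hD.symm n (φ + h) σ f
      cont := fun n => (hD.cont n).comp
        ((continuous_fst.add continuous_const).prodMk _root_.continuous_snd) }
  exact congrFun (congrFun (this.unique hD) n) φ

/-! ### Multiplying the field with a function -/

/-- The functional `φ ↦ F(s φ)`. -/
def pull (s : Config d) : Functional d →ₗ[ℂ] Functional d where
  toFun F φ := F (s * φ)
  map_add' _ _ := rfl
  map_smul' _ _ := rfl

@[simp] theorem pull_apply (s : Config d) (F : Functional d) (φ : Config d) :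
    pull s F φ = F (s * φ) := rfl

/-- The function `s(x₁) ⋯ s(xₙ)`. -/
def tpow (s : Config d) (n : ℕ) : SmoothFn ℂ (Fin n → Space d) :=
  of (fun x => ∏ i, (s (x i) : ℂ)) (contDiff_prod fun i _ =>
    Complex.ofRealCLM.contDiff.comp (s.contDiff.comp (contDiff_apply ℝ (Space d) i)))

@[simp] theorem tpow_apply (s : Config d) (n : ℕ) (x : Fin n → Space d) :
    tpow s n x = ∏ i, (s (x i) : ℂ) := rfl

/-- Multiplication with a smooth function. -/
def mulCLM {V : Type} [NormedAddCommGroup V] [NormedSpace ℝ V] [FiniteDimensional ℝ V]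
    (g : SmoothFn ℂ V) : SmoothFn ℂ V →L[ℂ] SmoothFn ℂ V where
  toFun f := g * f
  map_add' a b := by ext x; simp [mul_add]
  map_smul' c a := by ext x; simp [mul_left_comm]
  cont := continuous_mul continuous_const continuous_id

@[simp] theorem mulCLM_apply {V : Type} [NormedAddCommGroup V] [NormedSpace ℝ V]
    [FiniteDimensional ℝ V] (g f : SmoothFn ℂ V) : mulCLM g f = g * f := rfl

theorem SmoothFn.mul_add_config (s φ ψ : Config d) : s * (φ + ψ) = s * φ + s * ψ := by
  ext x
  simp [mul_add]

theorem SmoothFn.mul_smul_config (s φ : Config d) (t : ℝ) : s * t • φ = t • (s * φ) := by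
  ext x
  simp [mul_left_comm]

theorem headTensor_mul_tpow {n : ℕ} (s h : Config d) (f : SmoothFn ℂ (Fin n → Space d)) :
    headTensor (s * h) (tpow s n * f) = tpow s (n + 1) * headTensor h f := by
  ext x
  simp only [headTensor_apply, SmoothFn.mul_apply, tpow_apply, Fin.prod_univ_succ, Fin.tail]
  push_cast
  ring

theorem permute_tpow_mul {n : ℕ} (s : Config d) (σ : Equiv.Perm (Fin n))
    (f : SmoothFn ℂ (Fin n → Space d)) : tpow s n * permute σ f = permute σ (tpow s n * f) := by
  ext x
  change (∏ i, (s (x i) : ℂ)) * f (x ∘ σ) = (∏ i, (s (x (σ i)) : ℂ)) * f (x ∘ σ)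
  rw [Equiv.prod_comp σ fun i => (s (x i) : ℂ)]

/-- The chain rule: each direction `h` is replaced by `s h`, which puts a factor `s` on every
variable of the test function. -/
theorem IsFunDeriv.pull {F : Functional d} {D : (n : ℕ) → Config d → CDist (Fin n → Space d)}
    (hD : IsFunDeriv F D) (s : Config d) :
    IsFunDeriv (pull s F) fun n φ => (D n (s * φ)).comp (mulCLM (tpow s n)) where
  zero φ f := by
    simp [hD.zero]
  succ n φ h f := by
    have := hD.succ n (s * φ) (s * h) (tpow s n * f)
    simpa only [ContinuousLinearMap.comp_apply, mulCLM_apply, mul_add_config, mul_smul_config,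
      headTensor_mul_tpow] using this
  symm n φ σ f := by
    simp only [ContinuousLinearMap.comp_apply, mulCLM_apply, permute_tpow_mul, hD.symm]
  cont n := (hD.cont n).comp ((continuous_mul continuous_const continuous_fst).prodMk
    ((mulCLM (tpow s n)).continuous.comp _root_.continuous_snd))

theorem funSupport_pull (s : Config d) (F : Functional d) :
    funSupport (pull s F) ⊆ funSupport F := by
  intro x hx U hU
  obtain ⟨φ, h, hh, hne⟩ := hx U hU
  refine ⟨s * φ, s * h, tsupport_mul_subset_right.trans hh, ?_⟩
  rwa [← mul_add_config]

theorem IsCompactFunctional.pull {F : Functional d} (hF : IsCompactFunctional F) (s : Config d) :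
    IsCompactFunctional (pull s F) := by
  obtain ⟨⟨D, hD⟩, K, hK, h⟩ := hF
  exact ⟨⟨_, hD.pull s⟩, K, hK, (funSupport_pull s F).trans h⟩

/-- The derivatives are multiplied by a smooth function. This does not enlarge supports, nor wave
front sets, since the factor can be absorbed into the localizing function `χ`. -/
theorem IsLocalFunctional.pull {F : Functional d} (hF : IsLocalFunctional F) (s : Config d) :
    IsLocalFunctional (pull s F) := by
  obtain ⟨hF, D, hD, h⟩ := hF
  refine ⟨hF.pull s, _, hD.pull s, fun n φ => ⟨?_, ?_⟩⟩
  · refine (Distribution.dsupport_subset_dsupport fun O _ hO f hf => ?_).trans (h n (s * φ)).1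
    exact hO _ ((tsupport_mul_subset_right (f := tpow s n) (g := f)).trans hf)
  · refine subset_trans ?_ (h n (s * φ)).2
    rintro p ⟨hp, hx⟩
    refine ⟨hp, fun ⟨U, hU, Γ, hΓ, hc, hr⟩ => hx ⟨U, hU, Γ, hΓ, hc, fun χ hχ hχU N => ?_⟩⟩
    obtain ⟨C, hC⟩ := hr (tpow s n * χ) (hχ.mul_left (f := tpow s n))
      ((tsupport_mul_subset_right (f := tpow s n) (g := χ)).trans hχU) N
    refine ⟨C, fun η hη => ?_⟩
    have key : tpow s n * waveTest χ η = waveTest (tpow s n * χ) η := by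
      ext x
      exact (mul_assoc _ _ _).symm
    rw [ContinuousLinearMap.comp_apply, mulCLM_apply, key]
    exact hC η hη

theorem tsupport_disjoint_of_eventually_zero {V : Type*} [TopologicalSpace V] {f : V → ℝ}
    {S : Set V} (h : ∀ᶠ x in 𝓝ˢ S, f x = 0) : Disjoint (tsupport f) S := by
  rw [Set.disjoint_left]
  intro x hx hxS
  exact notMem_tsupport_iff_eventuallyEq.2 (h.filter_mono (nhds_le_nhdsSet hxS)) hx

theorem apply_congr_of_eventually {F : Functional d} (hF : Continuous F) {φ ψ : Config d}
    (h : ∀ᶠ x in 𝓝ˢ (funSupport F), φ x = ψ x) : F φ = F ψ := by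
  have h1 : ψ + (φ - ψ) = φ := by abel
  rw [← h1]
  refine apply_add_of_disjoint hF (tsupport_disjoint_of_eventually_zero ?_) ψ
  filter_upwards [h] with x hx
  rw [SmoothFn.sub_apply, hx, sub_self]

theorem pull_eq_self {F : Functional d} (hF : Continuous F) {s : Config d}
    (hs : ∀ᶠ x in 𝓝ˢ (funSupport F), s x = 1) : pull s F = F := by
  funext φ
  refine apply_congr_of_eventually hF ?_
  filter_upwards [hs] with x hx
  rw [SmoothFn.mul_apply, hx, one_mul]

/-- Since `F` is equal to its own pull-back by `s`, uniqueness identifies the derivatives. The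
factors `s` show that only test function values near the power of the support matter. -/
theorem IsFunDeriv.apply_eq_tpow_mul {F : Functional d}
    {D : (n : ℕ) → Config d → CDist (Fin n → Space d)} (hD : IsFunDeriv F D) {s : Config d}
    (hs : ∀ᶠ x in 𝓝ˢ (funSupport F), s x = 1) (n : ℕ) (φ : Config d)
    (f : SmoothFn ℂ (Fin n → Space d)) : D n φ f = D n (s * φ) (tpow s n * f) := by
  have h1 := hD.pull s
  rw [pull_eq_self hD.continuous hs] at h1
  exact congrArg (fun D' => D' n φ f) (hD.unique h1)

/-! ### Local functionals are additive -/

/-- The second derivative vanishes on `b ⊗ k`: this function is supported where `x₀` is in the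
support of `b` and `x₁` in that of `k`, hence off the diagonal. Integrating along `b` and then along
`k` gives the identity. -/
theorem IsLocalFunctional.additive {F : Functional d} (hF : IsLocalFunctional F)
    {b k : Config d} (hd : Disjoint (tsupport b) (tsupport k)) (a : Config d) :
    F (a + b + k) - F (a + b) = F (a + k) - F a := by
  obtain ⟨-, D, hD, hloc⟩ := hF
  have h2 : ∀ φ, D 2 φ (headTensor b (headTensor k 1)) = 0 := by
    intro φ
    refine CDist.apply_eq_zero _ (Set.disjoint_left.2 fun x hx hx' => ?_)
    have hdiag := (hloc 2 φ).1 hx'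
    have hc0 : Continuous fun x : Fin 2 → Space d => x 0 := continuous_apply 0
    have hc1 : Continuous fun x : Fin 2 → Space d => x 1 := continuous_apply 1
    have hb : x 0 ∈ tsupport b := by
      refine closure_minimal (t := (fun x : Fin 2 → Space d => x 0) ⁻¹' tsupport b) ?_
        ((isClosed_tsupport _).preimage hc0) hx
      intro y hy
      refine subset_tsupport _ fun h0 => hy ?_
      simp [h0]
    have hk : x 1 ∈ tsupport k := by
      refine closure_minimal (t := (fun x : Fin 2 → Space d => x 1) ⁻¹' tsupport k) ?_
        ((isClosed_tsupport _).preimage hc1) hx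
      intro y hy
      refine subset_tsupport _ fun h0 => hy ?_
      have : k (Fin.tail y 0) = 0 := h0
      simp [this]
    rw [hdiag 0 1] at hb
    exact Set.disjoint_left.1 hd hb hk
  have h1 : ∀ φ, D 1 (φ + b) (headTensor k 1) = D 1 φ (headTensor k 1) := by
    intro φ
    have := is_const_of_deriv_eq_zero (f := fun s : ℝ => D 1 (φ + s • b) (headTensor k 1))
      (fun s => (hD.hasDerivAt 1 φ b _ s).differentiableAt)
      (fun s => by rw [(hD.hasDerivAt 1 φ b _ s).deriv, h2]) 1 0
    simpa using this
  have hder : ∀ t : ℝ, HasDerivAt (fun s : ℝ => F (a + b + s • k) - F (a + s • k)) 0 t := by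
    intro t
    have := (hD.hasDerivAt_apply (a + b) k t).sub (hD.hasDerivAt_apply a k t)
    rw [add_right_comm, h1, sub_self] at this
    exact this
  have := is_const_of_deriv_eq_zero (fun s => (hder s).differentiableAt)
    (fun s => (hder s).deriv) 1 0
  simp only [one_smul, zero_smul, add_zero] at this
  linear_combination this

end EuclideanEG

namespace EuclideanEG
open Filter SmoothFn

variable {d : ℕ}

/-! ### Contractions with a smooth kernel -/

/-- The configurations of `n` points. -/
abbrev Pts (d n : ℕ) : Type := Fin n → Space d

/-- Moving the first of the `x`-variables to the last place of the `z`-variables. -/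
def moveX (d n p q : ℕ) : Pts d n × (Pts d (p + 1) × Pts d q) →L[ℝ]
    Pts d (n + 1) × (Pts d p × Pts d q) where
  toFun a := (Fin.snoc (α := fun _ => Space d) a.1 (a.2.1 0), (Fin.tail a.2.1, a.2.2))
  map_add' a b := by
    refine Prod.ext (funext fun i => ?_) rfl
    refine Fin.lastCases ?_ (fun i => ?_) i <;> simp
  map_smul' c a := by
    refine Prod.ext (funext fun i => ?_) rfl
    refine Fin.lastCases ?_ (fun i => ?_) i <;> simp
  cont := by
    refine Continuous.prodMk ?_ ?_
    · refine continuous_pi fun i => ?_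
      refine Fin.lastCases ?_ (fun i => ?_) i <;>
        simp only [Fin.snoc_last, Fin.snoc_castSucc] <;> fun_prop
    · refine Continuous.prodMk (continuous_pi fun i => ?_) (continuous_snd.comp continuous_snd)
      exact (continuous_apply i.succ).comp (continuous_fst.comp continuous_snd)

/-- Moving the first of the `y`-variables to the last place of the `z`-variables. -/
def moveY (d n p q : ℕ) : Pts d n × (Pts d p × Pts d (q + 1)) →L[ℝ]
    Pts d (n + 1) × (Pts d p × Pts d q) where
  toFun a := (Fin.snoc (α := fun _ => Space d) a.1 (a.2.2 0), (a.2.1, Fin.tail a.2.2))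
  map_add' a b := by
    refine Prod.ext (funext fun i => ?_) rfl
    refine Fin.lastCases ?_ (fun i => ?_) i <;> simp
  map_smul' c a := by
    refine Prod.ext (funext fun i => ?_) rfl
    refine Fin.lastCases ?_ (fun i => ?_) i <;> simp
  cont := by
    refine Continuous.prodMk ?_ ?_
    · refine continuous_pi fun i => ?_
      refine Fin.lastCases ?_ (fun i => ?_) i <;>
        simp only [Fin.snoc_last, Fin.snoc_castSucc] <;> fun_prop
    · refine Continuous.prodMk (continuous_fst.comp continuous_snd) (continuous_pi fun i => ?_)
      exact (continuous_apply i.succ).comp (continuous_snd.comp continuous_snd)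

@[simp] theorem moveX_apply {n p q : ℕ} (z : Pts d n) (x : Pts d (p + 1)) (y : Pts d q) :
    moveX d n p q (z, (x, y)) =
      (Fin.snoc (α := fun _ => Space d) z (x 0), (Fin.tail x, y)) := rfl

@[simp] theorem moveY_apply {n p q : ℕ} (z : Pts d n) (x : Pts d p) (y : Pts d (q + 1)) :
    moveY d n p q (z, (x, y)) =
      (Fin.snoc (α := fun _ => Space d) z (y 0), (x, Fin.tail y)) := rfl

/-- Permutation of points. -/
def permPts {n : ℕ} (σ : Equiv.Perm (Fin n)) : Pts d n →L[ℝ] Pts d n :=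
  ContinuousLinearMap.pi fun i => ContinuousLinearMap.proj (σ i)

@[simp] theorem permPts_apply {n : ℕ} (σ : Equiv.Perm (Fin n)) (x : Pts d n) :
    permPts σ x = x ∘ σ := rfl

section Leibniz

variable {F G : Functional d} {D D' : (n : ℕ) → Config d → CDist (Fin n → Space d)}

variable (D D') in
/-- The value at `κ(z, x, y)` of the sum of all distributions that result from
`D p φ` in `x` and `D' q φ` in `y` by distributing `n` further derivatives, with variables `z`. -/
def leibniz (φ : Config d) : (n p q : ℕ) → SmoothFn ℂ (Pts d n × (Pts d p × Pts d q)) →ₗ[ℂ] ℂ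
  | 0, p, q => (D p φ : SmoothFn ℂ (Pts d p) →ₗ[ℂ] ℂ) ∘ₗ slice (D' q φ) ∘ₗ snd ![]
  | n + 1, p, q => leibniz φ n (p + 1) q ∘ₗ comp (moveX d n p q) +
      leibniz φ n p (q + 1) ∘ₗ comp (moveY d n p q)

theorem leibniz_zero (φ : Config d) (p q : ℕ) (κ : SmoothFn ℂ (Pts d 0 × (Pts d p × Pts d q))) :
    leibniz D D' φ 0 p q κ = D p φ (slice (D' q φ) (snd ![] κ)) := rfl

theorem leibniz_succ (φ : Config d) (n p q : ℕ)
    (κ : SmoothFn ℂ (Pts d (n + 1) × (Pts d p × Pts d q))) :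
    leibniz D D' φ (n + 1) p q κ = leibniz D D' φ n (p + 1) q (comp (moveX d n p q) κ) +
      leibniz D D' φ n p (q + 1) (comp (moveY d n p q) κ) := rfl

theorem continuous_leibniz (hD : IsFunDeriv F D) (hD' : IsFunDeriv G D') (n p q : ℕ) :
    Continuous fun a : Config d × SmoothFn ℂ (Pts d n × (Pts d p × Pts d q)) =>
      leibniz D D' a.1 n p q a.2 := by
  induction n generalizing p q with
  | zero =>
    refine (hD.cont p).comp (continuous_fst.prodMk ?_)
    refine continuous_slice (D := fun a : Config d × SmoothFn ℂ (Pts d 0 × (Pts d p × Pts d q)) =>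
      D' q a.1) ((hD'.cont q).comp ((continuous_fst.comp continuous_fst).prodMk
        _root_.continuous_snd)) ?_
    exact SmoothFn.continuous_snd _root_.continuous_snd continuous_const
  | succ n ih =>
    exact ((ih (p + 1) q).comp (continuous_fst.prodMk
      ((continuous_comp _).comp _root_.continuous_snd))).add
      ((ih p (q + 1)).comp (continuous_fst.prodMk
      ((continuous_comp _).comp _root_.continuous_snd)))

/-- The function `h(y₀) κ(x, y₁, …)`. -/
def insertSnd {V : Type} [NormedAddCommGroup V] [NormedSpace ℝ V] {q : ℕ} (h : Config d)
    (κ : SmoothFn ℂ (V × Pts d q)) : SmoothFn ℂ (V × Pts d (q + 1)) :=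
  comp ((ContinuousLinearMap.proj 0).comp (ContinuousLinearMap.snd ℝ V (Pts d (q + 1))))
    (ofReal h) * comp ((ContinuousLinearMap.fst ℝ V (Pts d (q + 1))).prod
      ((ContinuousLinearMap.snd ℝ _ _).comp ((splitHead d q).comp
        (ContinuousLinearMap.snd ℝ V (Pts d (q + 1)))))) κ

@[simp] theorem insertSnd_apply {V : Type} [NormedAddCommGroup V] [NormedSpace ℝ V] {q : ℕ}
    (h : Config d) (κ : SmoothFn ℂ (V × Pts d q)) (a : V × Pts d (q + 1)) :
    insertSnd h κ a = h (a.2 0) * κ (a.1, Fin.tail a.2) := rfl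

theorem snd_insertSnd {V : Type} [NormedAddCommGroup V] [NormedSpace ℝ V] {q : ℕ} (h : Config d)
    (κ : SmoothFn ℂ (V × Pts d q)) (x : V) :
    snd x (insertSnd h κ) = headTensor h (snd x κ) := rfl

theorem lineDs_insertSnd {V : Type} [NormedAddCommGroup V] [NormedSpace ℝ V] {q : ℕ} (h : Config d)
    (κ : SmoothFn ℂ (V × Pts d q)) (L : List V) :
    lineDs (L.map fun v => (v, (0 : Pts d (q + 1)))) (insertSnd h κ) =
      insertSnd h (lineDs (L.map fun v => (v, (0 : Pts d q))) κ) := by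
  induction L generalizing κ with
  | nil => rfl
  | cons v L ih =>
    simp only [List.map_cons, lineDs_cons, ← ih]
    congr 1
    ext a
    refine lineD_eq_of_hasDerivAt ?_
    have := (κ.hasDerivAt_line (a.1, Fin.tail a.2) (v, 0) 0).const_mul (h (a.2 0) : ℂ)
    simpa using this

theorem hasDerivAt_slice_apply (hD : IsFunDeriv F D) (hD' : IsFunDeriv G D') (φ h : Config d)
    (p q : ℕ) (κ : SmoothFn ℂ (Pts d p × Pts d q)) :
    HasDerivAt (fun t : ℝ => D p (φ + t • h) (slice (D' q (φ + t • h)) κ))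
      (D (p + 1) φ (headTensor h (slice (D' q φ) κ)) +
        D p φ (slice (D' (q + 1) φ) (insertSnd h κ))) 0 := by
  have hline : Continuous fun t : ℝ => φ + t • h :=
    continuous_const.add (continuous_id.smul continuous_const)
  have := SmoothFn.hasDerivAt_apply (D := fun t : ℝ => D p (φ + t • h))
    ((hD.cont p).comp ((hline.comp continuous_fst).prodMk _root_.continuous_snd))
    (c := fun t : ℝ => slice (D' q (φ + t • h)) κ)
    (c' := fun t : ℝ => slice (D' (q + 1) (φ + t • h)) (insertSnd h κ))
    (continuous_slice (D := fun t : ℝ => D' (q + 1) (φ + t • h)) ((hD'.cont (q + 1)).comp ((hline.comp continuous_fst).prodMk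
      _root_.continuous_snd)) continuous_const)
    (fun L t x => by
      simp only [lineDs_slice, slice_apply, lineDs_insertSnd, snd_insertSnd]
      exact hD'.hasDerivAt q φ h _ t)
    (hD.succ p φ h _)
  simpa using this

/-- The function `h(z₀) κ(z₁, …; w)`. -/
def insertFst {W : Type} [NormedAddCommGroup W] [NormedSpace ℝ W] {n : ℕ} (h : Config d)
    (κ : SmoothFn ℂ (Pts d n × W)) : SmoothFn ℂ (Pts d (n + 1) × W) :=
  comp ((ContinuousLinearMap.proj 0).comp (ContinuousLinearMap.fst ℝ (Pts d (n + 1)) W))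
    (ofReal h) * comp (((ContinuousLinearMap.snd ℝ _ _).comp ((splitHead d n).comp
        (ContinuousLinearMap.fst ℝ (Pts d (n + 1)) W))).prod
      (ContinuousLinearMap.snd ℝ (Pts d (n + 1)) W)) κ

@[simp] theorem insertFst_apply {W : Type} [NormedAddCommGroup W] [NormedSpace ℝ W] {n : ℕ}
    (h : Config d) (κ : SmoothFn ℂ (Pts d n × W)) (a : Pts d (n + 1) × W) :
    insertFst h κ a = h (a.1 0) * κ (Fin.tail a.1, a.2) := rfl

theorem tail_snoc {n : ℕ} (z : Pts d (n + 1)) (a : Space d) :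
    Fin.tail (Fin.snoc (α := fun _ => Space d) z a) =
      Fin.snoc (α := fun _ => Space d) (Fin.tail z) a := by
  funext i
  refine Fin.lastCases ?_ (fun i => ?_) i
  · simp [Fin.tail]
  · simp only [Fin.tail, Fin.snoc_castSucc, Fin.succ_castSucc]

/-- The new variable enters at the front of the `z`-variables while the recursion takes them off at
the end, so the two operations commute and only the product rule for `n = 0` has content. -/
theorem hasDerivAt_leibniz (hD : IsFunDeriv F D) (hD' : IsFunDeriv G D') (φ h : Config d)
    (n p q : ℕ) (κ : SmoothFn ℂ (Pts d n × (Pts d p × Pts d q))) :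
    HasDerivAt (fun t : ℝ => leibniz D D' (φ + t • h) n p q κ)
      (leibniz D D' φ (n + 1) p q (insertFst h κ)) 0 := by
  induction n generalizing p q with
  | zero =>
    refine (hasDerivAt_slice_apply hD hD' φ h p q (snd ![] κ)).congr_deriv ?_
    symm
    rw [leibniz_succ, leibniz_zero, leibniz_zero]
    congr 2
    · ext x
      rw [slice_apply, headTensor_apply, slice_apply, ← smul_eq_mul, ← map_smul]
      congr 1
      ext y
      exact congrArg₂ (· * ·) rfl (congrArg (fun z => κ (z, Fin.tail x, y))
        (Subsingleton.elim _ _))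
    · congr 1
      ext ⟨x, y⟩
      exact congrArg₂ (· * ·) rfl (congrArg (fun z => κ (z, x, Fin.tail y))
        (Subsingleton.elim _ _))
  | succ n ih =>
    have := (ih (p + 1) q (comp (moveX d n p q) κ)).add (ih p (q + 1) (comp (moveY d n p q) κ))
    have hX : comp (moveX d (n + 1) p q) (insertFst h κ) =
        insertFst h (comp (moveX d n p q) κ) := by
      ext ⟨z, x, y⟩
      simp [tail_snoc]
    have hY : comp (moveY d (n + 1) p q) (insertFst h κ) =
        insertFst h (comp (moveY d n p q) κ) := by
      ext ⟨z, x, y⟩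
      simp [tail_snoc]
    rw [leibniz_succ, hX, hY]
    exact this

/-! ### Symmetry of the derivatives of contractions -/

/-- A permutation of `Fin n` as a permutation of `Fin (n + 1)` that fixes `0`. -/
def permSucc {n : ℕ} (τ : Equiv.Perm (Fin n)) : Equiv.Perm (Fin (n + 1)) :=
  Equiv.Perm.decomposeFin.symm (0, τ)

theorem permSucc_zero {n : ℕ} (τ : Equiv.Perm (Fin n)) : permSucc τ 0 = 0 := by
  simp [permSucc]

theorem permSucc_succ {n : ℕ} (τ : Equiv.Perm (Fin n)) (i : Fin n) :
    permSucc τ i.succ = (τ i).succ := by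
  simp [permSucc]

theorem tail_comp_permSucc {n : ℕ} (τ : Equiv.Perm (Fin n)) (x : Pts d (n + 1)) :
    Fin.tail (x ∘ permSucc τ) = Fin.tail x ∘ τ := by
  funext i
  simp [Fin.tail, permSucc_succ]

/-- Symmetry of `D` is carried through the recursion by the permutation that fixes the newly split
off variable. -/
theorem leibniz_permX (hD : IsFunDeriv F D) (φ : Config d)
    (n p q : ℕ) (τ : Equiv.Perm (Fin p)) (κ : SmoothFn ℂ (Pts d n × (Pts d p × Pts d q))) :
    leibniz D D' φ n p q (comp ((ContinuousLinearMap.id ℝ (Pts d n)).prodMap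
      ((permPts τ).prodMap (ContinuousLinearMap.id ℝ (Pts d q)))) κ) = leibniz D D' φ n p q κ := by
  induction n generalizing p q with
  | zero =>
    rw [leibniz_zero, leibniz_zero, ← hD.symm p φ τ (slice (D' q φ) (snd ![] κ))]
    rfl
  | succ n ih =>
    refine congrArg₂ (· + ·) ((congrArg _ ?_).trans (ih (p + 1) q (permSucc τ) _))
      (ih p (q + 1) τ (comp (moveY d n p q) κ))
    ext ⟨z, x, y⟩
    simp [tail_comp_permSucc, permSucc_zero]

theorem leibniz_permY (hD' : IsFunDeriv G D') (φ : Config d)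
    (n p q : ℕ) (τ : Equiv.Perm (Fin q)) (κ : SmoothFn ℂ (Pts d n × (Pts d p × Pts d q))) :
    leibniz D D' φ n p q (comp ((ContinuousLinearMap.id ℝ (Pts d n)).prodMap
      ((ContinuousLinearMap.id ℝ (Pts d p)).prodMap (permPts τ))) κ) = leibniz D D' φ n p q κ := by
  induction n generalizing p q with
  | zero =>
    rw [leibniz_zero, leibniz_zero]
    congr 1
    ext x
    exact hD'.symm q φ τ (snd x (snd ![] κ))
  | succ n ih =>
    refine congrArg₂ (· + ·) (ih (p + 1) q τ (comp (moveX d n p q) κ))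
      ((congrArg _ ?_).trans (ih p (q + 1) (permSucc τ) _))
    ext ⟨z, x, y⟩
    simp [tail_comp_permSucc, permSucc_zero]

/-- Permutation of the first group of points. -/
def permZ {W : Type} [NormedAddCommGroup W] [NormedSpace ℝ W] {n : ℕ} (σ : Equiv.Perm (Fin n)) :
    Pts d n × W →L[ℝ] Pts d n × W :=
  (permPts σ).prodMap (ContinuousLinearMap.id ℝ W)

@[simp] theorem permZ_apply {W : Type} [NormedAddCommGroup W] [NormedSpace ℝ W] {n : ℕ}
    (σ : Equiv.Perm (Fin n)) (a : Pts d n × W) : permZ σ a = (a.1 ∘ σ, a.2) := rfl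

theorem snoc_comp_swap_castSucc {n : ℕ} (z : Pts d (n + 1)) (a : Space d) (i : Fin n) :
    (Fin.snoc (α := fun _ => Space d) z a) ∘ Equiv.swap i.castSucc.castSucc i.castSucc.succ =
      Fin.snoc (α := fun _ => Space d) (z ∘ Equiv.swap i.castSucc i.succ) a := by
  funext j
  rw [Function.comp_apply, ← Fin.castSucc_succ]
  refine Fin.lastCases ?_ (fun j => ?_) j
  · rw [Equiv.swap_apply_of_ne_of_ne (Fin.castSucc_lt_last _).ne' (Fin.castSucc_lt_last _).ne',
      Fin.snoc_last, Fin.snoc_last]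
  · rw [Fin.snoc_castSucc, Function.comp_apply,
      (Fin.castSucc_injective _).swap_apply, Fin.snoc_castSucc]

theorem snoc_snoc_comp_swap {n : ℕ} (z : Pts d n) (a b : Space d) :
    (Fin.snoc (α := fun _ => Space d) (Fin.snoc (α := fun _ => Space d) z a) b) ∘
      Equiv.swap (Fin.last n).castSucc (Fin.last n).succ =
      Fin.snoc (α := fun _ => Space d) (Fin.snoc (α := fun _ => Space d) z b) a := by
  funext j
  rw [Function.comp_apply, Fin.succ_last]
  refine Fin.lastCases ?_ (fun j => ?_) j
  · rw [Equiv.swap_apply_right, Fin.snoc_castSucc, Fin.snoc_last, Fin.snoc_last]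
  · refine Fin.lastCases ?_ (fun j => ?_) j
    · rw [Equiv.swap_apply_left, Fin.snoc_castSucc, Fin.snoc_last, Fin.snoc_last]
    · rw [Equiv.swap_apply_of_ne_of_ne]
      · simp only [Fin.snoc_castSucc]
      · exact fun h => (Fin.castSucc_lt_last j).ne (Fin.castSucc_injective _ h)
      · exact (Fin.castSucc_lt_last _).ne

/-- A swap of the last two variables leaves the terms with both derivatives on the same factor
unchanged, by symmetry of `D` and `D'`, and exchanges the two mixed terms. Other adjacent swaps pass
through one step of the recursion. -/
theorem leibniz_swap (hD : IsFunDeriv F D) (hD' : IsFunDeriv G D') (φ : Config d) (n p q : ℕ)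
    (i : Fin n) (κ : SmoothFn ℂ (Pts d (n + 1) × (Pts d p × Pts d q))) :
    leibniz D D' φ (n + 1) p q (comp (permZ (Equiv.swap i.castSucc i.succ)) κ) =
      leibniz D D' φ (n + 1) p q κ := by
  induction n generalizing p q with
  | zero => exact i.elim0
  | succ n ih =>
    refine Fin.lastCases ?_ (fun i => ?_) i
    · have hx : comp (moveX d n (p + 1) q) (comp (moveX d (n + 1) p q)
          (comp (permZ (Equiv.swap (Fin.last n).castSucc (Fin.last n).succ)) κ)) =
          comp ((ContinuousLinearMap.id ℝ (Pts d n)).prodMap ((permPts (Equiv.swap 0 1)).prodMap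
            (ContinuousLinearMap.id ℝ (Pts d q))))
            (comp (moveX d n (p + 1) q) (comp (moveX d (n + 1) p q) κ)) := by
        ext ⟨z, x, y⟩
        simp only [comp_apply, moveX_apply, permZ_apply, snoc_snoc_comp_swap,
          ContinuousLinearMap.coe_prodMap', Prod.map_apply, permPts_apply,
          ContinuousLinearMap.id_apply]
        congr 3
      have hy : comp (moveY d n p (q + 1)) (comp (moveY d (n + 1) p q)
          (comp (permZ (Equiv.swap (Fin.last n).castSucc (Fin.last n).succ)) κ)) =
          comp ((ContinuousLinearMap.id ℝ (Pts d n)).prodMap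
            ((ContinuousLinearMap.id ℝ (Pts d p)).prodMap (permPts (Equiv.swap 0 1))))
            (comp (moveY d n p (q + 1)) (comp (moveY d (n + 1) p q) κ)) := by
        ext ⟨z, x, y⟩
        simp only [comp_apply, moveY_apply, permZ_apply, snoc_snoc_comp_swap,
          ContinuousLinearMap.coe_prodMap', Prod.map_apply, permPts_apply,
          ContinuousLinearMap.id_apply]
        congr 3
      have hxy : comp (moveY d n (p + 1) q) (comp (moveX d (n + 1) p q)
          (comp (permZ (Equiv.swap (Fin.last n).castSucc (Fin.last n).succ)) κ)) =
            comp (moveX d n p (q + 1)) (comp (moveY d (n + 1) p q) κ) := by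
        ext ⟨z, x, y⟩
        simp only [comp_apply, moveX_apply, moveY_apply, permZ_apply, snoc_snoc_comp_swap]
      have hyx : comp (moveX d n p (q + 1)) (comp (moveY d (n + 1) p q)
          (comp (permZ (Equiv.swap (Fin.last n).castSucc (Fin.last n).succ)) κ)) =
            comp (moveY d n (p + 1) q) (comp (moveX d (n + 1) p q) κ) := by
        ext ⟨z, x, y⟩
        simp only [comp_apply, moveX_apply, moveY_apply, permZ_apply, snoc_snoc_comp_swap]
      simp only [leibniz_succ, hx, hy, hxy, hyx, leibniz_permX hD, leibniz_permY hD']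
      ring
    · refine congrArg₂ (· + ·) ((congrArg _ ?_).trans (ih (p + 1) q i _))
        ((congrArg _ ?_).trans (ih p (q + 1) i _)) <;>
      · ext ⟨z, x, y⟩
        simp only [comp_apply, moveX_apply, moveY_apply, permZ_apply, snoc_comp_swap_castSucc]

/-- Adjacent transpositions generate the symmetric group. -/
theorem leibniz_permZ (hD : IsFunDeriv F D) (hD' : IsFunDeriv G D') (φ : Config d) (n p q : ℕ)
    (σ : Equiv.Perm (Fin n)) (κ : SmoothFn ℂ (Pts d n × (Pts d p × Pts d q))) :
    leibniz D D' φ n p q (comp (permZ σ) κ) = leibniz D D' φ n p q κ := by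
  cases n with
  | zero =>
    have : σ = 1 := Subsingleton.elim _ _
    rw [this]
    rfl
  | succ n =>
    have hσ : σ ∈ Submonoid.closure (Set.range fun i : Fin n => Equiv.swap i.castSucc i.succ) := by
      rw [Equiv.Perm.mclosure_swap_castSucc_succ]
      trivial
    induction hσ using Submonoid.closure_induction generalizing κ with
    | mem σ h =>
      obtain ⟨i, rfl⟩ := h
      exact leibniz_swap hD hD' φ n p q i κ
    | one => rfl
    | mul σ τ _ _ h1 h2 =>
      rw [← h2 κ, ← h1 (comp (permZ τ) κ)]
      rfl

end Leibniz

end EuclideanEG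

/-! ### Contractions as smooth functionals -/

namespace EuclideanEG
open Filter SmoothFn

variable {d : ℕ}

namespace SmoothFn

variable {𝕜 V W : Type} [RCLike 𝕜] [NormedAddCommGroup V] [NormedSpace ℝ V]
  [NormedAddCommGroup W] [NormedSpace ℝ W]

theorem continuous_ofReal [FiniteDimensional ℝ V] :
    Continuous (ofReal : SmoothFn ℝ V → SmoothFn 𝕜 V) := by
  refine continuous_iff.2 fun L => ?_
  simp only [lineDs_ofReal, ofReal_apply]
  exact RCLike.continuous_ofReal.comp (continuous_iff.1 continuous_id L)

/-- The function `f(x) κ(y)`, linear in `f`. -/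
def outer (κ : SmoothFn ℂ W) : SmoothFn ℂ V →ₗ[ℂ] SmoothFn ℂ (V × W) where
  toFun f := comp (ContinuousLinearMap.fst ℝ V W) f * comp (ContinuousLinearMap.snd ℝ V W) κ
  map_add' f g := by ext a; simp [add_mul]
  map_smul' c f := by ext a; simp [mul_assoc]

@[simp] theorem outer_apply (κ : SmoothFn ℂ W) (f : SmoothFn ℂ V) (a : V × W) :
    outer κ f a = f a.1 * κ a.2 := rfl

theorem slice_add [FiniteDimensional ℝ V] [FiniteDimensional ℝ W] (u v : CDist W)
    (f : SmoothFn ℂ (V × W)) : slice (u + v) f = slice u f + slice v f := rfl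

theorem slice_smul [FiniteDimensional ℝ V] [FiniteDimensional ℝ W] (c : ℂ) (u : CDist W)
    (f : SmoothFn ℂ (V × W)) : slice (c • u) f = c • slice u f := rfl

end SmoothFn

/-- Smooth kernels. -/
abbrev Kernel (d : ℕ) : Type := SmoothFn ℝ (Space d × Space d)

/-- The function `∏ᵢ K(xᵢ, yᵢ)`. -/
def kpow (K : Kernel d) : (k : ℕ) → SmoothFn ℂ (Pts d k × Pts d k)
  | 0 => 1
  | k + 1 =>
    comp (((ContinuousLinearMap.proj 0).comp (ContinuousLinearMap.fst ℝ _ _)).prod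
      ((ContinuousLinearMap.proj 0).comp (ContinuousLinearMap.snd ℝ _ _))) (ofReal K) *
    comp ((((ContinuousLinearMap.snd ℝ _ _).comp (splitHead d k)).comp
        (ContinuousLinearMap.fst ℝ _ _)).prod
      (((ContinuousLinearMap.snd ℝ _ _).comp (splitHead d k)).comp
        (ContinuousLinearMap.snd ℝ _ _))) (kpow K k)

theorem kpow_apply (K : Kernel d) (k : ℕ) (a : Pts d k × Pts d k) :
    kpow K k a = ∏ i, (K (a.1 i, a.2 i) : ℂ) := by
  induction k with
  | zero => simp [kpow]
  | succ k ih => simp [kpow, ih, Fin.prod_univ_succ, Fin.tail]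

theorem continuous_kpow (k : ℕ) : Continuous fun K : Kernel d => kpow K k := by
  induction k with
  | zero => exact continuous_const
  | succ k ih =>
    exact SmoothFn.continuous_mul ((continuous_comp _).comp continuous_ofReal)
      ((continuous_comp _).comp ih)

/-- The functional `φ ↦ ⟨F^{(k)}(φ), K^{⊗k} G^{(k)}(φ)⟩` for a smooth kernel `K`. -/
def contr (K : Kernel d) (k : ℕ) (F G : Functional d) : Functional d := fun φ =>
  funDeriv F k φ (slice (funDeriv G k φ) (kpow K k))

/-- The functional derivatives of contractions. -/
def contrDeriv {F G : Functional d} (hF : ∃ D, IsFunDeriv F D) (hG : ∃ D, IsFunDeriv G D)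
    (K : Kernel d) (k n : ℕ) (φ : Config d) : CDist (Fin n → Space d) where
  toLinearMap := leibniz (funDeriv F) (funDeriv G) φ n k k ∘ₗ outer (kpow K k)
  cont := (continuous_leibniz (funDeriv_spec hF) (funDeriv_spec hG) n k k).comp
    (continuous_const.prodMk (SmoothFn.continuous_mul (continuous_comp _) continuous_const))

theorem contrDeriv_apply {F G : Functional d} (hF : ∃ D, IsFunDeriv F D) (hG : ∃ D, IsFunDeriv G D)
    (K : Kernel d) (k n : ℕ) (φ : Config d) (f : SmoothFn ℂ (Fin n → Space d)) :
    contrDeriv hF hG K k n φ f =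
      leibniz (funDeriv F) (funDeriv G) φ n k k (outer (kpow K k) f) := rfl

theorem continuous_contrDeriv {F G : Functional d} (hF : ∃ D, IsFunDeriv F D)
    (hG : ∃ D, IsFunDeriv G D) (k n : ℕ) : Continuous
      fun a : Kernel d × Config d × SmoothFn ℂ (Fin n → Space d) =>
        contrDeriv hF hG a.1 k n a.2.1 a.2.2 :=
  (continuous_leibniz (funDeriv_spec hF) (funDeriv_spec hG) n k k).comp
    ((continuous_fst.comp _root_.continuous_snd).prodMk (SmoothFn.continuous_mul
      ((continuous_comp _).comp (_root_.continuous_snd.comp _root_.continuous_snd))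
      ((continuous_comp _).comp ((continuous_kpow k).comp continuous_fst))))

/-- The kernel does not depend on the field, so all derivatives are Leibniz sums applied to `f ⊗
K^{⊗k}`; smoothness of `K` keeps every slice smooth. -/
theorem isFunDeriv_contr {F G : Functional d} (hF : ∃ D, IsFunDeriv F D)
    (hG : ∃ D, IsFunDeriv G D) (K : Kernel d) (k : ℕ) :
    IsFunDeriv (contr K k F G) (contrDeriv hF hG K k) where
  zero φ f := by
    rw [contrDeriv_apply, leibniz_zero, contr, mul_comm, ← smul_eq_mul, ← map_smul, ← map_smul]
    rfl
  succ n φ h f := by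
    have := hasDerivAt_leibniz (funDeriv_spec hF) (funDeriv_spec hG) φ h n k k (outer (kpow K k) f)
    have h2 : insertFst h (outer (kpow K k) f) = outer (kpow K k) (headTensor h f) := by
      ext a
      simp [mul_assoc]
    rw [h2] at this
    exact this
  symm n φ σ f :=
    leibniz_permZ (funDeriv_spec hF) (funDeriv_spec hG) φ n k k σ (outer (kpow K k) f)
  cont n := (continuous_contrDeriv hF hG k n).comp (continuous_const.prodMk continuous_id)

theorem funDeriv_contr {F G : Functional d} (hF : ∃ D, IsFunDeriv F D)
    (hG : ∃ D, IsFunDeriv G D) (K : Kernel d) (k : ℕ) :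
    funDeriv (contr K k F G) = contrDeriv hF hG K k :=
  (isFunDeriv_contr hF hG K k).funDeriv_eq

/-- A variation outside both supports changes the derivatives of neither functional. -/
theorem funSupport_contr {F G : Functional d} (hF : ∃ D, IsFunDeriv F D)
    (hG : ∃ D, IsFunDeriv G D) (K : Kernel d) (k : ℕ) :
    funSupport (contr K k F G) ⊆ funSupport F ∪ funSupport G := by
  intro x hx
  by_contra hcon
  have hO : (funSupport F ∪ funSupport G)ᶜ ∈ 𝓝 x :=
    ((isClosed_funSupport F).union (isClosed_funSupport G)).isOpen_compl.mem_nhds hcon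
  obtain ⟨φ, h, hh, hne⟩ := hx _ hO
  have hd := Set.subset_compl_iff_disjoint_right.1 hh
  refine hne ?_
  simp only [contr]
  rw [(funDeriv_spec hF).apply_add_of_disjoint (hd.mono_right Set.subset_union_left),
    (funDeriv_spec hG).apply_add_of_disjoint (hd.mono_right Set.subset_union_right)]

theorem IsCompactFunctional.contr {F G : Functional d} (hF : IsCompactFunctional F)
    (hG : IsCompactFunctional G) (K : Kernel d) (k : ℕ) : IsCompactFunctional (contr K k F G) :=
  ⟨⟨_, isFunDeriv_contr hF.1 hG.1 K k⟩, _, hF.isCompact.union hG.isCompact,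
    funSupport_contr hF.1 hG.1 K k⟩

theorem funDeriv_add {F G : Functional d} (hF : ∃ D, IsFunDeriv F D) (hG : ∃ D, IsFunDeriv G D) :
    funDeriv (F + G) = fun n φ => funDeriv F n φ + funDeriv G n φ :=
  ((funDeriv_spec hF).add (funDeriv_spec hG)).funDeriv_eq

theorem funDeriv_smul {F : Functional d} (c : ℂ) (hF : ∃ D, IsFunDeriv F D) :
    funDeriv (c • F) = fun n φ => c • funDeriv F n φ :=
  ((funDeriv_spec hF).smul c).funDeriv_eq

/-- The contraction as a bilinear map. -/
def contrBilin (K : Kernel d) (k : ℕ) :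
    compactFunctionals d →ₗ[ℂ] compactFunctionals d →ₗ[ℂ] compactFunctionals d :=
  LinearMap.mk₂ ℂ (fun F G => ⟨contr K k F.1 G.1, F.2.contr G.2 K k⟩)
    (fun F F' G => Subtype.ext <| funext fun φ => by
      simp [contr, funDeriv_add F.2.1 F'.2.1])
    (fun c F G => Subtype.ext <| funext fun φ => by
      simp [contr, funDeriv_smul c F.2.1])
    (fun F G G' => Subtype.ext <| funext fun φ => by
      simp [contr, funDeriv_add G.2.1 G'.2.1, slice_add])
    (fun c F G => Subtype.ext <| funext fun φ => by
      simp [contr, funDeriv_smul c G.2.1, slice_smul])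

@[simp] theorem contrBilin_apply (K : Kernel d) (k : ℕ) (F G : compactFunctionals d) :
    (contrBilin K k F G : Functional d) = contr K k F G := rfl

/-- Cutoffs that are `1` near the supports may be inserted in all variables; where they do not
vanish, the two kernels agree. -/
theorem contr_congr {F G : Functional d} (hF : IsCompactFunctional F) (hG : IsCompactFunctional G)
    {K K' : Kernel d} {U U' : Set (Space d)} (hU : IsOpen U) (hU' : IsOpen U')
    (hFU : funSupport F ⊆ U) (hGU : funSupport G ⊆ U')
    (h : ∀ x ∈ U, ∀ y ∈ U', K (x, y) = K' (x, y)) (k : ℕ) : contr K k F G = contr K' k F G := by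
  obtain ⟨s, hs, hsU⟩ := exists_cutoff hF.isCompact hU hFU
  obtain ⟨s', hs', hsU'⟩ := exists_cutoff hG.isCompact hU' hGU
  funext φ
  simp only [contr]
  rw [(funDeriv_spec hF.1).apply_eq_tpow_mul hs,
    (funDeriv_spec hF.1).apply_eq_tpow_mul hs k φ (slice _ (kpow K' k))]
  congr 1
  ext x
  simp only [SmoothFn.mul_apply, slice_apply]
  by_cases hx : ∀ i, x i ∈ U
  · congr 1
    rw [(funDeriv_spec hG.1).apply_eq_tpow_mul hs',
      (funDeriv_spec hG.1).apply_eq_tpow_mul hs' k φ (snd x (kpow K' k))]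
    congr 1
    ext y
    simp only [SmoothFn.mul_apply, snd_apply, kpow_apply]
    by_cases hy : ∀ i, y i ∈ U'
    · simp only [h _ (hx _) _ (hy _)]
    · push Not at hy
      obtain ⟨i, hi⟩ := hy
      have : s' (y i) = 0 := image_eq_zero_of_notMem_tsupport fun h => hi (hsU' h)
      rw [tpow_apply, Finset.prod_eq_zero (Finset.mem_univ i) (by rw [this]; simp)]
      simp
  · push Not at hx
    obtain ⟨i, hi⟩ := hx
    have : s (x i) = 0 := image_eq_zero_of_notMem_tsupport fun h => hi (hsU h)
    rw [tpow_apply, Finset.prod_eq_zero (Finset.mem_univ i) (by rw [this]; simp)]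
    simp

/-! ### The cut off kernel -/

theorem contDiff_cutKernel {P : Space d → ℝ} (hP : ContDiffOn ℝ ∞ P {0}ᶜ) {ε : ℝ} (hε : 0 < ε) :
    ContDiff ℝ ∞ (cutKernel P ε) := by
  rw [contDiff_iff_contDiffAt]
  intro x
  rcases eq_or_ne x 0 with rfl | hx
  · have : cutKernel P ε =ᶠ[𝓝 0] fun _ => 0 := by
      filter_upwards [Metric.ball_mem_nhds (0 : Space d) hε] with x hx
      rw [mem_ball_zero_iff] at hx
      rw [cutKernel, Real.smoothTransition.zero_of_nonpos, zero_mul]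
      rw [sub_nonpos, div_le_one (by positivity)]
      gcongr
    exact contDiffAt_const.congr_of_eventuallyEq this
  · refine ContDiffAt.mul ?_ (hP.contDiffAt (isOpen_compl_singleton.mem_nhds hx))
    exact (Real.smoothTransition.contDiff.comp
      (((contDiff_norm_sq ℝ).div_const _).sub contDiff_const)).contDiffAt

theorem cutKernel_of_le {P : Space d → ℝ} {ε : ℝ} (hε : 0 < ε) {x : Space d} (hx : 2 * ε ≤ ‖x‖) :
    cutKernel P ε x = P x := by
  rw [cutKernel, Real.smoothTransition.one_of_one_le, one_mul]
  rw [le_sub_iff_add_le, le_div_iff₀ (by positivity)]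
  nlinarith

/-- The kernel `P(x - y)` cut off near the diagonal. -/
def cutoffKernel {P : Space d → ℝ} (hP : ContDiffOn ℝ ∞ P {0}ᶜ) (ε : Set.Ioi (0 : ℝ)) : Kernel d :=
  of (fun a => cutKernel P ε (a.1 - a.2))
    ((contDiff_cutKernel hP ε.2).comp (contDiff_fst.sub contDiff_snd))

@[simp] theorem cutoffKernel_apply {P : Space d → ℝ} (hP : ContDiffOn ℝ ∞ P {0}ᶜ)
    (ε : Set.Ioi (0 : ℝ)) (a : Space d × Space d) :
    cutoffKernel hP ε a = cutKernel P ε (a.1 - a.2) := rfl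

theorem CDist.eval_coe {V : Type} [NormedAddCommGroup V] [NormedSpace ℝ V] (u : CDist V)
    (f : SmoothFn ℂ V) : u.eval f = u f := dif_pos f.contDiff

/-- The sets `S` and `S'` have a distance of at least `r`. -/
def FarApart (r : ℝ) (S S' : Set (Space d)) : Prop := ∀ x ∈ S, ∀ y ∈ S', r ≤ dist x y

/-- The expression under the limit is constant for small cutoffs, because different cutoffs give the
same kernel near the product of the supports. -/
theorem contraction_eq_contr {P : Space d → ℝ} (hP : ContDiffOn ℝ ∞ P {0}ᶜ) {F G : Functional d}
    (hF : IsCompactFunctional F) (hG : IsCompactFunctional G) {r : ℝ}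
    (hr : FarApart r (funSupport F) (funSupport G)) (ε : Set.Ioi (0 : ℝ)) (hε : 4 * ε.1 ≤ r)
    (k : ℕ) : contraction P k F G = contr (cutoffKernel hP ε) k F G := by
  have hε0 : 0 < ε.1 := ε.2
  have hr0 : 0 < r := by linarith
  funext φ
  refine Tendsto.limUnder_eq (tendsto_const_nhds.congr' ?_)
  filter_upwards [Ioo_mem_nhdsGT (show (0 : ℝ) < r / 4 by positivity)] with ε' hε'
  have h1 : contr (cutoffKernel hP ε) k F G = contr (cutoffKernel hP ⟨ε', hε'.1⟩) k F G := by
    -- Points of the two `r / 8`-thickenings are still at least `3 r / 4` apart, which exceeds `2 ε`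
    -- and `2 ε'`, so both kernels equal `P` there.
    refine contr_congr hF hG (U := Metric.thickening (r / 8) (funSupport F))
      (U' := Metric.thickening (r / 8) (funSupport G)) Metric.isOpen_thickening
      Metric.isOpen_thickening (Metric.self_subset_thickening (by positivity) _)
      (Metric.self_subset_thickening (by positivity) _) (fun x hx y hy => ?_) k
    obtain ⟨x', hx', hxx⟩ := Metric.mem_thickening_iff.1 hx
    obtain ⟨y', hy', hyy⟩ := Metric.mem_thickening_iff.1 hy
    have h2 := hr x' hx' y' hy'
    have h3 : dist x' y' ≤ dist x x' + dist x y + dist y y' := by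
      rw [dist_comm x x']
      exact dist_triangle4 x' x y y'
    rw [cutoffKernel_apply, cutoffKernel_apply, cutKernel_of_le hε0, cutKernel_of_le hε'.1]
    · rw [← dist_eq_norm]
      linarith [hε'.2]
    · rw [← dist_eq_norm]
      linarith [hε'.2]
  rw [h1, contr, ← CDist.eval_coe]
  congr 1
  funext x
  rw [slice_apply, ← CDist.eval_coe]
  congr 1
  funext y
  rw [snd_apply, kpow_apply]
  push_cast
  rfl

end EuclideanEG

namespace EuclideanEG
open Filter SmoothFn

variable {d : ℕ}

/-! ### Associativity and commutativity -/

theorem permute_headTensor {n : ℕ} (σ : Equiv.Perm (Fin n)) (h : Config d)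
    (f : SmoothFn ℂ (Fin n → Space d)) :
    headTensor h (permute σ f) = permute (permSucc σ) (headTensor h f) := by
  ext x
  change (h (x 0) : ℂ) * f (Fin.tail x ∘ σ) =
    h ((x ∘ permSucc σ) 0) * f (Fin.tail (x ∘ permSucc σ))
  rw [tail_comp_permSucc, Function.comp_apply, permSucc_zero]

theorem headTensor_headTensor {n : ℕ} (h k : Config d) (f : SmoothFn ℂ (Fin n → Space d)) :
    headTensor h (headTensor k f) =
      permute (Equiv.swap 0 1) (headTensor k (headTensor h f)) := by
  ext x
  change (h (x 0) : ℂ) * (k (x 1) * f (Fin.tail (Fin.tail x))) =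
    k (x (Equiv.swap 0 1 0)) * (h (x (Equiv.swap 0 1 1)) *
      f (Fin.tail (Fin.tail (x ∘ Equiv.swap 0 1))))
  have : Fin.tail (Fin.tail (x ∘ Equiv.swap 0 1)) = Fin.tail (Fin.tail x) := by
    funext j
    simp only [Fin.tail, Function.comp_apply]
    rw [Equiv.swap_apply_of_ne_of_ne] <;> simp [Fin.ext_iff]
  rw [this, Equiv.swap_apply_left, Equiv.swap_apply_right]
  ring

/-- The directional derivative of a functional. -/
def dirFun (h : Config d) (F : Functional d) : Functional d := fun φ =>
  funDeriv F 1 φ (headTensor h 1)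

theorem headTensor_smul {n : ℕ} (h : Config d) (c : ℂ) (f : SmoothFn ℂ (Fin n → Space d)) :
    headTensor h (c • f) = c • headTensor h f := by
  ext x
  simp [mul_left_comm]

theorem headTensor_add {n : ℕ} (h : Config d) (f g : SmoothFn ℂ (Fin n → Space d)) :
    headTensor h (f + g) = headTensor h f + headTensor h g := by
  ext x
  simp [mul_add]

theorem continuous_headTensor {n : ℕ} (h : Config d) :
    Continuous (headTensor h : SmoothFn ℂ (Fin n → Space d) → _) :=
  SmoothFn.continuous_mul (continuous_const (y := comp (ContinuousLinearMap.proj 0) (ofReal h)))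
    (continuous_comp ((ContinuousLinearMap.snd ℝ _ _).comp (splitHead d n)))

/-- Tensoring with a function on the left, as a continuous linear map. -/
def headTensorCLM (n : ℕ) (h : Config d) :
    SmoothFn ℂ (Fin n → Space d) →L[ℂ] SmoothFn ℂ (Fin (n + 1) → Space d) where
  toFun := headTensor h
  map_add' := headTensor_add h
  map_smul' := headTensor_smul h
  cont := continuous_headTensor h

theorem isFunDeriv_dirFun {F : Functional d} {D : (n : ℕ) → Config d → CDist (Fin n → Space d)}
    (hD : IsFunDeriv F D) (h : Config d) :
    IsFunDeriv (dirFun h F) fun n φ => (D (n + 1) φ).comp (headTensorCLM n h) where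
  zero φ f := by
    rw [dirFun, hD.funDeriv_eq, mul_comm, ← smul_eq_mul, ← map_smul, ← headTensor_smul]
    change D 1 φ (headTensor h f) = _
    congr 2
    ext x
    simp [Subsingleton.elim x ![]]
  succ n φ k f := by
    have := hD.succ (n + 1) φ k (headTensor h f)
    rw [headTensor_headTensor, hD.symm] at this
    exact this
  symm n φ σ f := by
    change D (n + 1) φ (headTensor h (permute σ f)) = D (n + 1) φ (headTensor h f)
    rw [permute_headTensor, hD.symm]
  cont n := (hD.cont (n + 1)).comp
    (continuous_fst.prodMk ((continuous_headTensor h).comp _root_.continuous_snd))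

theorem funDeriv_dirFun {F : Functional d} (hF : ∃ D, IsFunDeriv F D) (h : Config d) (n : ℕ)
    (φ : Config d) (f : SmoothFn ℂ (Fin n → Space d)) :
    funDeriv (dirFun h F) n φ f = funDeriv F (n + 1) φ (headTensor h f) := by
  rw [(isFunDeriv_dirFun (funDeriv_spec hF) h).funDeriv_eq]
  rfl

theorem hasDerivAt_dirFun {F : Functional d} (hF : ∃ D, IsFunDeriv F D) (φ h : Config d) :
    HasDerivAt (fun t : ℝ => F (φ + t • h)) (dirFun h F φ) 0 := by
  simpa [dirFun] using (funDeriv_spec hF).hasDerivAt_apply φ h 0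

theorem funSupport_dirFun {F : Functional d} (hF : ∃ D, IsFunDeriv F D) (h : Config d) :
    funSupport (dirFun h F) ⊆ funSupport F := by
  intro x hx
  by_contra hcon
  obtain ⟨φ, k, hk, hne⟩ := hx _ ((isClosed_funSupport F).isOpen_compl.mem_nhds hcon)
  refine hne ?_
  rw [dirFun, (funDeriv_spec hF).apply_add_of_disjoint (Set.subset_compl_iff_disjoint_right.1 hk)]
  rfl

/-- The directional derivative as a linear map. -/
def dirD (h : Config d) : compactFunctionals d →ₗ[ℂ] compactFunctionals d where
  toFun F := ⟨dirFun h F.1, ⟨⟨_, isFunDeriv_dirFun (funDeriv_spec F.2.1) h⟩, _, F.2.isCompact,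
    funSupport_dirFun F.2.1 h⟩⟩
  map_add' F G := Subtype.ext <| funext fun φ => by simp [dirFun, funDeriv_add F.2.1 G.2.1]
  map_smul' c F := Subtype.ext <| funext fun φ => by simp [dirFun, funDeriv_smul c F.2.1]

@[simp] theorem dirD_coe (h : Config d) (F : compactFunctionals d) :
    (dirD h F : Functional d) = dirFun h F := rfl

theorem dirD_comm (h k : Config d) (F : compactFunctionals d) :
    dirD h (dirD k F) = dirD k (dirD h F) := by
  refine Subtype.ext (funext fun φ => ?_)
  change funDeriv (dirFun k F.1) 1 φ (headTensor h 1) = funDeriv (dirFun h F.1) 1 φ (headTensor k 1)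
  rw [funDeriv_dirFun F.2.1, funDeriv_dirFun F.2.1, headTensor_headTensor,
    (funDeriv_spec F.2.1).symm]

theorem contr_zero {F G : Functional d} (hF : ∃ D, IsFunDeriv F D) (hG : ∃ D, IsFunDeriv G D)
    (K : Kernel d) : contr K 0 F G = F * G := by
  funext φ
  rw [contr, (funDeriv_spec hF).zero, slice_apply, (funDeriv_spec hG).zero, snd_apply, kpow_apply]
  simp

/-- The pointwise product of functionals. -/
def mulFun (d : ℕ) : compactFunctionals d →ₗ[ℂ] compactFunctionals d →ₗ[ℂ] compactFunctionals d :=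
  -- The zeroth contraction is the product for every kernel; this form brings smoothness and compact
  -- support along.
  contrBilin 0 0

theorem mulFun_coe (F G : compactFunctionals d) : (mulFun d F G : Functional d) = F.1 * G.1 :=
  contr_zero F.2.1 G.2.1 0

theorem dirD_mulFun (h : Config d) (F G : compactFunctionals d) :
    dirD h (mulFun d F G) = mulFun d (dirD h F) G + mulFun d F (dirD h G) := by
  refine Subtype.ext (funext fun φ => ?_)
  have h1 := hasDerivAt_dirFun (mulFun d F G).2.1 φ h
  rw [mulFun_coe] at h1
  have h2 := (hasDerivAt_dirFun F.2.1 φ h).mul (hasDerivAt_dirFun G.2.1 φ h)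
  have h3 := h1.unique h2
  rw [dirD_coe, mulFun_coe, h3]
  change _ = (mulFun d (dirD h F) G : Functional d) φ + (mulFun d F (dirD h G) : Functional d) φ
  rw [mulFun_coe, mulFun_coe]
  simp

/-- The kernel is a finite sum of products. -/
def IsTensorKernel {ι : Type} [Fintype ι] (K : Kernel d) (f g : ι → Config d) : Prop :=
  ∀ a, K a = ∑ i, f i a.1 * g i a.2

theorem dense_tensorKernels (d : ℕ) : Dense {K : Kernel d | ∃ (ι : Type) (_ : Fintype ι)
    (f g : ι → Config d), IsTensorKernel K f g} := by
  refine dense_tensors.mono fun K hK => ?_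
  induction hK using Submodule.span_induction with
  | mem K hK =>
    obtain ⟨⟨f, g⟩, rfl⟩ := hK
    exact ⟨Unit, inferInstance, fun _ => f, fun _ => g, fun a => by simp⟩
  | zero => exact ⟨Empty, inferInstance, Empty.elim, Empty.elim, fun a => by simp⟩
  | add K K' _ _ h1 h2 =>
    obtain ⟨ι, _, f, g, h⟩ := h1
    obtain ⟨ι', _, f', g', h'⟩ := h2
    refine ⟨ι ⊕ ι', inferInstance, Sum.elim f f', Sum.elim g g', fun a => ?_⟩
    simp [h a, h' a]
  | smul c K _ h1 =>
    obtain ⟨ι, _, f, g, h⟩ := h1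
    refine ⟨ι, inferInstance, fun i => c • f i, g, fun a => ?_⟩
    simp [h a, Finset.mul_sum, mul_assoc]

/-! ### Finite rank kernels: contractions as powers of commuting operators -/

section Algebra

variable {ι : Type} [Fintype ι] {K : Kernel d} {f g : ι → Config d}

/-- Expanding the factor `K(x₀, y₀)` leaves `fᵢ` in the first variable of one derivative and `gᵢ` in
that of the other, that is, directional derivatives. -/
theorem contrBilin_succ (hK : IsTensorKernel K f g) (k : ℕ) (F G : compactFunctionals d) :
    contrBilin K (k + 1) F G = ∑ i, contrBilin K k (dirD (f i) F) (dirD (g i) G) := by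
  refine Subtype.ext (funext fun φ => ?_)
  rw [Submodule.coe_sum, Finset.sum_apply]
  simp only [contrBilin_apply, dirD_coe, contr, funDeriv_dirFun F.2.1]
  rw [← map_sum]
  congr 1
  ext x
  rw [SmoothFn.sum_apply, slice_apply]
  have h1 : ∀ i, headTensor (f i) (slice (funDeriv (dirFun (g i) G.1) k φ) (kpow K k)) x =
      funDeriv G.1 (k + 1) φ ((f i (x 0) : ℂ) •
        headTensor (g i) (snd (Fin.tail x) (kpow K k))) := by
    intro i
    rw [headTensor_apply, slice_apply, funDeriv_dirFun G.2.1, map_smul, smul_eq_mul]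
  simp only [h1]
  rw [← map_sum]
  congr 1
  ext y
  rw [SmoothFn.sum_apply]
  simp only [snd_apply, SmoothFn.smul_apply, headTensor_apply, kpow_apply, Fin.prod_univ_succ,
    hK (x 0, y 0), ← mul_assoc, ← Finset.sum_mul]
  push_cast
  rfl

variable (f g) in
/-- The operator `∑ᵢ ∂_{fᵢ} ⊗ ∂_{gᵢ}`. -/
def gam : Module.End ℂ (compactFunctionals d ⊗[ℂ] compactFunctionals d) :=
  ∑ i, TensorProduct.map (dirD (f i)) (dirD (g i))

theorem contrBilin_eq_gam_pow (hK : IsTensorKernel K f g) (k : ℕ) (F G : compactFunctionals d) :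
    contrBilin K k F G = TensorProduct.lift (mulFun d) ((gam f g ^ k) (F ⊗ₜ G)) := by
  induction k generalizing F G with
  | zero =>
    refine Subtype.ext ?_
    simp only [pow_zero, Module.End.one_apply, TensorProduct.lift.tmul, mulFun_coe,
      contrBilin_apply]
    exact contr_zero F.2.1 G.2.1 K
  | succ k ih =>
    rw [contrBilin_succ hK, pow_succ, Module.End.mul_apply, gam, LinearMap.sum_apply, map_sum,
      map_sum]
    exact Finset.sum_congr rfl fun i _ => ih _ _

variable (d) in
/-- Triple tensor products of functionals. -/
abbrev Triple : Type := compactFunctionals d ⊗[ℂ] (compactFunctionals d ⊗[ℂ] compactFunctionals d)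

variable (f g) in
/-- The contraction of the first and the second factor. -/
def gam12 : Module.End ℂ (Triple d) :=
  ∑ i, TensorProduct.map (dirD (f i)) (TensorProduct.map (dirD (g i)) LinearMap.id)

variable (f g) in
/-- The contraction of the first and the third factor. -/
def gam13 : Module.End ℂ (Triple d) :=
  ∑ i, TensorProduct.map (dirD (f i)) (TensorProduct.map LinearMap.id (dirD (g i)))

variable (f g) in
/-- The contraction of the second and the third factor. -/
def gam23 : Module.End ℂ (Triple d) :=
  ∑ i, TensorProduct.map LinearMap.id (TensorProduct.map (dirD (f i)) (dirD (g i)))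

variable (d) in
/-- Multiplication of the first two factors. -/
def mul12 : Triple d →ₗ[ℂ] compactFunctionals d ⊗[ℂ] compactFunctionals d :=
  TensorProduct.map (TensorProduct.lift (mulFun d)) LinearMap.id ∘ₗ
    (TensorProduct.assoc ℂ _ _ _).symm.toLinearMap

variable (d) in
/-- Multiplication of the last two factors. -/
def mul23 : Triple d →ₗ[ℂ] compactFunctionals d ⊗[ℂ] compactFunctionals d :=
  TensorProduct.map LinearMap.id (TensorProduct.lift (mulFun d))

theorem lift_mulFun_mul12 : TensorProduct.lift (mulFun d) ∘ₗ mul12 d =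
    TensorProduct.lift (mulFun d) ∘ₗ mul23 d := by
  ext F G H : 5
  refine Subtype.ext ?_
  change (mulFun d (mulFun d F G) H : Functional d) = (mulFun d F (mulFun d G H) : Functional d)
  simp only [mulFun_coe, mul_assoc]

/-- The Leibniz rule for the first derivative of each pair: it acts on one of the two multiplied
factors. -/
theorem gam_mul12 : gam f g ∘ₗ mul12 d = mul12 d ∘ₗ (gam13 f g + gam23 f g) := by
  ext F G H : 5
  change gam f g (mulFun d F G ⊗ₜ H) =
    mul12 d (gam13 f g (F ⊗ₜ (G ⊗ₜ H)) + gam23 f g (F ⊗ₜ (G ⊗ₜ H)))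
  simp only [gam, gam13, gam23, LinearMap.sum_apply, ← Finset.sum_add_distrib, map_sum]
  refine Finset.sum_congr rfl fun i _ => ?_
  simp only [TensorProduct.map_tmul, dirD_mulFun, TensorProduct.add_tmul, map_add]
  rfl

theorem gam_mul23 : gam f g ∘ₗ mul23 d = mul23 d ∘ₗ (gam12 f g + gam13 f g) := by
  ext F G H : 5
  change gam f g (F ⊗ₜ mulFun d G H) =
    mul23 d (gam12 f g (F ⊗ₜ (G ⊗ₜ H)) + gam13 f g (F ⊗ₜ (G ⊗ₜ H)))
  simp only [gam, gam12, gam13, LinearMap.sum_apply, ← Finset.sum_add_distrib, map_sum]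
  refine Finset.sum_congr rfl fun i _ => ?_
  simp only [TensorProduct.map_tmul, dirD_mulFun, TensorProduct.tmul_add, map_add]
  rfl

theorem commute_dirD (h k : Config d) : Commute (dirD h) (dirD k) :=
  LinearMap.ext (dirD_comm h k)

theorem commute_map {A B : Type*} [AddCommGroup A] [AddCommGroup B] [Module ℂ A] [Module ℂ B]
    {u u' : Module.End ℂ A} {v v' : Module.End ℂ B} (hu : Commute u u') (hv : Commute v v') :
    Commute (TensorProduct.map u v : Module.End ℂ (A ⊗[ℂ] B)) (TensorProduct.map u' v') := by
  change TensorProduct.map u v ∘ₗ TensorProduct.map u' v' =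
    TensorProduct.map u' v' ∘ₗ TensorProduct.map u v
  rw [← TensorProduct.map_comp, ← TensorProduct.map_comp]
  exact congrArg₂ TensorProduct.map hu.eq hv.eq

theorem commute_id_left {A : Type*} [AddCommGroup A] [Module ℂ A] (u : Module.End ℂ A) :
    Commute (LinearMap.id : Module.End ℂ A) u := Commute.one_left u

theorem commute_id_right {A : Type*} [AddCommGroup A] [Module ℂ A] (u : Module.End ℂ A) :
    Commute u (LinearMap.id : Module.End ℂ A) := Commute.one_right u

theorem commute_gam12_gam13 : Commute (gam12 f g) (gam13 f g) :=
  Commute.sum_left _ _ _ fun _ _ => Commute.sum_right _ _ _ fun _ _ =>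
    commute_map (commute_dirD _ _) (commute_map (commute_id_right _) (commute_id_left _))

theorem commute_gam12_gam23 : Commute (gam12 f g) (gam23 f g) :=
  Commute.sum_left _ _ _ fun _ _ => Commute.sum_right _ _ _ fun _ _ =>
    commute_map (commute_id_right _) (commute_map (commute_dirD _ _) (commute_id_left _))

theorem commute_gam13_gam23 : Commute (gam13 f g) (gam23 f g) :=
  Commute.sum_left _ _ _ fun _ _ => Commute.sum_right _ _ _ fun _ _ =>
    commute_map (commute_id_right _) (commute_map (commute_id_left _) (commute_dirD _ _))

theorem intertwine_pow {A B : Type*} [AddCommMonoid A] [AddCommMonoid B] [Module ℂ A] [Module ℂ B]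
    {u : Module.End ℂ A} {v : Module.End ℂ B} {T : B →ₗ[ℂ] A} (h : u ∘ₗ T = T ∘ₗ v) (k : ℕ)
    (b : B) : (u ^ k) (T b) = T ((v ^ k) b) := by
  induction k generalizing b with
  | zero => rfl
  | succ k ih =>
    rw [pow_succ, pow_succ, Module.End.mul_apply, Module.End.mul_apply, ← ih]
    exact congrArg _ (LinearMap.congr_fun h b)

/-- Both contractions are moved in front of a single triple multiplication, where associativity
becomes a statement about commuting operators. -/
theorem contrBilin_left (hK : IsTensorKernel K f g) (k l : ℕ) (F G H : compactFunctionals d) :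
    contrBilin K k (contrBilin K l F G) H = TensorProduct.lift (mulFun d) (mul12 d
      (((gam13 f g + gam23 f g) ^ k * gam12 f g ^ l) (F ⊗ₜ (G ⊗ₜ H)))) := by
  have h1 : mul12 d ((gam12 f g ^ l) (F ⊗ₜ (G ⊗ₜ H))) = contrBilin K l F G ⊗ₜ[ℂ] H := by
    rw [contrBilin_eq_gam_pow hK]
    let T : compactFunctionals d ⊗[ℂ] compactFunctionals d →ₗ[ℂ] Triple d :=
      (TensorProduct.assoc ℂ _ _ _).toLinearMap ∘ₗ (TensorProduct.mk ℂ _ _).flip H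
    have hT : gam12 f g ∘ₗ T = T ∘ₗ gam f g := by
      ext F G : 3
      simp [T, gam12, gam]
    have h2 := intertwine_pow hT l (F ⊗ₜ G)
    have h3 : T (F ⊗ₜ G) = F ⊗ₜ (G ⊗ₜ H) := rfl
    rw [h3] at h2
    rw [h2]
    simp [T, mul12]
  rw [contrBilin_eq_gam_pow hK, ← h1, intertwine_pow gam_mul12]
  rfl

theorem contrBilin_right (hK : IsTensorKernel K f g) (k l : ℕ) (F G H : compactFunctionals d) :
    contrBilin K k F (contrBilin K l G H) = TensorProduct.lift (mulFun d) (mul12 d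
      (((gam12 f g + gam13 f g) ^ k * gam23 f g ^ l) (F ⊗ₜ (G ⊗ₜ H)))) := by
  have h1 : mul23 d ((gam23 f g ^ l) (F ⊗ₜ (G ⊗ₜ H))) = F ⊗ₜ[ℂ] contrBilin K l G H := by
    rw [contrBilin_eq_gam_pow hK]
    let T : compactFunctionals d ⊗[ℂ] compactFunctionals d →ₗ[ℂ] Triple d :=
      TensorProduct.mk ℂ _ _ F
    have hT : gam23 f g ∘ₗ T = T ∘ₗ gam f g := by
      ext F G : 3
      simp [T, gam23, gam]
    have h2 := intertwine_pow hT l (G ⊗ₜ H)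
    have h3 : T (G ⊗ₜ H) = F ⊗ₜ (G ⊗ₜ H) := rfl
    rw [h3] at h2
    rw [h2]
    simp [T, mul23]
  rw [contrBilin_eq_gam_pow hK, ← h1, intertwine_pow gam_mul23]
  exact (LinearMap.congr_fun lift_mulFun_mul12 _).symm

/-- The binomial theorem, in the form of the degree `N` part of `exp(x) exp(y) = exp(x + y)`. -/
theorem sum_divided_powers {R : Type*} [Semiring R] [Algebra ℂ R] {x y : R} (h : Commute x y) (N : ℕ) :
    ∑ q ∈ Finset.HasAntidiagonal.antidiagonal N,
      ((q.1.factorial : ℂ)⁻¹ * (q.2.factorial : ℂ)⁻¹) • (x ^ q.1 * y ^ q.2) =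
        (N.factorial : ℂ)⁻¹ • (x + y) ^ N := by
  rw [h.add_pow', Finset.smul_sum]
  refine Finset.sum_congr rfl fun q hq => ?_
  rw [Finset.HasAntidiagonal.mem_antidiagonal] at hq
  subst hq
  rw [← Nat.cast_smul_eq_nsmul ℂ, smul_smul, Nat.choose_symm_add, Nat.add_choose,
    Nat.cast_div (Nat.factorial_mul_factorial_dvd_factorial_add _ _)
      (by exact_mod_cast mul_ne_zero (Nat.factorial_ne_zero _) (Nat.factorial_ne_zero _))]
  congr 1
  push_cast
  field_simp [Nat.factorial_ne_zero]

/-- Both sides are the degree `N` part of `exp(Γ₁₂ + Γ₁₃ + Γ₂₃)`, followed by multiplication of the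
three factors. -/
theorem contrBilin_assoc_tensor (hK : IsTensorKernel K f g) (N : ℕ)
    (F G H : compactFunctionals d) :
    ∑ q ∈ Finset.HasAntidiagonal.antidiagonal N, ((q.1.factorial : ℂ)⁻¹ * (q.2.factorial : ℂ)⁻¹) •
      contrBilin K q.1 (contrBilin K q.2 F G) H =
    ∑ q ∈ Finset.HasAntidiagonal.antidiagonal N, ((q.1.factorial : ℂ)⁻¹ * (q.2.factorial : ℂ)⁻¹) •
      contrBilin K q.1 F (contrBilin K q.2 G H) := by
  have h1 := sum_divided_powers (R := Module.End ℂ (Triple d))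
    (commute_gam12_gam13.symm.add_left commute_gam12_gam23.symm : Commute
      (gam13 f g + gam23 f g) (gam12 f g)) N
  have h2 := sum_divided_powers (R := Module.End ℂ (Triple d))
    (commute_gam12_gam23.add_left commute_gam13_gam23 : Commute
      (gam12 f g + gam13 f g) (gam23 f g)) N
  have h3 : gam13 f g + gam23 f g + gam12 f g = gam12 f g + gam13 f g + gam23 f g := by abel
  rw [h3, ← h2] at h1
  have h4 := congrArg (fun u : Module.End ℂ (Triple d) =>
    TensorProduct.lift (mulFun d) (mul12 d (u (F ⊗ₜ (G ⊗ₜ H))))) h1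
  simp only [LinearMap.sum_apply, LinearMap.smul_apply, map_sum, map_smul] at h4
  simpa only [contrBilin_left hK, contrBilin_right hK] using h4

theorem contrBilin_comm_tensor {K' : Kernel d} (hK : IsTensorKernel K f g)
    (hK' : IsTensorKernel K' g f) (k : ℕ) (F G : compactFunctionals d) :
    contrBilin K k F G = contrBilin K' k G F := by
  induction k generalizing F G with
  | zero =>
    refine Subtype.ext ?_
    change contr K 0 F.1 G.1 = contr K' 0 G.1 F.1
    rw [contr_zero F.2.1 G.2.1, contr_zero G.2.1 F.2.1, mul_comm]
  | succ k ih =>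
    rw [contrBilin_succ hK, contrBilin_succ hK']
    exact Finset.sum_congr rfl fun i _ => ih _ _

end Algebra

/-! ### From finite rank kernels to all smooth kernels -/

theorem continuous_contr_apply (k : ℕ) {F : Functional d} (hF : ∃ D, IsFunDeriv F D)
    (G : Functional d) (φ : Config d) : Continuous fun K => contr K k F G φ :=
  ((funDeriv_spec hF).cont k).comp (continuous_const.prodMk
    (continuous_slice (D := fun _ => funDeriv G k φ)
      ((funDeriv G k φ).continuous.comp _root_.continuous_snd) (continuous_kpow k)))

/-- Exchanging the functionals amounts to exchanging the arguments of the kernel. This holds for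
finite rank kernels, hence for all by density and continuity; only afterwards does the symmetry of
`K` enter, so the approximating kernels need not be symmetric. -/
theorem contrBilin_comm {K : Kernel d} (hK : ∀ x y, K (x, y) = K (y, x)) (k : ℕ)
    (F G : compactFunctionals d) : contrBilin K k F G = contrBilin K k G F := by
  let sw : Kernel d → Kernel d :=
    comp ((ContinuousLinearMap.snd ℝ _ _).prod (ContinuousLinearMap.fst ℝ _ _))
  have hsw : Continuous sw := continuous_comp _
  have key : ∀ φ, (fun K => contr K k F.1 G.1 φ) = fun K => contr (sw K) k G.1 F.1 φ := by
    intro φ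
    refine Continuous.ext_on (dense_tensorKernels d) (continuous_contr_apply k F.2.1 G.1 φ)
      ((continuous_contr_apply k G.2.1 F.1 φ).comp hsw) ?_
    rintro K ⟨ι, _, f, g, h⟩
    have h' : IsTensorKernel (sw K) g f := fun a =>
      (h (a.2, a.1)).trans (Finset.sum_congr rfl fun i _ => mul_comm _ _)
    exact congrArg (fun A : compactFunctionals d => A.1 φ) (contrBilin_comm_tensor h h' k F G)
  have hs : sw K = K := by
    ext a
    exact hK a.2 a.1
  refine Subtype.ext (funext fun φ => ?_)
  have := congrFun (key φ) K
  simp only [hs] at this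
  exact this

theorem continuous_contr_left (k l : ℕ) (F G H : compactFunctionals d) (φ : Config d) :
    Continuous fun K => contr K k (contr K l F.1 G.1) H.1 φ := by
  have h : (fun K => contr K k (contr K l F.1 G.1) H.1 φ) = fun K =>
      contrDeriv F.2.1 G.2.1 K l k φ (slice (funDeriv H.1 k φ) (kpow K k)) := by
    funext K
    rw [contr, funDeriv_contr F.2.1 G.2.1]
  rw [h]
  exact (continuous_contrDeriv F.2.1 G.2.1 l k).comp (continuous_id.prodMk
    (continuous_const.prodMk (continuous_slice (D := fun _ => funDeriv H.1 k φ)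
      ((funDeriv H.1 k φ).continuous.comp _root_.continuous_snd) (continuous_kpow k))))

theorem continuous_contr_right (k l : ℕ) (F G H : compactFunctionals d) (φ : Config d) :
    Continuous fun K => contr K k F.1 (contr K l G.1 H.1) φ := by
  have h : (fun K => contr K k F.1 (contr K l G.1 H.1) φ) = fun K =>
      funDeriv F.1 k φ (slice (contrDeriv G.2.1 H.2.1 K l k φ) (kpow K k)) := by
    funext K
    rw [contr, funDeriv_contr G.2.1 H.2.1]
  rw [h]
  refine ((funDeriv_spec F.2.1).cont k).comp (continuous_const.prodMk
    (continuous_slice (D := fun K => contrDeriv G.2.1 H.2.1 K l k φ) ?_ (continuous_kpow k)))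
  exact (continuous_contrDeriv G.2.1 H.2.1 l k).comp (continuous_fst.prodMk
    (continuous_const.prodMk _root_.continuous_snd))

/-- At a fixed field both sides are continuous in the kernel, also in the nested contractions,
because the derivatives of the inner contraction depend jointly continuously on the kernel and the
test function. -/
theorem contrBilin_assoc (K : Kernel d) (N : ℕ) (F G H : compactFunctionals d) :
    ∑ q ∈ Finset.HasAntidiagonal.antidiagonal N, ((q.1.factorial : ℂ)⁻¹ * (q.2.factorial : ℂ)⁻¹) •
      contrBilin K q.1 (contrBilin K q.2 F G) H =
    ∑ q ∈ Finset.HasAntidiagonal.antidiagonal N, ((q.1.factorial : ℂ)⁻¹ * (q.2.factorial : ℂ)⁻¹) •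
      contrBilin K q.1 F (contrBilin K q.2 G H) := by
  refine Subtype.ext (funext fun φ => ?_)
  have key : (fun K => ∑ q ∈ Finset.HasAntidiagonal.antidiagonal N,
        ((q.1.factorial : ℂ)⁻¹ * (q.2.factorial : ℂ)⁻¹) •
          contr K q.1 (contr K q.2 F.1 G.1) H.1 φ) =
      fun K => ∑ q ∈ Finset.HasAntidiagonal.antidiagonal N,
        ((q.1.factorial : ℂ)⁻¹ * (q.2.factorial : ℂ)⁻¹) •
          contr K q.1 F.1 (contr K q.2 G.1 H.1) φ := by
    refine Continuous.ext_on (dense_tensorKernels d)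
      (continuous_finsetSum _ fun q _ => (continuous_contr_left q.1 q.2 F G H φ).fun_const_smul _)
      (continuous_finsetSum _ fun q _ => (continuous_contr_right q.1 q.2 F G H φ).fun_const_smul _) ?_
    rintro K ⟨ι, _, f, g, h⟩
    have := congrArg (fun A : compactFunctionals d => A.1 φ) (contrBilin_assoc_tensor h N F G H)
    simpa [Submodule.coe_sum, Finset.sum_apply] using this
  have := congrFun key K
  simpa [Submodule.coe_sum, Finset.sum_apply] using this

end EuclideanEG

namespace EuclideanEG
open Filter SmoothFn

variable {d : ℕ}

/-! ### Formal power series of functionals -/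

theorem sum_antidiagonal_assoc {A : Type*} [AddCommMonoid A] (f : ℕ → ℕ → ℕ → A) (N : ℕ) :
    ∑ p ∈ Finset.HasAntidiagonal.antidiagonal N, ∑ q ∈ Finset.HasAntidiagonal.antidiagonal p.1,
      f q.1 q.2 p.2 =
    ∑ p ∈ Finset.HasAntidiagonal.antidiagonal N, ∑ q ∈ Finset.HasAntidiagonal.antidiagonal p.2,
      f p.1 q.1 q.2 := by
  rw [Finset.sum_sigma', Finset.sum_sigma']
  refine Finset.sum_bij' (fun a _ => ⟨(a.2.1, a.2.2 + a.1.2), (a.2.2, a.1.2)⟩)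
    (fun a _ => ⟨(a.1.1 + a.2.1, a.2.2), (a.1.1, a.2.1)⟩) ?_ ?_ ?_ ?_ ?_
  all_goals
    rintro ⟨⟨a, b⟩, ⟨c, e⟩⟩ h
    simp only [Finset.mem_sigma, Finset.HasAntidiagonal.mem_antidiagonal, and_true] at h ⊢
  · omega
  · omega
  · obtain ⟨-, rfl⟩ := h
    rfl
  · obtain ⟨-, rfl⟩ := h
    rfl

theorem sum_antidiagonal_left_comm {A : Type*} [AddCommMonoid A] (f : ℕ → ℕ → ℕ → A) (N : ℕ) :
    ∑ p ∈ Finset.HasAntidiagonal.antidiagonal N, ∑ q ∈ Finset.HasAntidiagonal.antidiagonal p.2,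
      f p.1 q.1 q.2 =
    ∑ p ∈ Finset.HasAntidiagonal.antidiagonal N, ∑ q ∈ Finset.HasAntidiagonal.antidiagonal p.2,
      f q.1 p.1 q.2 := by
  rw [Finset.sum_sigma', Finset.sum_sigma']
  refine Finset.sum_bij' (fun a _ => ⟨(a.2.1, a.1.1 + a.2.2), (a.1.1, a.2.2)⟩)
    (fun a _ => ⟨(a.2.1, a.1.1 + a.2.2), (a.1.1, a.2.2)⟩) ?_ ?_ ?_ ?_ ?_
  all_goals
    rintro ⟨⟨a, b⟩, ⟨c, e⟩⟩ h
    simp only [Finset.mem_sigma, Finset.HasAntidiagonal.mem_antidiagonal, and_true] at h ⊢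
  · omega
  · omega
  · obtain ⟨-, rfl⟩ := h
    rfl
  · obtain ⟨-, rfl⟩ := h
    rfl

section Series

variable {S S' : Submodule ℂ (Functional d)}

/-- The coefficients of a series, as elements of the space of functionals. -/
def cf (F : seriesIn S) (j : ℕ) : S := ⟨PowerSeries.coeff j F.1, F.2 j⟩

/-- The series with the given coefficients. -/
def ofCoeffs (f : ℕ → S) : seriesIn S :=
  ⟨PowerSeries.mk fun j => (f j).1, fun j => by rw [PowerSeries.coeff_mk]; exact (f j).2⟩

@[simp] theorem cf_coe (F : seriesIn S) (j : ℕ) :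
    (cf F j : Functional d) = PowerSeries.coeff j F.1 := rfl

@[simp] theorem cf_ofCoeffs (f : ℕ → S) (j : ℕ) : cf (ofCoeffs f) j = f j :=
  Subtype.ext (by rw [cf_coe, ofCoeffs, PowerSeries.coeff_mk])

theorem series_ext {F G : seriesIn S} (h : ∀ j, cf F j = cf G j) : F = G :=
  Subtype.ext (PowerSeries.ext fun j => congrArg Subtype.val (h j))

@[simp] theorem cf_add (F G : seriesIn S) (j : ℕ) : cf (F + G) j = cf F j + cf G j :=
  Subtype.ext (map_add (PowerSeries.coeff j) F.1 G.1)

theorem cf_smul (a : ℂ⟦X⟧) (F : seriesIn S) (N : ℕ) : cf (a • F) N =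
    ∑ p ∈ Finset.HasAntidiagonal.antidiagonal N, PowerSeries.coeff p.1 a • cf F p.2 := by
  refine Subtype.ext ?_
  have h : (a • F).1 = PowerSeries.map (algebraMap ℂ (Functional d)) a * F.1 := rfl
  rw [cf_coe, h, PowerSeries.coeff_mul, Submodule.coe_sum]
  refine Finset.sum_congr rfl fun p _ => ?_
  rw [PowerSeries.coeff_map, ← Algebra.smul_def]
  rfl

/-- A linear map of spaces of functionals, applied to the coefficients of series. -/
def seriesMap (T : S →ₗ[ℂ] S') : seriesIn S →ₗ[ℂ⟦X⟧] seriesIn S' where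
  toFun F := ofCoeffs fun j => T (cf F j)
  map_add' F G := series_ext fun j => by simp
  map_smul' a F := series_ext fun j => by simp [cf_smul]

@[simp] theorem cf_seriesMap (T : S →ₗ[ℂ] S') (F : seriesIn S) (j : ℕ) :
    cf (seriesMap T F) j = T (cf F j) := cf_ofCoeffs _ _

/-- A functional as a constant series. -/
def const (f : S) : seriesIn S := ofCoeffs fun j => if j = 0 then f else 0

theorem cf_const (f : S) (j : ℕ) : cf (const f) j = if j = 0 then f else 0 := cf_ofCoeffs _ _

/-- The series with its first `N` coefficients removed. -/
def shift (N : ℕ) (F : seriesIn S) : seriesIn S := ofCoeffs fun j => cf F (j + N)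

@[simp] theorem cf_shift (N : ℕ) (F : seriesIn S) (j : ℕ) : cf (shift N F) j = cf F (j + N) :=
  cf_ofCoeffs _ _

theorem cf_X_pow_smul (N : ℕ) (F : seriesIn S) (j : ℕ) :
    cf ((PowerSeries.X ^ N : ℂ⟦X⟧) • F) j = if N ≤ j then cf F (j - N) else 0 := by
  rw [cf_smul]
  split_ifs with h
  · rw [Finset.sum_eq_single (N, j - N)]
    · simp [PowerSeries.coeff_X_pow]
    · rintro ⟨a, b⟩ hab hne
      rw [Finset.HasAntidiagonal.mem_antidiagonal] at hab
      rw [PowerSeries.coeff_X_pow, if_neg, zero_smul]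
      rintro rfl
      exact hne (by simp only [Prod.mk.injEq, true_and]; omega)
    · intro hN
      exact absurd (by rw [Finset.HasAntidiagonal.mem_antidiagonal]; omega) hN
  · refine Finset.sum_eq_zero fun p hp => ?_
    rw [Finset.HasAntidiagonal.mem_antidiagonal] at hp
    rw [PowerSeries.coeff_X_pow, if_neg (by omega), zero_smul]

/-- The coefficients of the two series agree up to order `N`. -/
def EqTo (N : ℕ) (F G : (Functional d)⟦X⟧) : Prop :=
  ∀ j ≤ N, PowerSeries.coeff j F = PowerSeries.coeff j G

theorem EqTo.refl (N : ℕ) (F : (Functional d)⟦X⟧) : EqTo N F F := fun _ _ => rfl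

theorem EqTo.symm {N : ℕ} {F G : (Functional d)⟦X⟧} (h : EqTo N F G) : EqTo N G F :=
  fun j hj => (h j hj).symm

theorem EqTo.trans {N : ℕ} {F G H : (Functional d)⟦X⟧} (h : EqTo N F G) (h' : EqTo N G H) :
    EqTo N F H := fun j hj => (h j hj).trans (h' j hj)

theorem EqTo.add {N : ℕ} {F G F' G' : (Functional d)⟦X⟧} (h : EqTo N F G) (h' : EqTo N F' G') :
    EqTo N (F + F') (G + G') := fun j hj => by rw [map_add, map_add, h j hj, h' j hj]

theorem EqTo.sum {ι : Type*} (s : Finset ι) {N : ℕ} {F G : ι → (Functional d)⟦X⟧}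
    (h : ∀ i ∈ s, EqTo N (F i) (G i)) : EqTo N (∑ i ∈ s, F i) (∑ i ∈ s, G i) := fun j hj => by
  rw [map_sum, map_sum]
  exact Finset.sum_congr rfl fun i hi => h i hi j hj

theorem eq_of_eqTo {F G : seriesIn S} (h : ∀ N, EqTo N F.1 G.1) : F = G :=
  series_ext fun j => Subtype.ext (h j j le_rfl)

theorem eq_X_pow_smul_shift {N : ℕ} {F : seriesIn S} (h : EqTo N F.1 0) :
    F = (PowerSeries.X ^ (N + 1) : ℂ⟦X⟧) • shift (N + 1) F := by
  refine series_ext fun j => ?_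
  rw [cf_X_pow_smul]
  split_ifs with hj
  · rw [cf_shift, Nat.sub_add_cancel hj]
  · refine Subtype.ext ((h j (by omega)).trans ?_)
    rw [map_zero]
    rfl

theorem eqTo_X_pow_smul (N : ℕ) (F : seriesIn S) :
    EqTo N ((PowerSeries.X ^ (N + 1) : ℂ⟦X⟧) • F).1 0 := fun j hj => by
  rw [← cf_coe, cf_X_pow_smul, if_neg (by omega), map_zero]
  rfl

/-- Linearity over power series makes maps continuous in the `ħ`-adic sense: a series that vanishes
up to order `N` is `ħ^(N+1)` times a series. -/
theorem EqTo.map_zero {N : ℕ} {F : seriesIn S} (h : EqTo N F.1 0)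
    (T : seriesIn S →ₗ[ℂ⟦X⟧] seriesIn S') : EqTo N (T F).1 0 := by
  rw [eq_X_pow_smul_shift h, map_smul]
  exact eqTo_X_pow_smul N _

theorem EqTo.map {N : ℕ} {F G : seriesIn S} (h : EqTo N F.1 G.1)
    (T : seriesIn S →ₗ[ℂ⟦X⟧] seriesIn S') : EqTo N (T F).1 (T G).1 := by
  have h0 : EqTo N (F - G).1 0 := fun j hj => by
    rw [Submodule.coe_sub, map_sub, h j hj, sub_self, _root_.map_zero]
  have h1 := h0.map_zero T
  rw [map_sub] at h1
  intro j hj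
  have h2 := h1 j hj
  rw [Submodule.coe_sub, map_sub, _root_.map_zero, sub_eq_zero] at h2
  exact h2

theorem linearMap_ext_const {T T' : seriesIn S →ₗ[ℂ⟦X⟧] seriesIn S'}
    (h : ∀ f, T (const f) = T' (const f)) : T = T' := by
  refine LinearMap.ext fun F => eq_of_eqTo fun N => ?_
  have h1 : EqTo N F.1
      (∑ i ∈ Finset.range (N + 1), (PowerSeries.X ^ i : ℂ⟦X⟧) • const (cf F i) : seriesIn S).1 := by
    intro j hj
    rw [Submodule.coe_sum, map_sum, Finset.sum_eq_single j]
    · rw [← cf_coe, ← cf_coe, cf_X_pow_smul, if_pos le_rfl, cf_const, if_pos (by omega)]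
    · intro i _ hij
      rw [← cf_coe, cf_X_pow_smul]
      split_ifs with hi
      · rw [cf_const, if_neg (by omega)]
        rfl
      · rfl
    · intro hj'
      exact absurd (Finset.mem_range.2 (by omega)) hj'
  refine (h1.map T).trans (EqTo.trans ?_ (h1.map T').symm)
  simp only [map_sum, map_smul, h]
  exact EqTo.refl _ _

end Series

/-! ### The star product of a smooth kernel -/

/-- The star product `∑ₖ ħᵏ / k! ⟨F^{(k)}, K^{⊗k} G^{(k)}⟩`. -/
def star (K : Kernel d) : CompactSeries d →ₗ[ℂ⟦X⟧] CompactSeries d →ₗ[ℂ⟦X⟧] CompactSeries d :=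
  LinearMap.mk₂ ℂ⟦X⟧
    (fun F G => ofCoeffs fun N => ∑ q ∈ Finset.HasAntidiagonal.antidiagonal N,
      ∑ p ∈ Finset.HasAntidiagonal.antidiagonal q.2,
        (q.1.factorial : ℂ)⁻¹ • contrBilin K q.1 (cf F p.1) (cf G p.2))
    (fun F F' G => series_ext fun N => by
      simp only [cf_ofCoeffs, cf_add, map_add, LinearMap.add_apply, smul_add,
        Finset.sum_add_distrib])
    (fun a F G => series_ext fun N => by
      simp only [cf_ofCoeffs, cf_smul, map_sum, map_smul, LinearMap.sum_apply,
        LinearMap.smul_apply, Finset.smul_sum]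
      -- The triple sums are reordered such that the summation over the coefficients of `a` becomes
      -- the outermost one.
      have h1 : ∀ k M, ∑ p ∈ Finset.HasAntidiagonal.antidiagonal M,
          ∑ i ∈ Finset.HasAntidiagonal.antidiagonal p.1, (k.factorial : ℂ)⁻¹ •
            PowerSeries.coeff i.1 a • contrBilin K k (cf F i.2) (cf G p.2) = _ := fun k M =>
        sum_antidiagonal_assoc (fun r s q => (k.factorial : ℂ)⁻¹ •
          PowerSeries.coeff r a • contrBilin K k (cf F s) (cf G q)) M
      simp only [h1]
      rw [sum_antidiagonal_left_comm fun k r M => ∑ i ∈ Finset.HasAntidiagonal.antidiagonal M,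
        (k.factorial : ℂ)⁻¹ • PowerSeries.coeff r a • contrBilin K k (cf F i.1) (cf G i.2)]
      simp only [smul_comm (_ : ℂ) (PowerSeries.coeff _ a)])
    (fun F G G' => series_ext fun N => by
      simp only [cf_ofCoeffs, cf_add, map_add, smul_add, Finset.sum_add_distrib])
    (fun a F G => series_ext fun N => by
      simp only [cf_ofCoeffs, cf_smul, map_sum, map_smul, Finset.smul_sum]
      have h1 : ∀ k M, ∑ p ∈ Finset.HasAntidiagonal.antidiagonal M,
          ∑ i ∈ Finset.HasAntidiagonal.antidiagonal p.2, (k.factorial : ℂ)⁻¹ •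
            PowerSeries.coeff i.1 a • contrBilin K k (cf F p.1) (cf G i.2) = _ := fun k M =>
        sum_antidiagonal_left_comm (fun p r s => (k.factorial : ℂ)⁻¹ •
          PowerSeries.coeff r a • contrBilin K k (cf F p) (cf G s)) M
      simp only [h1]
      rw [sum_antidiagonal_left_comm fun k r M => ∑ i ∈ Finset.HasAntidiagonal.antidiagonal M,
        (k.factorial : ℂ)⁻¹ • PowerSeries.coeff r a • contrBilin K k (cf F i.1) (cf G i.2)]
      simp only [smul_comm (_ : ℂ) (PowerSeries.coeff _ a)])

theorem cf_star (K : Kernel d) (F G : CompactSeries d) (N : ℕ) : cf (star K F G) N =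
    ∑ q ∈ Finset.HasAntidiagonal.antidiagonal N, ∑ p ∈ Finset.HasAntidiagonal.antidiagonal q.2,
      (q.1.factorial : ℂ)⁻¹ • contrBilin K q.1 (cf F p.1) (cf G p.2) := cf_ofCoeffs _ _

theorem star_comm {K : Kernel d} (hK : ∀ x y, K (x, y) = K (y, x)) (F G : CompactSeries d) :
    star K F G = star K G F := by
  refine series_ext fun N => ?_
  rw [cf_star, cf_star]
  refine Finset.sum_congr rfl fun q _ => ?_
  rw [← Finset.Nat.sum_antidiagonal_swap]
  exact Finset.sum_congr rfl fun p _ => by rw [contrBilin_comm hK]; rfl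

theorem cf_star_const_right (K : Kernel d) (F : CompactSeries d) (g : compactFunctionals d)
    (N : ℕ) : cf (star K F (const g)) N = ∑ q ∈ Finset.HasAntidiagonal.antidiagonal N,
      (q.1.factorial : ℂ)⁻¹ • contrBilin K q.1 (cf F q.2) g := by
  rw [cf_star]
  refine Finset.sum_congr rfl fun q _ => ?_
  rw [Finset.sum_eq_single (q.2, 0)]
  · rw [cf_const, if_pos rfl]
  · rintro ⟨a, b⟩ hab hne
    rw [Finset.HasAntidiagonal.mem_antidiagonal] at hab
    rw [cf_const, if_neg, map_zero, smul_zero]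
    rintro rfl
    exact hne (by simpa using hab)
  · intro h
    exact absurd (by rw [Finset.HasAntidiagonal.mem_antidiagonal, add_zero]) h

theorem cf_star_const_left (K : Kernel d) (f : compactFunctionals d) (G : CompactSeries d)
    (N : ℕ) : cf (star K (const f) G) N = ∑ q ∈ Finset.HasAntidiagonal.antidiagonal N,
      (q.1.factorial : ℂ)⁻¹ • contrBilin K q.1 f (cf G q.2) := by
  rw [cf_star]
  refine Finset.sum_congr rfl fun q _ => ?_
  rw [Finset.sum_eq_single (0, q.2)]
  · rw [cf_const, if_pos rfl]
  · rintro ⟨a, b⟩ hab hne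
    rw [Finset.HasAntidiagonal.mem_antidiagonal] at hab
    rw [cf_const, if_neg, map_zero, LinearMap.zero_apply, smul_zero]
    rintro rfl
    exact hne (by simpa using hab)
  · intro h
    exact absurd (by rw [Finset.HasAntidiagonal.mem_antidiagonal, zero_add]) h

theorem star_const_const (K : Kernel d) (f g : compactFunctionals d) (N : ℕ) :
    cf (star K (const f) (const g)) N = (N.factorial : ℂ)⁻¹ • contrBilin K N f g := by
  rw [cf_star_const_right, Finset.sum_eq_single (N, 0)]
  · rw [cf_const, if_pos rfl]
  · rintro ⟨a, b⟩ hab hne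
    rw [Finset.HasAntidiagonal.mem_antidiagonal] at hab
    rw [cf_const, if_neg, map_zero, LinearMap.zero_apply, smul_zero]
    rintro rfl
    exact hne (by simpa using hab)
  · intro h
    exact absurd (by rw [Finset.HasAntidiagonal.mem_antidiagonal, add_zero]) h

/-- For constant series, coefficient `N` is the associativity of contractions in degree `N`.
Series-linear maps that agree on constants agree, which extends the identity to the third, the
second and then the first argument. -/
theorem star_assoc (K : Kernel d) (F G H : CompactSeries d) :
    star K (star K F G) H = star K F (star K G H) := by
  have key : ∀ f g h : compactFunctionals d,
      star K (star K (const f) (const g)) (const h) =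
        star K (const f) (star K (const g) (const h)) := fun f g h => series_ext fun N => by
    simp only [cf_star_const_right K (star K _ _), cf_star_const_left K _ (star K _ _),
      star_const_const, map_smul, LinearMap.smul_apply, smul_smul]
    exact contrBilin_assoc K N f g h
  have h1 : ∀ f g, star K (star K (const f) (const g)) = star K (const f) ∘ₗ star K (const g) :=
    fun f g => linearMap_ext_const (key f g)
  have h2 : ∀ f, (star K).flip H ∘ₗ star K (const f) = star K (const f) ∘ₗ (star K).flip H :=
    fun f => linearMap_ext_const fun g => LinearMap.congr_fun (h1 f g) H
  have h3 : (star K).flip H ∘ₗ (star K).flip G = (star K).flip (star K G H) :=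
    linearMap_ext_const fun f => LinearMap.congr_fun (h2 f) G
  exact LinearMap.congr_fun h3 F

/-- The functional derivatives of the constant functional `1`. -/
def oneDeriv (d : ℕ) : (n : ℕ) → Config d → CDist (Fin n → Space d)
  | 0, _ =>
    { toFun := fun f => f ![]
      map_add' := fun _ _ => rfl
      map_smul' := fun _ _ => rfl
      cont := (continuous_iff.1 continuous_id []).comp (continuous_id.prodMk continuous_const) }
  | _ + 1, _ => 0

theorem isFunDeriv_one : IsFunDeriv (1 : Functional d) (oneDeriv d) where
  zero φ f := (one_mul _).symm
  succ n φ h f := by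
    cases n <;> exact hasDerivAt_const _ _
  symm n φ σ f := by
    cases n with
    | zero => exact congrArg f (Subsingleton.elim _ _)
    | succ n => rfl
  cont n := by
    cases n with
    | zero =>
      exact (continuous_iff.1 _root_.continuous_snd []).comp (continuous_id.prodMk continuous_const)
    | succ n => exact continuous_const

theorem funSupport_one : funSupport (1 : Functional d) = ∅ :=
  Set.eq_empty_of_forall_notMem fun x hx => by
    obtain ⟨φ, h, -, hne⟩ := hx Set.univ Filter.univ_mem
    exact hne rfl

theorem contr_one {F : Functional d} (hF : ∃ D, IsFunDeriv F D) (K : Kernel d) (k : ℕ) :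
    contr K k F 1 = if k = 0 then F else 0 := by
  cases k with
  | zero => rw [contr_zero hF ⟨_, isFunDeriv_one⟩, mul_one, if_pos rfl]
  | succ k =>
    funext φ
    rw [contr, isFunDeriv_one.funDeriv_eq, if_neg k.succ_ne_zero]
    exact map_zero (funDeriv F (k + 1) φ)

theorem isCompactFunctional_one : IsCompactFunctional (1 : Functional d) :=
  ⟨⟨_, isFunDeriv_one⟩, ∅, isCompact_empty, funSupport_one.subset⟩

theorem star_one_right (K : Kernel d) (F G : CompactSeries d) (hG : G.1 = 1) : star K F G = F := by
  have h1 : G = const ⟨1, isCompactFunctional_one⟩ := by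
    refine series_ext fun j => Subtype.ext ?_
    rw [cf_coe, hG, cf_const, PowerSeries.coeff_one]
    split_ifs <;> rfl
  refine series_ext fun N => Subtype.ext ?_
  rw [h1, cf_star_const_right, Submodule.coe_sum, Finset.sum_eq_single (0, N)]
  · rw [Submodule.coe_smul, contrBilin_apply, contr_one (cf F N).2.1, if_pos rfl]
    simp
  · rintro ⟨a, b⟩ hab hne
    rw [Finset.HasAntidiagonal.mem_antidiagonal] at hab
    rw [Submodule.coe_smul, contrBilin_apply, contr_one (cf F b).2.1, if_neg, smul_zero]
    rintro rfl
    exact hne (by simpa using hab)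
  · intro h
    exact absurd (by rw [Finset.HasAntidiagonal.mem_antidiagonal, zero_add]) h

/-! ### The time-ordered product and the star product -/

/-- The union of the supports of the coefficients up to order `N`. -/
def suppTo (N : ℕ) (F : (Functional d)⟦X⟧) : Set (Space d) :=
  ⋃ j ∈ Finset.range (N + 1), funSupport (PowerSeries.coeff j F)

theorem funSupport_subset_suppTo {j N : ℕ} (h : j ≤ N) (F : (Functional d)⟦X⟧) :
    funSupport (PowerSeries.coeff j F) ⊆ suppTo N F :=
  Set.subset_biUnion_of_mem (u := fun j => funSupport (PowerSeries.coeff j F))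
    (Finset.mem_coe.2 (Finset.mem_range.2 (Nat.lt_succ_of_le h)))

theorem funSupport_subset_seriesSupport (j : ℕ) (F : (Functional d)⟦X⟧) :
    funSupport (PowerSeries.coeff j F) ⊆ seriesSupport F :=
  (Set.subset_iUnion (fun j => funSupport (PowerSeries.coeff j F)) j).trans subset_closure

theorem suppTo_subset_seriesSupport (N : ℕ) (F : (Functional d)⟦X⟧) :
    suppTo N F ⊆ seriesSupport F :=
  Set.iUnion₂_subset fun j _ => funSupport_subset_seriesSupport j F

theorem seriesSupport_subset {F : (Functional d)⟦X⟧} {S : Set (Space d)} (hS : IsClosed S)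
    (h : ∀ j, funSupport (PowerSeries.coeff j F) ⊆ S) : seriesSupport F ⊆ S :=
  hS.closure_subset_iff.2 (Set.iUnion_subset h)

theorem isClosed_seriesSupport (F : (Functional d)⟦X⟧) : IsClosed (seriesSupport F) :=
  isClosed_closure

theorem isCompact_suppTo {S : Submodule ℂ (Functional d)} (hS : S ≤ compactFunctionals d) (N : ℕ)
    (F : seriesIn S) : IsCompact (suppTo N F.1) :=
  (Finset.range (N + 1)).isCompact_biUnion fun j _ => IsCompactFunctional.isCompact (hS (F.2 j))

theorem FarApart.mono {r r' : ℝ} {S S' T T' : Set (Space d)} (h : FarApart r S S') (hr : r' ≤ r)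
    (hT : T ⊆ S) (hT' : T' ⊆ S') : FarApart r' T T' :=
  fun x hx y hy => hr.trans (h x (hT hx) y (hT' hy))

theorem exists_farApart {S S' : Set (Space d)} (hS : IsCompact S) (hS' : IsClosed S')
    (h : Disjoint S S') : ∃ r > 0, FarApart r S S' := by
  obtain ⟨r, hr, h'⟩ := Metric.exists_pos_forall_lt_edist hS hS' h
  refine ⟨r, hr, fun x hx y hy => ?_⟩
  have := (h' x hx y hy).le
  rw [edist_nndist, ENNReal.coe_le_coe] at this
  exact this

section TimeProd

variable {P : Space d → ℝ} (hP : ContDiffOn ℝ ∞ P {0}ᶜ)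

/-- Only the coefficients up to order `N` enter, and for their supports the cutoff is invisible. -/
theorem timeProd_eqTo_star {N : ℕ} {F G : CompactSeries d} {ε : Set.Ioi (0 : ℝ)}
    (h : FarApart (4 * ε.1) (suppTo N F.1) (suppTo N G.1)) :
    EqTo N (timeProd P F.1 G.1) (star (cutoffKernel hP ε) F G).1 := by
  intro j hj
  rw [← cf_coe, cf_star, timeProd, PowerSeries.coeff_mk, Submodule.coe_sum]
  refine Finset.sum_congr rfl fun q hq => ?_
  rw [Submodule.coe_sum]
  refine Finset.sum_congr rfl fun p hp => ?_
  rw [Finset.HasAntidiagonal.mem_antidiagonal] at hq hp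
  rw [Submodule.coe_smul, contrBilin_apply, contraction_eq_contr hP (F.2 _) (G.2 _) (h.mono le_rfl
    (funSupport_subset_suppTo (by omega) _) (funSupport_subset_suppTo (by omega) _)) ε le_rfl]
  rfl

/-- The support of a whole series need not be compact, and two disjoint series supports may have
distance zero. The coefficients up to order `N` have compact supports, so the cutoff may depend on
`N`. -/
theorem timeProd_eventually {F G : CompactSeries d}
    (h : Disjoint (seriesSupport F.1) (seriesSupport G.1)) (N : ℕ) :
    ∀ᶠ ε : Set.Ioi (0 : ℝ) in atBot,
      EqTo N (timeProd P F.1 G.1) (star (cutoffKernel hP ε) F G).1 := by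
  obtain ⟨r, hr, hfar⟩ := exists_farApart (isCompact_suppTo le_rfl N F)
    (isClosed_seriesSupport G.1) (h.mono_left (suppTo_subset_seriesSupport N F.1))
  filter_upwards [eventually_le_atBot (⟨r / 4, by simpa using hr⟩ : Set.Ioi (0 : ℝ))] with ε hε
  have hε' : ε.1 ≤ r / 4 := hε
  exact timeProd_eqTo_star hP
    (hfar.mono (by linarith) subset_rfl (suppTo_subset_seriesSupport N G.1))

end TimeProd

theorem funSupport_sum {ι : Type*} (s : Finset ι) (F : ι → Functional d) {S : Set (Space d)}
    (h : ∀ i ∈ s, funSupport (F i) ⊆ S) : funSupport (∑ i ∈ s, F i) ⊆ S := by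
  induction s using Finset.cons_induction with
  | empty => simp [funSupport_zero]
  | cons i s hi ih =>
    rw [Finset.sum_cons]
    exact (funSupport_add _ _).trans (Set.union_subset (h i (Finset.mem_cons_self i s))
      (ih fun j hj => h j (Finset.mem_cons_of_mem hj)))

theorem seriesSupport_star (K : Kernel d) (F G : CompactSeries d) :
    seriesSupport (star K F G).1 ⊆ seriesSupport F.1 ∪ seriesSupport G.1 := by
  refine seriesSupport_subset (isClosed_closure.union isClosed_closure) fun j => ?_
  rw [← cf_coe, cf_star, Submodule.coe_sum]
  refine funSupport_sum _ _ fun q _ => ?_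
  rw [Submodule.coe_sum]
  refine funSupport_sum _ _ fun p _ => (funSupport_smul _ _).trans ?_
  exact (funSupport_contr (cf F _).2.1 (cf G _).2.1 K q.1).trans (Set.union_subset_union
    (funSupport_subset_seriesSupport _ _) (funSupport_subset_seriesSupport _ _))

end EuclideanEG

namespace EuclideanEG
open Filter SmoothFn

variable {d : ℕ}

/-! ### Consistency of the causal factorizations -/

/-- `E_{|I|}(⨂_{i ∈ I} F_i)`. -/
def partE {k : ℕ} (E : (j : ℕ) → OrderMap d j) (I : Finset (Fin k)) (F : Fin k → LocalSeries d) :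
    CompactSeries d :=
  E I.card (subTensor F I)

/-- The supports of the series with indices in `I` are disjoint from those with indices in `J`. -/
def Separated {k : ℕ} (F : Fin k → LocalSeries d) (I J : Finset (Fin k)) : Prop :=
  ∀ i ∈ I, ∀ j ∈ J, Disjoint (seriesSupport (F i).1) (seriesSupport (F j).1)

theorem Separated.mono {k : ℕ} {F : Fin k → LocalSeries d} {I J I' J' : Finset (Fin k)}
    (h : Separated F I J) (hI : I' ⊆ I) (hJ : J' ⊆ J) : Separated F I' J' :=
  fun i hi j hj => h i (hI hi) j (hJ hj)

section Consistency

variable {P : Space d → ℝ} {n : ℕ} {E : (k : ℕ) → OrderMap d k} (hE : InductionHypothesis P n E)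

include hE in
-- By symmetry of the lower maps, any enumeration of `I` may replace the increasing one.
theorem partE_eq {k l : ℕ} (F : Fin k → LocalSeries d) (I : Finset (Fin k)) (hl : l < n)
    (e : Fin l → Fin k) (he : Function.Injective e) (hI : ∀ i, i ∈ I ↔ ∃ a, e a = i) :
    partE E I F = E l (tensor (F ∘ e)) := by
  have hIe : I = Finset.univ.map ⟨e, he⟩ := by
    ext i
    simp [hI]
  obtain rfl : l = I.card := by rw [hIe, Finset.card_map, Finset.card_univ, Fintype.card_fin]
  have hmem : ∀ a, e a ∈ I := fun a => (hI _).2 ⟨a, rfl⟩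
  let π : Fin I.card → Fin I.card := fun a => (I.orderIsoOfFin rfl).symm ⟨e a, hmem a⟩
  have hπ : Function.Bijective π := Finite.injective_iff_bijective.1 fun a b hab =>
    he (congrArg Subtype.val ((I.orderIsoOfFin rfl).symm.injective hab))
  have h := hE.symmetric _ hl (Equiv.ofBijective π hπ) fun j => F (I.orderEmbOfFin rfl j)
  have h2 : (fun j => F (I.orderEmbOfFin rfl j)) ∘ Equiv.ofBijective π hπ = F ∘ e := by
    funext a
    change F (I.orderEmbOfFin rfl (π a)) = F (e a)
    rw [← Finset.coe_orderIsoOfFin_apply, OrderIso.apply_symm_apply]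
  rw [h2] at h
  exact h.symm

include hE in
theorem partE_empty {k : ℕ} (hn : 0 < n) (F : Fin k → LocalSeries d) :
    (partE E ∅ F).1 = 1 := by
  rw [partE_eq hE F ∅ hn Fin.elim0 (fun a => a.elim0) (by simp), ← hE.order_zero]
  congr 3
  exact Subsingleton.elim _ _

include hE in
theorem seriesSupport_partE {k : ℕ} (F : Fin k → LocalSeries d) (I : Finset (Fin k))
    (hI : I.card < n) : seriesSupport (partE E I F).1 ⊆ ⋃ i ∈ I, seriesSupport (F i).1 := by
  refine (hE.support _ hI _).trans (Set.iUnion_subset fun a => ?_)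
  exact Set.subset_biUnion_of_mem (u := fun i => seriesSupport (F i).1)
    (Finset.orderEmbOfFin_mem I rfl a)

include hE in
theorem disjoint_partE {k : ℕ} {F : Fin k → LocalSeries d} {A B : Finset (Fin k)}
    (hA : A.card < n) (hB : B.card < n) (h : Separated F A B) :
    Disjoint (seriesSupport (partE E A F).1) (seriesSupport (partE E B F).1) := by
  refine Set.disjoint_of_subset (seriesSupport_partE hE F A hA) (seriesSupport_partE hE F B hB) ?_
  simp only [Set.disjoint_iUnion_left, Set.disjoint_iUnion_right]
  exact fun j hj i hi => h i hi j hj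

include hE in
-- Causality of the lower map of order `|A ∪ B|`, read off after enumerating `A ∪ B`.
theorem partE_union {k : ℕ} {F : Fin k → LocalSeries d} {A B : Finset (Fin k)}
    (hAB : Disjoint A B) (hA : A.Nonempty) (hB : B.Nonempty) (hn : (A ∪ B).card < n)
    (h : Separated F A B) :
    (partE E (A ∪ B) F).1 = timeProd P (partE E A F).1 (partE E B F).1 := by
  let e := (A ∪ B).orderEmbOfFin rfl
  have hrange : ∀ i, i ∈ A ∪ B ↔ ∃ a, e a = i := fun i => by
    rw [← Finset.mem_coe, ← Finset.range_orderEmbOfFin (A ∪ B) rfl]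
    rfl
  let A' : Finset (Fin (A ∪ B).card) := Finset.univ.filter fun a => e a ∈ A
  have hA' : ∀ a, a ∈ A' ↔ e a ∈ A := fun a => by simp [A']
  have hB' : ∀ a, a ∈ A'ᶜ ↔ e a ∈ B := fun a => by
    have h1 := (hrange (e a)).2 ⟨a, rfl⟩
    rw [Finset.mem_compl, hA']
    rw [Finset.mem_union] at h1
    exact ⟨fun h2 => h1.resolve_left h2, fun h2 h3 => Finset.disjoint_left.1 hAB h3 h2⟩
  have key : ∀ (C : Finset (Fin k)) (C' : Finset (Fin (A ∪ B).card)), C ⊆ A ∪ B →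
      (∀ a, a ∈ C' ↔ e a ∈ C) → partE E C' (F ∘ e) = partE E C F := by
    intro C C' hC hC'
    have hcard : C'.card < n := lt_of_le_of_lt (by simpa using Finset.card_le_univ C') hn
    refine (partE_eq hE F C hcard (e ∘ C'.orderEmbOfFin rfl)
      (e.injective.comp (C'.orderEmbOfFin rfl).injective) fun i => ⟨fun hi => ?_, ?_⟩).symm
    · obtain ⟨a, rfl⟩ := (hrange i).1 (hC hi)
      have h1 := (hC' a).2 hi
      rw [← Finset.mem_coe, ← Finset.range_orderEmbOfFin C' rfl] at h1
      obtain ⟨b, rfl⟩ := h1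
      exact ⟨b, rfl⟩
    · rintro ⟨a, rfl⟩
      exact (hC' _).1 (Finset.orderEmbOfFin_mem C' rfl a)
  have hne : ∀ (C : Finset (Fin k)) (C' : Finset (Fin (A ∪ B).card)), C ⊆ A ∪ B →
      (∀ a, a ∈ C' ↔ e a ∈ C) → C.Nonempty → C'.Nonempty := by
    rintro C C' hC hC' ⟨i, hi⟩
    obtain ⟨a, rfl⟩ := (hrange i).1 (hC hi)
    exact ⟨a, (hC' a).2 hi⟩
  have h1 := hE.causal _ hn (F ∘ e) A' (hne A A' Finset.subset_union_left hA' hA)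
    (hne B A'ᶜ Finset.subset_union_right hB' hB)
    fun a ha b hb => h _ ((hA' a).1 ha) _ ((hB' b).1 hb)
  have h2 := key A A' Finset.subset_union_left hA'
  have h3 := key B A'ᶜ Finset.subset_union_right hB'
  rw [← h2, ← h3]
  exact h1

variable (hP : ContDiffOn ℝ ∞ P {0}ᶜ) (hsymm : ∀ x, P (-x) = P x)

include hsymm in
theorem cutoffKernel_symm (ε : Set.Ioi (0 : ℝ)) (x y : Space d) :
    cutoffKernel hP ε (x, y) = cutoffKernel hP ε (y, x) := by
  simp only [cutoffKernel_apply, cutKernel]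
  rw [← neg_sub y x, norm_neg, hsymm]

include hE hsymm in
-- The intersections used below may be empty; then the factor is `E_0(1) = 1`, the unit of the star
-- product.
theorem partE_union_eventually {k : ℕ} {F : Fin k → LocalSeries d} {A B : Finset (Fin k)}
    (hAB : Disjoint A B) (hn : (A ∪ B).card < n) (h : Separated F A B) (N : ℕ) :
    ∀ᶠ ε : Set.Ioi (0 : ℝ) in atBot, EqTo N (partE E (A ∪ B) F).1
      (star (cutoffKernel hP ε) (partE E A F) (partE E B F)).1 := by
  have hn0 : 0 < n := (Nat.zero_le _).trans_lt hn
  rcases A.eq_empty_or_nonempty with rfl | hA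
  · refine Eventually.of_forall fun ε => ?_
    rw [star_comm (cutoffKernel_symm hP hsymm ε), star_one_right _ _ _ (partE_empty hE hn0 F),
      Finset.empty_union]
    exact EqTo.refl _ _
  rcases B.eq_empty_or_nonempty with rfl | hB
  · refine Eventually.of_forall fun ε => ?_
    rw [star_one_right _ _ _ (partE_empty hE hn0 F), Finset.union_empty]
    exact EqTo.refl _ _
  rw [partE_union hE hAB hA hB hn h]
  exact timeProd_eventually hP (disjoint_partE hE
    ((Finset.card_le_card Finset.subset_union_left).trans_lt hn)
    ((Finset.card_le_card Finset.subset_union_right).trans_lt hn) h) N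

theorem star_mul_mul_comm {K : Kernel d} (hK : ∀ x y, K (x, y) = K (y, x))
    (A B C D : CompactSeries d) :
    star K (star K A B) (star K C D) = star K (star K A C) (star K B D) := by
  rw [star_assoc, star_assoc, ← star_assoc K B C D, star_comm hK B C, star_assoc]

theorem EqTo.star {N : ℕ} {F F' G G' : CompactSeries d} (K : Kernel d) (h : EqTo N F.1 F'.1)
    (h' : EqTo N G.1 G'.1) : EqTo N (star K F G).1 (star K F' G').1 :=
  (h'.map (EuclideanEG.star K F)).trans (h.map ((EuclideanEG.star K).flip G'))

theorem card_lt_of_compl_nonempty {I : Finset (Fin n)} (h : Iᶜ.Nonempty) : I.card < n := by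
  have := Finset.card_compl_add_card I
  have := h.card_pos
  simp only [Fintype.card_fin] at *
  omega

include hE hP hsymm in
-- Both sides are star products of the factors that belong to `I ∩ J`, `I ∩ Jᶜ`, `Iᶜ ∩ J` and `Iᶜ ∩
-- Jᶜ`. They differ by an exchange of the two middle factors.
theorem timeProd_partE_eq {F : Fin n → LocalSeries d} {I J : Finset (Fin n)} (hI : I.Nonempty)
    (hI' : Iᶜ.Nonempty) (hJ : J.Nonempty) (hJ' : Jᶜ.Nonempty) (hsI : Separated F I Iᶜ)
    (hsJ : Separated F J Jᶜ) :
    timeProd P (partE E I F).1 (partE E Iᶜ F).1 = timeProd P (partE E J F).1 (partE E Jᶜ F).1 := by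
  have hcI := card_lt_of_compl_nonempty hI'
  have hcI' := card_lt_of_compl_nonempty (I := Iᶜ) (by rwa [compl_compl])
  have hcJ := card_lt_of_compl_nonempty hJ'
  have hcJ' := card_lt_of_compl_nonempty (I := Jᶜ) (by rwa [compl_compl])
  have e1 : (I ∩ J) ∪ (I ∩ Jᶜ) = I := by rw [← Finset.inter_union_distrib_left]; simp
  have e2 : (Iᶜ ∩ J) ∪ (Iᶜ ∩ Jᶜ) = Iᶜ := by rw [← Finset.inter_union_distrib_left]; simp
  have e3 : (I ∩ J) ∪ (Iᶜ ∩ J) = J := by rw [← Finset.union_inter_distrib_right]; simp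
  have e4 : (I ∩ Jᶜ) ∪ (Iᶜ ∩ Jᶜ) = Jᶜ := by rw [← Finset.union_inter_distrib_right]; simp
  have dI : Disjoint I Iᶜ := disjoint_compl_right
  have dJ : Disjoint J Jᶜ := disjoint_compl_right
  refine PowerSeries.ext fun N => ?_
  have h1 := partE_union_eventually hE hP hsymm (F := F) (A := I ∩ J) (B := I ∩ Jᶜ)
    (dJ.mono Finset.inter_subset_right Finset.inter_subset_right) (by rwa [e1])
    (hsJ.mono Finset.inter_subset_right Finset.inter_subset_right) N
  have h2 := partE_union_eventually hE hP hsymm (F := F) (A := Iᶜ ∩ J) (B := Iᶜ ∩ Jᶜ)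
    (dJ.mono Finset.inter_subset_right Finset.inter_subset_right) (by rwa [e2])
    (hsJ.mono Finset.inter_subset_right Finset.inter_subset_right) N
  have h3 := partE_union_eventually hE hP hsymm (F := F) (A := I ∩ J) (B := Iᶜ ∩ J)
    (dI.mono Finset.inter_subset_left Finset.inter_subset_left) (by rwa [e3])
    (hsI.mono Finset.inter_subset_left Finset.inter_subset_left) N
  have h4 := partE_union_eventually hE hP hsymm (F := F) (A := I ∩ Jᶜ) (B := Iᶜ ∩ Jᶜ)
    (dI.mono Finset.inter_subset_left Finset.inter_subset_left) (by rwa [e4])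
    (hsI.mono Finset.inter_subset_left Finset.inter_subset_left) N
  rw [e1] at h1
  rw [e2] at h2
  rw [e3] at h3
  rw [e4] at h4
  have h5 := timeProd_eventually hP (disjoint_partE hE hcI hcI' hsI) N
  have h6 := timeProd_eventually hP (disjoint_partE hE hcJ hcJ' hsJ) N
  -- One cutoff serves all six products up to order `N`.
  obtain ⟨ε, h1, h2, h3, h4, h5, h6⟩ :=
    (h1.and (h2.and (h3.and (h4.and (h5.and h6))))).exists
  have h7 := h5.trans (h1.star _ h2)
  rw [star_mul_mul_comm (cutoffKernel_symm hP hsymm ε)] at h7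
  exact (h7.trans ((h3.star _ h4).symm.trans h6.symm)) N le_rfl

end Consistency

end EuclideanEG

namespace EuclideanEG
open Filter SmoothFn

variable {d : ℕ}

/-! ### Cutting local functionals into pieces -/

/-- The partial sums of the partition of unity that belongs to a sequence of bump functions. -/
def partialSum (b : ℕ → Config d) : ℕ → Config d
  | 0 => 0
  | i + 1 => partialSum b i + b i * (1 - partialSum b i)

theorem partialSum_succ_of_eq_one {b : ℕ → Config d} {i : ℕ} {x : Space d} (h : b i x = 1) :
    partialSum b (i + 1) x = 1 := by
  simp [partialSum, h]

theorem partialSum_eq_one {b : ℕ → Config d} {i j : ℕ} (hj : j < i) {x : Space d} (h : b j x = 1) :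
    partialSum b i x = 1 := by
  induction i, hj using Nat.le_induction with
  | base => exact partialSum_succ_of_eq_one h
  | succ i _ ih => simp [partialSum, ih]

/-- The functional `φ ↦ F(s φ)`, for local functionals. -/
def pullLoc (s : Config d) : localFunctionals d →ₗ[ℂ] localFunctionals d :=
  (pull s).restrict fun _ hF => IsLocalFunctional.pull hF s

theorem continuous_local (F : localFunctionals d) : Continuous F.1 :=
  (funDeriv_spec F.2.1.1).continuous

/-- The pieces of a local functional that belong to a sequence of bump functions. -/
def piece (b : ℕ → Config d) : ℕ → localFunctionals d →ₗ[ℂ] localFunctionals d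
  -- The constant functional `F(0)`, which has empty support. It shifts the indices: piece `i + 1`
  -- belongs to the bump function `b i`.
  | 0 => pullLoc 0
  | i + 1 => pullLoc (partialSum b (i + 1)) - pullLoc (partialSum b i)

/-- The sets in which the pieces are supported. -/
def patch (b : ℕ → Config d) : ℕ → Set (Space d)
  | 0 => ∅
  | i + 1 => tsupport (b i)

theorem isClosed_patch (b : ℕ → Config d) (i : ℕ) : IsClosed (patch b i) := by
  cases i with
  | zero => exact isClosed_empty
  | succ i => exact isClosed_tsupport _

theorem sum_piece (b : ℕ → Config d) (i : ℕ) :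
    ∑ j ∈ Finset.range (i + 1), piece b j = pullLoc (partialSum b i) := by
  induction i with
  | zero => simp [piece, partialSum]
  | succ i ih =>
    rw [Finset.sum_range_succ, ih]
    exact LinearMap.ext fun F => add_sub_cancel (pullLoc _ F) (pullLoc _ F)

theorem pullLoc_one : pullLoc (1 : Config d) = LinearMap.id :=
  LinearMap.ext fun F => Subtype.ext <| funext fun φ => congrArg F.1 <|
    SmoothFn.ext fun x => one_mul (φ x)

/-- The sum telescopes, and the final function `b r = 1` completes the partial sums to `1`. There
are `r + 2` pieces: the constant one and those of `b 0, …, b r`. -/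
theorem sum_piece_eq_id {b : ℕ → Config d} {r : ℕ} (hb : b r = 1) :
    ∑ j : Fin (r + 2), piece b j = LinearMap.id := by
  rw [Fin.sum_univ_eq_sum_range (piece b), sum_piece, ← pullLoc_one]
  congr 1
  ext x
  exact partialSum_succ_of_eq_one (by rw [hb]; rfl)

theorem piece_coe (b : ℕ → Config d) (i : ℕ) (F : localFunctionals d) :
    (piece b (i + 1) F : Functional d) =
      pull (partialSum b (i + 1)) F.1 - pull (partialSum b i) F.1 := rfl

theorem partialSum_mul (b : ℕ → Config d) (i : ℕ) (φ : Config d) : partialSum b (i + 1) * φ =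
    partialSum b i * φ + b i * ((1 - partialSum b i) * φ) := by
  ext x
  simp only [partialSum, SmoothFn.mul_apply, SmoothFn.add_apply]
  ring

/-- Piece `i + 1` is the change of `F` caused by adding `b i (1 - s) φ` to `s φ`, with `s` the
partial sum. A variation `h` off the support of `b i` leaves the added field unchanged, and by
additivity the increment does not notice the variation `s h` of the base field. -/
theorem funSupport_piece (b : ℕ → Config d) (i : ℕ) (F : localFunctionals d) :
    funSupport (piece b i F).1 ⊆ funSupport F.1 ∩ patch b i := by
  cases i with
  | zero =>
    rintro x hx
    obtain ⟨φ, h, -, hne⟩ := hx Set.univ Filter.univ_mem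
    refine absurd (congrArg F.1 ?_) hne
    ext y
    simp
  | succ i =>
    refine Set.subset_inter ?_ fun x hx => ?_
    · rw [piece_coe, sub_eq_add_neg, ← neg_one_smul ℂ]
      exact (funSupport_add _ _).trans (Set.union_subset (funSupport_pull _ _)
        ((funSupport_smul _ _).trans (funSupport_pull _ _)))
    · by_contra hcon
      obtain ⟨φ, h, hh, hne⟩ := hx _ ((isClosed_tsupport (b i)).isOpen_compl.mem_nhds hcon)
      have hd : Disjoint (tsupport (b i)) (tsupport h) :=
        (Set.subset_compl_iff_disjoint_left.1 hh)
      have hd' : Disjoint (tsupport (b i * ((1 - partialSum b i) * φ) : Config d))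
          (tsupport (partialSum b i * h : Config d)) :=
        hd.mono (tsupport_mul_subset_left (f := b i)) (tsupport_mul_subset_right (g := h))
      have h0 : b i * ((1 - partialSum b i) * h) = 0 := by
        ext y
        by_cases hy : y ∈ tsupport h
        · have : b i y = 0 := image_eq_zero_of_notMem_tsupport fun h' =>
            Set.disjoint_left.1 hd h' hy
          simp [this]
        · simp [image_eq_zero_of_notMem_tsupport hy]
      refine hne ?_
      have := IsLocalFunctional.additive F.2 hd' (partialSum b i * φ)
      simp only [piece_coe, Pi.sub_apply, pull_apply, mul_add_config, partialSum_mul b i φ,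
        partialSum_mul b i h, h0, add_zero]
      exact sub_eq_sub_iff_sub_eq_sub.1 this

theorem piece_eq_zero_of_disjoint {b : ℕ → Config d} {i : ℕ} {F : localFunctionals d}
    (h : Disjoint (tsupport (b i)) (funSupport F.1)) : piece b (i + 1) F = 0 := by
  refine Subtype.ext (funext fun φ => ?_)
  rw [piece_coe, Pi.sub_apply, pull_apply, pull_apply, partialSum_mul,
    apply_add_of_disjoint (continuous_local F) (h.mono_left tsupport_mul_subset_left), sub_self]
  rfl

/-- Once the earlier bump functions cover the support, the partial sums are `1` near it and further
increments do not contribute. -/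
theorem piece_eq_zero_of_eq_one {b : ℕ → Config d} {i : ℕ} {F : localFunctionals d}
    (h : ∀ x ∈ funSupport F.1, ∃ j < i, ∀ᶠ y in 𝓝 x, b j y = 1) : piece b (i + 1) F = 0 := by
  have h1 : ∀ k, i ≤ k → ∀ᶠ y in 𝓝ˢ (funSupport F.1), partialSum b k y = 1 := by
    intro k hk
    rw [Filter.Eventually, mem_nhdsSet_iff_forall]
    intro x hx
    obtain ⟨j, hj, hx⟩ := h x hx
    filter_upwards [hx] with y hy
    exact partialSum_eq_one (hj.trans_le hk) hy
  refine Subtype.ext ?_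
  rw [piece_coe, pull_eq_self (continuous_local F) (h1 _ i.le_succ),
    pull_eq_self (continuous_local F) (h1 i le_rfl), sub_self]
  rfl

/-- Bump functions with supports in balls of radius `ρ`, followed by the constant `1`, such that
near each point of `S` one of the bump functions is equal to `1`. -/
structure IsBumpCover (ρ : ℝ) (S : Set (Space d)) (r : ℕ) (b : ℕ → Config d) : Prop where
  small : ∀ i < r, ∃ c, tsupport (b i) ⊆ Metric.closedBall c ρ
  last : b r = 1
  cover : ∀ x ∈ S, ∃ j < r, ∀ᶠ y in 𝓝 x, b j y = 1

theorem exists_bumpCover {ρ : ℝ} (hρ : 0 < ρ) {S : Set (Space d)} (hS : IsCompact S) :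
    ∃ (r : ℕ) (b : ℕ → Config d), IsBumpCover ρ S r b := by
  obtain ⟨t, -, ht⟩ := hS.elim_nhds_subcover (fun x => Metric.ball x (ρ / 2))
    fun x _ => Metric.ball_mem_nhds x (half_pos hρ)
  -- The default value `1` from index `t.card` on supplies the final function of the cover.
  refine ⟨t.card, fun i => if h : i < t.card then
    bump (t.equivFin.symm ⟨i, h⟩ : Space d) (ρ / 2) ρ (half_pos hρ) (half_lt_self hρ) else 1,
    fun i hi => ⟨t.equivFin.symm ⟨i, hi⟩, ?_⟩, dif_neg (lt_irrefl _), fun x hx => ?_⟩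
  · rw [dif_pos hi, tsupport_bump]
  · obtain ⟨c, hc, hx⟩ := Set.mem_iUnion₂.1 (ht hx)
    refine ⟨t.equivFin ⟨c, hc⟩, (t.equivFin ⟨c, hc⟩).2, ?_⟩
    filter_upwards [Metric.isOpen_ball.mem_nhds hx] with y hy
    rw [dif_pos (t.equivFin ⟨c, hc⟩).2]
    refine bump_eq_one _ _ _ _ _ ?_
    simpa using Metric.ball_subset_closedBall hy

/-! ### Which products of pieces can be split -/

/-- The sets with indices in `I` have a distance of at least `4 ε` from the other ones. -/
def FarSplit {n : ℕ} (B : Fin n → Set (Space d)) (I : Finset (Fin n)) (ε : Set.Ioi (0 : ℝ)) :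
    Prop :=
  I.Nonempty ∧ Iᶜ.Nonempty ∧ ∀ i ∈ I, ∀ j ∈ Iᶜ, FarApart (4 * ε.1) (B i) (B j)

/-- A cluster around `i₀` can be enlarged by one point as long as it is not everything, and each
enlargement costs at most `η`. -/
theorem dist_le_of_chain {X : Type*} [PseudoMetricSpace X] {n : ℕ} (x : Fin n → X) {η : ℝ}
    (hη : 0 ≤ η) (h : ∀ I : Finset (Fin n), I.Nonempty → Iᶜ.Nonempty →
      ∃ i ∈ I, ∃ j ∈ Iᶜ, dist (x i) (x j) ≤ η) (i₀ j : Fin n) : dist (x i₀) (x j) ≤ n * η := by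
  have key : ∀ k < n, ∃ I : Finset (Fin n), I.card = k + 1 ∧ i₀ ∈ I ∧
      ∀ i ∈ I, dist (x i₀) (x i) ≤ k * η := by
    intro k
    induction k with
    | zero => exact fun _ => ⟨{i₀}, by simp⟩
    | succ k ih =>
      intro hk
      obtain ⟨I, hI, h0, hd⟩ := ih (by omega)
      have hc : Iᶜ.Nonempty := by
        rw [← Finset.card_pos, Finset.card_compl, hI, Fintype.card_fin]
        omega
      obtain ⟨i, hi, j, hj, hij⟩ := h I ⟨i₀, h0⟩ hc
      refine ⟨insert j I, by rw [Finset.card_insert_of_notMem (Finset.mem_compl.1 hj), hI],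
        Finset.mem_insert_of_mem h0, fun a ha => ?_⟩
      push_cast
      rcases Finset.mem_insert.1 ha with rfl | ha
      · linarith [dist_triangle (x i₀) (x i) (x a), hd i hi]
      · linarith [hd a ha]
  have hn : 0 < n := i₀.pos
  obtain ⟨I, hI, -, hd⟩ := key (n - 1) (by omega)
  have hI' : I = Finset.univ := by
    rw [← Finset.card_eq_iff_eq_univ, hI, Fintype.card_fin]
    omega
  refine (hd j (hI' ▸ Finset.mem_univ j)).trans ?_
  gcongr
  omega

/-- The complements of the `C i` cover the compact set `C 0`. A ball that meets `C 0` is contained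
in a slightly larger ball around a point of `C 0`, to which the Lebesgue number applies. -/
theorem exists_ball_disjoint {n : ℕ} {C : Fin n → Set (Space d)} (hC : ∀ i, IsCompact (C i))
    (hn : 0 < n) (h : ⋂ i, C i = ∅) :
    ∃ δ > 0, ∀ x, ∃ j, Disjoint (Metric.closedBall x δ) (C j) := by
  obtain ⟨δ, hδ, h1⟩ := lebesgue_number_lemma_of_metric (hC ⟨0, hn⟩) (c := fun i => (C i)ᶜ)
    (fun i => (hC i).isClosed.isOpen_compl) (by rw [← Set.compl_iInter, h, Set.compl_empty]; simp)
  refine ⟨δ / 3, by positivity, fun x => ?_⟩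
  by_cases hx : Disjoint (Metric.closedBall x (δ / 3)) (C ⟨0, hn⟩)
  · exact ⟨_, hx⟩
  · obtain ⟨y, hy, hyC⟩ := Set.not_disjoint_iff.1 hx
    obtain ⟨j, hj⟩ := h1 y hyC
    refine ⟨j, Set.disjoint_left.2 fun z hz => hj ?_⟩
    rw [Metric.mem_closedBall] at hy hz
    rw [Metric.mem_ball]
    linarith [dist_triangle z x y, dist_comm y x]

/-- Patches that cannot be split form a chain of small balls, which lies in a ball so small that it
misses one of the `C j`. -/
theorem exists_piece_eq_zero {n : ℕ} (hn : 2 ≤ n) {C : Fin n → Set (Space d)}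
    (hC : ∀ i, IsCompact (C i)) (h : ⋂ i, C i = ∅) :
    ∃ ρ₀ > 0, ∃ R₀ : ℝ, ∀ ρ ≤ ρ₀, 0 < ρ → ∀ R ≥ R₀, ∀ r b,
      IsBumpCover ρ (Metric.closedBall (0 : Space d) R) r b → ∀ β : Fin n → Fin (r + 2),
      (¬ ∃ I ε, FarSplit (fun i => patch b (β i)) I ε) →
      ∃ j, ∀ F : localFunctionals d, funSupport F.1 ⊆ C j → piece b (β j) F = 0 := by
  obtain ⟨δ, hδ, hball⟩ := exists_ball_disjoint hC (by omega) h
  obtain ⟨R₀, hR₀⟩ := (isCompact_iUnion hC).isBounded.subset_closedBall 0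
  -- The centres of the patches turn out to be within `3 n ρ` of the first one and the patches have
  -- radius `ρ`, so `(3 n + 1) ρ ≤ δ` keeps all of them in the ball of radius `δ`.
  refine ⟨δ / (3 * n + 1), by positivity, R₀, fun ρ hρδ hρ R hR r b hb β hβ => ?_⟩
  rw [le_div_iff₀ (by positivity)] at hρδ
  -- The patch of the constant `1` is the whole space, but its piece vanishes because the other bump
  -- functions already cover all supports.
  by_cases hlast : ∃ j, (β j : ℕ) = r + 1
  · obtain ⟨j, hj⟩ := hlast
    refine ⟨j, fun F hF => ?_⟩
    rw [hj]
    exact piece_eq_zero_of_eq_one fun x hx => hb.cover x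
      (Metric.closedBall_subset_closedBall hR (hR₀ (Set.mem_iUnion.2 ⟨j, hF hx⟩)))
  have hzero : ∀ j, (β j : ℕ) ≠ 0 := by
    intro j hj
    -- The patch with index `0` is empty, so it can be split off with any distance.
    refine hβ ⟨{j}, ⟨1, Set.mem_Ioi.2 one_pos⟩, Finset.singleton_nonempty j, ?_, fun i hi k _ x hx => ?_⟩
    · rw [← Finset.card_pos, Finset.card_compl, Finset.card_singleton, Fintype.card_fin]
      omega
    · have hx' : x ∈ patch b (β i) := hx
      rw [Finset.mem_singleton.1 hi, hj] at hx'
      exact absurd hx' (Set.notMem_empty x)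
  have hlt : ∀ j, (β j : ℕ) - 1 < r := fun j => by
    have h1 := (β j).2
    have h2 := hzero j
    have h3 : (β j : ℕ) ≠ r + 1 := fun h => hlast ⟨j, h⟩
    omega
  have hβj : ∀ j, (β j : ℕ) = (β j - 1) + 1 := fun j => by
    have := hzero j
    omega
  choose x hx using fun j => hb.small _ (hlt j)
  have hpatch : ∀ j, patch b (β j) ⊆ Metric.closedBall (x j) ρ := fun j => by
    rw [hβj j]
    exact hx j
  have hchain := dist_le_of_chain x (η := 3 * ρ) (by positivity) fun I hI hI' => by
    by_contra hcon
    push Not at hcon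
    -- Centres more than `3 ρ` apart leave a distance of at least `ρ = 4 (ρ / 4)` between the balls.
    refine hβ ⟨I, ⟨ρ / 4, by simpa using hρ⟩, hI, hI', fun i hi j hj y hy z hz => ?_⟩
    have h1 := Metric.mem_closedBall.1 (hpatch i hy)
    have h2 := Metric.mem_closedBall.1 (hpatch j hz)
    have h3 := dist_triangle4 (x i) y z (x j)
    have h4 := hcon i hi j hj
    have h5 := dist_comm (x i) y
    change 4 * (ρ / 4) ≤ _
    linarith
  obtain ⟨j, hj⟩ := hball (x ⟨0, by omega⟩)
  refine ⟨j, fun F hF => ?_⟩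
  rw [hβj j]
  refine piece_eq_zero_of_disjoint (Set.disjoint_of_subset (fun y hy => ?_) hF hj)
  have h1 := Metric.mem_closedBall.1 (hx j hy)
  have h2 := hchain ⟨0, by omega⟩ j
  rw [Metric.mem_closedBall]
  have h3 := dist_triangle y (x j) (x ⟨0, by omega⟩)
  rw [dist_comm (x j)] at h3
  linarith

end EuclideanEG

namespace EuclideanEG
open Filter SmoothFn

variable {d : ℕ}

/-! ### The approximations of the time-ordered product off the diagonal -/

theorem seriesSupport_seriesMap_piece (b : ℕ → Config d) (i : ℕ) (F : LocalSeries d) :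
    seriesSupport (seriesMap (piece b i) F).1 ⊆ seriesSupport F.1 ∩ patch b i := by
  refine seriesSupport_subset ((isClosed_seriesSupport _).inter (isClosed_patch b i)) fun j => ?_
  rw [← cf_coe, cf_seriesMap]
  exact (funSupport_piece b i (cf F j)).trans
    (Set.inter_subset_inter_left _ (funSupport_subset_seriesSupport j F.1))

theorem sum_seriesMap_piece {b : ℕ → Config d} {r : ℕ} (hb : b r = 1) (F : LocalSeries d) :
    ∑ j : Fin (r + 2), seriesMap (piece b j) F = F := by
  refine series_ext fun k => ?_
  have h1 := LinearMap.congr_fun (sum_piece_eq_id hb) (cf F k)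
  rw [LinearMap.sum_apply] at h1
  refine Eq.trans (Subtype.ext ?_) h1
  rw [cf_coe, Submodule.coe_sum, map_sum, Submodule.coe_sum]
  exact Finset.sum_congr rfl fun j _ => congrArg Subtype.val (cf_seriesMap (piece b j) F k)

/-- The pieces of a family of local functionals. -/
def pieces {n r : ℕ} (b : ℕ → Config d) (β : Fin n → Fin (r + 2)) (F : Fin n → LocalSeries d) :
    Fin n → LocalSeries d :=
  fun i => seriesMap (piece b (β i)) (F i)

theorem seriesSupport_pieces {n r : ℕ} (b : ℕ → Config d) (β : Fin n → Fin (r + 2))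
    (F : Fin n → LocalSeries d) (i : Fin n) :
    seriesSupport (pieces b β F i).1 ⊆ seriesSupport (F i).1 :=
  (seriesSupport_seriesMap_piece _ _ _).trans Set.inter_subset_left

theorem seriesSupport_pieces_patch {n r : ℕ} (b : ℕ → Config d) (β : Fin n → Fin (r + 2))
    (F : Fin n → LocalSeries d) (i : Fin n) :
    seriesSupport (pieces b β F i).1 ⊆ patch b (β i) :=
  (seriesSupport_seriesMap_piece _ _ _).trans Set.inter_subset_right

theorem suppTo_pieces {n r : ℕ} (b : ℕ → Config d) (β : Fin n → Fin (r + 2))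
    (F : Fin n → LocalSeries d) (N : ℕ) (i : Fin n) :
    suppTo N (pieces b β F i).1 ⊆ suppTo N (F i).1 := by
  refine Set.iUnion₂_mono fun j _ => ?_
  rw [pieces, ← cf_coe, cf_seriesMap]
  exact (funSupport_piece b (β i) (cf (F i) j)).trans Set.inter_subset_left

theorem eqTo_seriesMap_piece_zero {b : ℕ → Config d} {i N : ℕ} {C : Set (Space d)}
    (h : ∀ F : localFunctionals d, funSupport F.1 ⊆ C → piece b i F = 0) {F : LocalSeries d}
    (hF : suppTo N F.1 ⊆ C) : EqTo N (seriesMap (piece b i) F).1 0 := fun j hj => by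
  rw [← cf_coe, cf_seriesMap, h _ ((funSupport_subset_suppTo hj F.1).trans hF), map_zero]
  rfl

theorem map_eq_sum_pieces {n r : ℕ} {A : Type*} [AddCommMonoid A] [Module ℂ⟦X⟧ A]
    (T : MultilinearMap ℂ⟦X⟧ (fun _ : Fin n => LocalSeries d) A) {b : ℕ → Config d} (hb : b r = 1)
    (F : Fin n → LocalSeries d) : T F = ∑ β : Fin n → Fin (r + 2), T (pieces b β F) := by
  have h := T.map_sum fun (i : Fin n) (j : Fin (r + 2)) => seriesMap (piece b j) (F i)
  simp only [sum_seriesMap_piece hb] at h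
  exact h

/-- With the other arguments fixed, the map is linear over power series, hence preserves vanishing
up to order `N`. -/
theorem MultilinearMap.eqTo_zero {n N : ℕ}
    (T : MultilinearMap ℂ⟦X⟧ (fun _ : Fin n => LocalSeries d) (CompactSeries d))
    {F : Fin n → LocalSeries d} {j : Fin n} (h : EqTo N (F j).1 0) : EqTo N (T F).1 0 := by
  have := h.map_zero (T.toLinearMap F j)
  rwa [MultilinearMap.toLinearMap_apply, Function.update_eq_self] at this

section PartMultilinear

variable {k : ℕ} (E : (j : ℕ) → OrderMap d j) [DecidableEq (Fin k)] {I : Finset (Fin k)}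
  {i : Fin k}

theorem partE_update_of_notMem (hi : i ∉ I) (F : Fin k → LocalSeries d) (G : LocalSeries d) :
    partE E I (Function.update F i G) = partE E I F := by
  unfold partE subTensor
  congr 2
  funext a
  refine Function.update_of_ne ?_ _ _
  rintro rfl
  exact hi (Finset.orderEmbOfFin_mem I rfl a)

theorem exists_partE_update (hi : i ∈ I) (F : Fin k → LocalSeries d) :
    ∃ T : LocalSeries d →ₗ[ℂ⟦X⟧] CompactSeries d,
      ∀ G, partE E I (Function.update F i G) = T G := by
  rw [← Finset.mem_coe, ← Finset.range_orderEmbOfFin I rfl] at hi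
  obtain ⟨a, rfl⟩ := hi
  refine ⟨((E I.card).compMultilinearMap (PiTensorProduct.tprod ℂ⟦X⟧)).toLinearMap
    (F ∘ I.orderEmbOfFin rfl) a, fun G => ?_⟩
  exact congrArg (fun H => E I.card (tensor H))
    (Function.update_comp_eq_of_injective F (I.orderEmbOfFin rfl).injective a G)

end PartMultilinear

/-- The map `F ↦ E_{|I|}(⨂_{i ∈ I} F_i) ⋆ E_{|Iᶜ|}(⨂_{j ∈ Iᶜ} F_j)`. -/
def starMulti {n : ℕ} (E : (j : ℕ) → OrderMap d j) (K : Kernel d) (I : Finset (Fin n)) :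
    MultilinearMap ℂ⟦X⟧ (fun _ : Fin n => LocalSeries d) (CompactSeries d) where
  toFun F := star K (partE E I F) (partE E Iᶜ F)
  map_update_add' := by
    intro inst F i G G'
    obtain rfl : inst = instDecidableEqFin n := Subsingleton.elim _ _
    by_cases hi : i ∈ I
    · have hi' : i ∉ Iᶜ := fun h => Finset.mem_compl.1 h hi
      obtain ⟨T, hT⟩ := exists_partE_update E hi F
      simp only [hT, partE_update_of_notMem E hi', map_add, LinearMap.add_apply]
    · obtain ⟨T, hT⟩ := exists_partE_update E (Finset.mem_compl.2 hi) F
      simp only [hT, partE_update_of_notMem E hi, map_add]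
  map_update_smul' := by
    intro inst F i c G
    obtain rfl : inst = instDecidableEqFin n := Subsingleton.elim _ _
    by_cases hi : i ∈ I
    · have hi' : i ∉ Iᶜ := fun h => Finset.mem_compl.1 h hi
      obtain ⟨T, hT⟩ := exists_partE_update E hi F
      simp only [hT, partE_update_of_notMem E hi', map_smul, LinearMap.smul_apply]
    · obtain ⟨T, hT⟩ := exists_partE_update E (Finset.mem_compl.2 hi) F
      simp only [hT, partE_update_of_notMem E hi, map_smul]

theorem starMulti_apply {n : ℕ} (E : (j : ℕ) → OrderMap d j) (K : Kernel d) (I : Finset (Fin n))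
    (F : Fin n → LocalSeries d) : starMulti E K I F = star K (partE E I F) (partE E Iᶜ F) := rfl

open Classical in
/-- The sum of all products of pieces that can be split. -/
def theta {P : Space d → ℝ} (hP : ContDiffOn ℝ ∞ P {0}ᶜ) (n : ℕ) (E : (j : ℕ) → OrderMap d j)
    (r : ℕ) (b : ℕ → Config d) : OrderMap d n :=
  -- The splitting and the cutoff are chosen from the patches alone, so each summand is linear.
  -- Products that cannot be split get the value `0`, which is correct for adapted partitions.
  ∑ β : Fin n → Fin (r + 2), if h : ∃ I ε, FarSplit (fun i => patch b (β i)) I ε then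
    PiTensorProduct.lift ((starMulti E (cutoffKernel hP h.choose_spec.choose) h.choose).compLinearMap
      fun i => seriesMap (piece b (β i))) else 0

/-- Every product of pieces that cannot be split has a factor that vanishes on the functionals
with supports in the given sets. -/
structure IsAdapted {n : ℕ} (C : Fin n → Set (Space d)) (r : ℕ) (b : ℕ → Config d) : Prop where
  last : b r = 1
  zero : ∀ β : Fin n → Fin (r + 2), (¬ ∃ I ε, FarSplit (fun i => patch b (β i)) I ε) →
    ∃ j, ∀ F : localFunctionals d, funSupport F.1 ⊆ C j → piece b (β j) F = 0

section Theta

variable {P : Space d → ℝ} {n : ℕ} {E : (k : ℕ) → OrderMap d k} (hE : InductionHypothesis P n E)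
  (hP : ContDiffOn ℝ ∞ P {0}ᶜ) (hsymm : ∀ x, P (-x) = P x)

include hE in
-- The comparison is made piece by piece. A product that can be split is fixed by causality, and its
-- patches are far enough apart for the chosen cutoff; a product that cannot be split has a factor
-- that vanishes up to order `N`. The family `v` covers multilinear maps on all tensors as well as
-- maps defined only off the diagonal.
theorem eqTo_theta {r N : ℕ} {b : ℕ → Config d} {C : Fin n → Set (Space d)}
    (hb : IsAdapted C r b) {F : Fin n → LocalSeries d} (hF : ∀ i, suppTo N (F i).1 ⊆ C i)
    {v : (Fin n → Fin (r + 2)) → CompactSeries d}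
    (hv : ∀ β I, I.Nonempty → Iᶜ.Nonempty → Separated (pieces b β F) I Iᶜ → EqTo N (v β).1
      (timeProd P (partE E I (pieces b β F)).1 (partE E Iᶜ (pieces b β F)).1))
    (hv0 : ∀ β j, EqTo N (pieces b β F j).1 0 → EqTo N (v β).1 0) :
    EqTo N (∑ β, v β : CompactSeries d).1 (theta hP n E r b (tensor F)).1 := by
  rw [theta, LinearMap.sum_apply, Submodule.coe_sum, Submodule.coe_sum]
  refine EqTo.sum _ fun β _ => ?_
  split_ifs with h
  · rw [PiTensorProduct.lift.tprod, MultilinearMap.compLinearMap_apply, starMulti_apply]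
    obtain ⟨hI, hI', hfar⟩ := h.choose_spec.choose_spec
    set I := h.choose
    set ε := h.choose_spec.choose
    have hsep : Separated (pieces b β F) I Iᶜ := fun i hi j hj => by
      refine Set.disjoint_of_subset (seriesSupport_pieces_patch b β F i)
        (seriesSupport_pieces_patch b β F j) (Set.disjoint_left.2 fun x hx hx' => ?_)
      have h1 := hfar i hi j hj x hx x hx'
      rw [dist_self] at h1
      have h2 : 0 < ε.1 := ε.2
      linarith
    refine (hv β I hI hI' hsep).trans (timeProd_eqTo_star hP fun x hx y hy => ?_)
    have hx' := seriesSupport_partE hE _ I (card_lt_of_compl_nonempty hI')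
      (suppTo_subset_seriesSupport _ _ hx)
    have hy' := seriesSupport_partE hE _ Iᶜ
      (card_lt_of_compl_nonempty (by rwa [compl_compl])) (suppTo_subset_seriesSupport _ _ hy)
    obtain ⟨i, hi, hx'⟩ := Set.mem_iUnion₂.1 hx'
    obtain ⟨j, hj, hy'⟩ := Set.mem_iUnion₂.1 hy'
    exact hfar i hi j hj x (seriesSupport_pieces_patch b β F i hx') y
      (seriesSupport_pieces_patch b β F j hy')
  · obtain ⟨j, hj⟩ := hb.zero β h
    exact hv0 β j (eqTo_seriesMap_piece_zero hj (hF j))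

include hE in
theorem multilinear_eqTo_theta {r N : ℕ} {b : ℕ → Config d} {C : Fin n → Set (Space d)}
    (hb : IsAdapted C r b) {F : Fin n → LocalSeries d} (hF : ∀ i, suppTo N (F i).1 ⊆ C i)
    (T : MultilinearMap ℂ⟦X⟧ (fun _ : Fin n => LocalSeries d) (CompactSeries d))
    (hT : ∀ (β : Fin n → Fin (r + 2)) (I : Finset (Fin n)), I.Nonempty → Iᶜ.Nonempty →
      Separated (pieces b β F) I Iᶜ → EqTo N (T (pieces b β F)).1
        (timeProd P (partE E I (pieces b β F)).1 (partE E Iᶜ (pieces b β F)).1)) :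
    EqTo N (T F).1 (theta hP n E r b (tensor F)).1 := by
  rw [map_eq_sum_pieces T hb.last F]
  exact eqTo_theta hE hP hb hF hT fun β j hj => MultilinearMap.eqTo_zero T hj

include hE hsymm in
-- For a small cutoff the right-hand side is the multilinear map `starMulti` of the splitting `I`.
-- On pieces it agrees with the factorization along any other splitting, by consistency, so the
-- comparison with `theta` applies.
theorem theta_eqTo_timeProd {r N : ℕ} {b : ℕ → Config d} {C : Fin n → Set (Space d)}
    (hb : IsAdapted C r b) {F : Fin n → LocalSeries d} (hF : ∀ i, suppTo N (F i).1 ⊆ C i)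
    {I : Finset (Fin n)} (hI : I.Nonempty) (hI' : Iᶜ.Nonempty) (hsep : Separated F I Iᶜ) :
    EqTo N (theta hP n E r b (tensor F)).1 (timeProd P (partE E I F).1 (partE E Iᶜ F).1) := by
  have hc := card_lt_of_compl_nonempty hI'
  have hc' := card_lt_of_compl_nonempty (I := Iᶜ) (by rwa [compl_compl])
  have hsep' : ∀ β : Fin n → Fin (r + 2), Separated (pieces b β F) I Iᶜ := fun β i hi j hj =>
    (hsep i hi j hj).mono (seriesSupport_pieces b β F i) (seriesSupport_pieces b β F j)
  have h0 := timeProd_eventually hP (disjoint_partE hE hc hc' hsep) N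
  have h1 := eventually_all.2 fun β : Fin n → Fin (r + 2) =>
    timeProd_eventually hP (disjoint_partE hE hc hc' (hsep' β)) N
  obtain ⟨ε, h0, h1⟩ := (h0.and h1).exists
  refine (h0.trans (multilinear_eqTo_theta hE hP hb hF (starMulti E (cutoffKernel hP ε) I)
    fun β J hJ hJ' hsepJ => ?_)).symm
  rw [timeProd_partE_eq hE hP hsymm hJ hJ' hI hI' hsepJ (hsep' β)]
  exact (h1 β).symm

include hE hsymm in
-- The first `theta` is itself multilinear and causal on the pieces of the second partition, so it
-- is one of the maps that the second `theta` reproduces.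
theorem theta_eqTo_theta {r r' N : ℕ} {b b' : ℕ → Config d} {C : Fin n → Set (Space d)}
    (hb : IsAdapted C r b) (hb' : IsAdapted C r' b') {F : Fin n → LocalSeries d}
    (hF : ∀ i, suppTo N (F i).1 ⊆ C i) :
    EqTo N (theta hP n E r b (tensor F)).1 (theta hP n E r' b' (tensor F)).1 :=
  multilinear_eqTo_theta hE hP hb' hF ((theta hP n E r b).compMultilinearMap
    (PiTensorProduct.tprod ℂ⟦X⟧)) fun β _ hI hI' hsep =>
      theta_eqTo_timeProd hE hP hsymm hb (fun i => (suppTo_pieces b' β F N i).trans (hF i))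
        hI hI' hsep

include hE in
theorem seriesSupport_theta (r : ℕ) (b : ℕ → Config d) (F : Fin n → LocalSeries d) :
    seriesSupport (theta hP n E r b (tensor F)).1 ⊆ ⋃ i, seriesSupport (F i).1 := by
  have hcl : IsClosed (⋃ i, seriesSupport (F i).1) :=
    isClosed_iUnion_of_finite fun i => isClosed_seriesSupport _
  refine seriesSupport_subset hcl fun j => ?_
  rw [theta, LinearMap.sum_apply, Submodule.coe_sum, map_sum]
  refine funSupport_sum _ _ fun β _ => ?_
  split_ifs with h
  · rw [PiTensorProduct.lift.tprod, MultilinearMap.compLinearMap_apply, starMulti_apply]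
    obtain ⟨hI, hI', -⟩ := h.choose_spec.choose_spec
    refine (funSupport_subset_seriesSupport j _).trans ((seriesSupport_star _ _ _).trans
      (Set.union_subset ?_ ?_))
    · refine (seriesSupport_partE hE _ _ (card_lt_of_compl_nonempty hI')).trans
        (Set.iUnion₂_subset fun i _ => (seriesSupport_pieces b β F i).trans ?_)
      exact Set.subset_iUnion (fun i => seriesSupport (F i).1) i
    · refine (seriesSupport_partE hE _ _ (card_lt_of_compl_nonempty (by rwa [compl_compl]))).trans
        (Set.iUnion₂_subset fun i _ => (seriesSupport_pieces b β F i).trans ?_)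
      exact Set.subset_iUnion (fun i => seriesSupport (F i).1) i
  · rw [LinearMap.zero_apply, Submodule.coe_zero, map_zero, funSupport_zero]
    exact Set.empty_subset _

end Theta

end EuclideanEG

namespace EuclideanEG
open Filter SmoothFn

variable {d : ℕ}

/-! ### The time-ordered product off the diagonal -/

/-- Patches of radius `1 / (m + 1)` and covers of balls of radius `m` eventually meet every
requirement. A sequence that does not depend on the tensor is needed for the limit to be linear. -/
theorem exists_adapted_sequence {n : ℕ} (hn : 2 ≤ n) : ∃ (r : ℕ → ℕ) (b : ℕ → ℕ → Config d),
    ∀ C : Fin n → Set (Space d), (∀ i, IsCompact (C i)) → ⋂ i, C i = ∅ →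
      ∀ᶠ m in atTop, IsAdapted C (r m) (b m) := by
  choose r b hb using fun m : ℕ => exists_bumpCover (ρ := ((m : ℝ) + 1)⁻¹) (by positivity)
    (isCompact_closedBall (0 : Space d) (m : ℝ))
  refine ⟨r, b, fun C hC h => ?_⟩
  obtain ⟨ρ₀, hρ₀, R₀, h1⟩ := exists_piece_eq_zero hn hC h
  have h2 : Tendsto (fun m : ℕ => ((m : ℝ) + 1)⁻¹) atTop (𝓝 0) := by
    simpa using tendsto_one_div_add_atTop_nhds_zero_nat (𝕜 := ℝ)
  filter_upwards [h2.eventually_le_const hρ₀, tendsto_natCast_atTop_atTop.eventually_ge_atTop R₀]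
    with m hm hm'
  exact ⟨(hb m).last, h1 _ hm (by positivity) _ hm' _ _ (hb m)⟩

/-- Being eventually constant in each order is stable under sums and multiplication with power
series, so it extends from `s` to its span; limits are unique, hence linear. -/
theorem exists_limit_map {M : Type*} [AddCommMonoid M] [Module ℂ⟦X⟧ M]
    (Θ : ℕ → M →ₗ[ℂ⟦X⟧] CompactSeries d) (s : Set M)
    (h : ∀ t ∈ s, ∀ N, ∃ v : CompactSeries d, ∀ᶠ m in atTop, EqTo N (Θ m t).1 v.1) :
    ∃ T : Submodule.span ℂ⟦X⟧ s →ₗ[ℂ⟦X⟧] CompactSeries d,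
      ∀ t N, ∀ᶠ m in atTop, EqTo N (Θ m t.1).1 (T t).1 := by
  have h1 : ∀ t ∈ s, ∃ v : CompactSeries d, ∀ N, ∀ᶠ m in atTop, EqTo N (Θ m t).1 v.1 := by
    intro t ht
    choose v hv using h t ht
    -- The stable value may depend on the order, so coefficient `j` is taken from the one for order
    -- `j`.
    refine ⟨ofCoeffs fun j => cf (v j) j, fun N => ?_⟩
    have := (eventually_all_finset (Finset.range (N + 1))).2 fun j _ => hv j
    filter_upwards [this] with m hm j hj
    rw [hm j (Finset.mem_range.2 (Nat.lt_succ_of_le hj)) j le_rfl, ← cf_coe, ← cf_coe, cf_ofCoeffs]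
  have h2 : ∀ t : Submodule.span ℂ⟦X⟧ s, ∃ v : CompactSeries d, ∀ N,
      ∀ᶠ m in atTop, EqTo N (Θ m t.1).1 v.1 := by
    rintro ⟨t, ht⟩
    induction ht using Submodule.span_induction with
    | mem t ht => exact h1 t ht
    | zero => exact ⟨0, fun N => Eventually.of_forall fun m => by rw [map_zero]; exact EqTo.refl _ _⟩
    | add t t' _ _ ih ih' =>
      obtain ⟨v, hv⟩ := ih
      obtain ⟨v', hv'⟩ := ih'
      refine ⟨v + v', fun N => ?_⟩
      filter_upwards [hv N, hv' N] with m hm hm'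
      rw [map_add]
      exact hm.add hm'
    | smul a t _ ih =>
      obtain ⟨v, hv⟩ := ih
      refine ⟨a • v, fun N => ?_⟩
      filter_upwards [hv N] with m hm
      rw [map_smul]
      exact hm.map (LinearMap.lsmul ℂ⟦X⟧ (CompactSeries d) a)
  choose T hT using h2
  have huniq : ∀ (t : Submodule.span ℂ⟦X⟧ s) (v : CompactSeries d),
      (∀ N, ∀ᶠ m in atTop, EqTo N (Θ m t.1).1 v.1) → T t = v := fun t v hv =>
    eq_of_eqTo fun N => by
      obtain ⟨m, hm, hm'⟩ := ((hT t N).and (hv N)).exists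
      exact hm.symm.trans hm'
  refine ⟨{ toFun := T, map_add' := fun t t' => huniq _ _ fun N => ?_,
            map_smul' := fun a t => huniq _ _ fun N => ?_ }, hT⟩
  · filter_upwards [hT t N, hT t' N] with m hm hm'
    rw [Submodule.coe_add, map_add]
    exact hm.add hm'
  · filter_upwards [hT t N] with m hm
    rw [Submodule.coe_smul, map_smul]
    exact hm.map (LinearMap.lsmul ℂ⟦X⟧ (CompactSeries d) a)

theorem OffDiagonal.mono {n : ℕ} {F G : Fin n → LocalSeries d} (hF : OffDiagonal F)
    (h : ∀ i, seriesSupport (G i).1 ⊆ seriesSupport (F i).1) : OffDiagonal G :=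
  Set.disjoint_of_subset_left (Set.pi_mono fun i _ => h i) hF

theorem OffDiagonal.false {n : ℕ} {F : Fin n → LocalSeries d} (hF : OffDiagonal F)
    {x : Fin n → Space d} (h : ∀ i, x i ∈ seriesSupport (F i).1) (h' : x ∈ thinDiag d n) : False := by
  rw [OffDiagonal, Set.disjoint_left] at hF
  exact hF (fun i _ => h i) h'

theorem OffDiagonal.iInter_suppTo {n : ℕ} {F : Fin n → LocalSeries d} (hF : OffDiagonal F)
    (N : ℕ) : ⋂ i, suppTo N (F i).1 = ∅ := by
  refine Set.eq_empty_of_forall_notMem fun x hx => ?_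
  exact hF.false (x := fun _ => x) (fun i => suppTo_subset_seriesSupport N _ (Set.mem_iInter.1 hx i))
    fun _ _ => rfl

theorem localFunctionals_le : localFunctionals d ≤ compactFunctionals d := fun _ hF => hF.1

theorem OffDiagonal.eventually_isAdapted {n : ℕ} {F : Fin n → LocalSeries d} (hF : OffDiagonal F)
    {r : ℕ → ℕ} {b : ℕ → ℕ → Config d} (hb : ∀ C : Fin n → Set (Space d), (∀ i, IsCompact (C i)) →
      ⋂ i, C i = ∅ → ∀ᶠ m in atTop, IsAdapted C (r m) (b m)) (N : ℕ) :
    ∀ᶠ m in atTop, IsAdapted (fun i => suppTo N (F i).1) (r m) (b m) :=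
  hb _ (fun i => isCompact_suppTo localFunctionals_le N (F i)) (hF.iInter_suppTo N)

theorem seriesSupport_shift {S : Submodule ℂ (Functional d)} (N : ℕ) (F : seriesIn S) :
    seriesSupport (shift N F).1 ⊆ seriesSupport F.1 := by
  refine seriesSupport_subset isClosed_closure fun j => ?_
  rw [← cf_coe, cf_shift]
  exact funSupport_subset_seriesSupport _ _

/-- Here the map is defined only off the diagonal. Removing the vanishing coefficients of a factor
does not enlarge its support, so the power of `ħ` can be taken out within the space of these
tensors. -/
theorem offTensor_eqTo_zero {n N : ℕ} (T : offDiagTensors d n →ₗ[ℂ⟦X⟧] CompactSeries d)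
    {F : Fin n → LocalSeries d} (hF : OffDiagonal F) {j : Fin n} (h : EqTo N (F j).1 0) :
    EqTo N (T (offTensor F hF)).1 0 := by
  have hG : OffDiagonal (Function.update F j (shift (N + 1) (F j))) := hF.mono fun i => by
    rcases eq_or_ne i j with rfl | hij
    · rw [Function.update_self]
      exact seriesSupport_shift _ _
    · rw [Function.update_of_ne hij]
  have h1 : offTensor F hF = (PowerSeries.X ^ (N + 1) : ℂ⟦X⟧) • offTensor _ hG := by
    refine Subtype.ext ?_
    change tensor F = (PowerSeries.X ^ (N + 1) : ℂ⟦X⟧) • tensor _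
    rw [← MultilinearMap.map_update_smul, ← eq_X_pow_smul_shift h, Function.update_eq_self]
  rw [h1, map_smul]
  exact eqTo_X_pow_smul N _

section Main

variable {P : Space d → ℝ} {n : ℕ} {E : (k : ℕ) → OrderMap d k} (hE : InductionHypothesis P n E)
  (hP : ContDiffOn ℝ ∞ P {0}ᶜ) (hsymm : ∀ x, P (-x) = P x)

include hE in
-- Cutting only shrinks supports, so all products of pieces stay off the diagonal and causality of
-- `T` applies to each of them.
theorem causal_eqTo_theta (T : offDiagTensors d n →ₗ[ℂ⟦X⟧] CompactSeries d)
    (hT : ∀ F (hF : OffDiagonal F), Factorizes P E F (T (offTensor F hF)))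
    {F : Fin n → LocalSeries d} (hF : OffDiagonal F) {r N : ℕ} {b : ℕ → Config d}
    (hb : IsAdapted (fun i => suppTo N (F i).1) r b) :
    EqTo N (T (offTensor F hF)).1 (theta hP n E r b (tensor F)).1 := by
  have hβ : ∀ β : Fin n → Fin (r + 2), OffDiagonal (pieces b β F) := fun β =>
    hF.mono (seriesSupport_pieces b β F)
  have h1 : offTensor F hF = ∑ β : Fin n → Fin (r + 2), offTensor _ (hβ β) := by
    refine Subtype.ext ?_
    rw [Submodule.coe_sum]
    exact map_eq_sum_pieces (PiTensorProduct.tprod ℂ⟦X⟧) hb.last F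
  rw [h1, map_sum]
  refine eqTo_theta hE hP hb (fun i => subset_rfl) (fun β I hI hI' hsep => ?_)
    fun β j hj => offTensor_eqTo_zero T (hβ β) hj
  rw [hT _ (hβ β) I hI hI' hsep]
  exact EqTo.refl _ _

include hE hP in
theorem causal_unique (hn : 2 ≤ n) {T T' : offDiagTensors d n →ₗ[ℂ⟦X⟧] CompactSeries d}
    (hT : ∀ F (hF : OffDiagonal F), Factorizes P E F (T (offTensor F hF)))
    (hT' : ∀ F (hF : OffDiagonal F), Factorizes P E F (T' (offTensor F hF))) : T = T' := by
  obtain ⟨r, b, hb⟩ := exists_adapted_sequence (d := d) hn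
  have h1 : ∀ F (hF : OffDiagonal F), T (offTensor F hF) = T' (offTensor F hF) := fun F hF =>
    eq_of_eqTo fun N => by
      obtain ⟨m, hm⟩ := (hF.eventually_isAdapted hb N).exists
      exact (causal_eqTo_theta hE hP T hT hF hm).trans (causal_eqTo_theta hE hP T' hT' hF hm).symm
  refine LinearMap.ext fun ⟨t, ht⟩ => ?_
  induction ht using Submodule.span_induction with
  | mem t ht =>
    obtain ⟨F, hF, rfl⟩ := ht
    exact h1 F hF
  | zero => exact (map_zero T).trans (map_zero T').symm
  | add t t' ht ht' ih ih' =>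
    exact (map_add T ⟨t, ht⟩ ⟨t', ht'⟩).trans
      ((congrArg₂ (· + ·) ih ih').trans (map_add T' ⟨t, ht⟩ ⟨t', ht'⟩).symm)
  | smul a t ht ih =>
    exact (map_smul T a ⟨t, ht⟩).trans ((congrArg (a • ·) ih).trans (map_smul T' a ⟨t, ht⟩).symm)

include hE hP hsymm in
-- On each generator the `theta` of the fixed sequence are eventually equal to any given order.
-- Causality and the support property concern one coefficient at a time, so they pass from a single
-- late `theta` to the limit.
theorem exists_causal (hn : 2 ≤ n) : ∃ T : offDiagTensors d n →ₗ[ℂ⟦X⟧] CompactSeries d,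
    (∀ F (hF : OffDiagonal F), Factorizes P E F (T (offTensor F hF))) ∧
    ∀ F (hF : OffDiagonal F),
      seriesSupport (T (offTensor F hF)).1 ⊆ ⋃ i, seriesSupport (F i).1 := by
  obtain ⟨r, b, hb⟩ := exists_adapted_sequence (d := d) hn
  obtain ⟨T, hT⟩ : ∃ T : offDiagTensors d n →ₗ[ℂ⟦X⟧] CompactSeries d,
      ∀ (t : offDiagTensors d n) (N : ℕ), ∀ᶠ m in atTop,
        EqTo N (theta hP n E (r m) (b m) t.1).1 (T t).1 :=
    exists_limit_map (M := LocalTensor d n) (fun m => theta hP n E (r m) (b m))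
    {t | ∃ F : Fin n → LocalSeries d, OffDiagonal F ∧ tensor F = t} (by
      rintro _ ⟨F, hF, rfl⟩ N
      have h1 := hF.eventually_isAdapted hb N
      obtain ⟨m, hm⟩ := h1.exists
      refine ⟨theta hP n E (r m) (b m) (tensor F), ?_⟩
      filter_upwards [h1] with m' hm'
      exact theta_eqTo_theta hE hP hsymm hm' hm fun i => subset_rfl)
  refine ⟨T, fun F hF I hI hI' hsep => PowerSeries.ext fun N => ?_, fun F hF => ?_⟩
  · obtain ⟨m, hm, hm'⟩ := ((hT (offTensor F hF) N).and (hF.eventually_isAdapted hb N)).exists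
    exact (hm.symm.trans (theta_eqTo_timeProd hE hP hsymm hm' (fun i => subset_rfl) hI hI' hsep))
      N le_rfl
  · refine seriesSupport_subset (isClosed_iUnion_of_finite fun i => isClosed_seriesSupport _)
      fun N => ?_
    obtain ⟨m, hm⟩ := (hT (offTensor F hF) N).exists
    rw [← hm N le_rfl]
    exact (funSupport_subset_seriesSupport N _).trans (seriesSupport_theta hE hP (r m) (b m) F)

theorem OffDiagonal.perm {F : Fin n → LocalSeries d} (hF : OffDiagonal F)
    (π : Equiv.Perm (Fin n)) : OffDiagonal (F ∘ π) := by
  refine Set.disjoint_left.2 fun x hx hx' => ?_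
  refine hF.false (x := x ∘ π.symm) (fun i => ?_) fun i j => hx' _ _
  simpa using hx (π.symm i) (Set.mem_univ _)

theorem reindex_tensor (π : Equiv.Perm (Fin n)) (F : Fin n → LocalSeries d) :
    PiTensorProduct.reindex ℂ⟦X⟧ (fun _ : Fin n => LocalSeries d) π.symm (tensor F) =
      tensor (F ∘ π) :=
  PiTensorProduct.reindex_tprod (R := ℂ⟦X⟧) (s := fun _ : Fin n => LocalSeries d) π.symm F

/-- Permuting the factors of the tensors. -/
def permTensor (π : Equiv.Perm (Fin n)) : offDiagTensors d n →ₗ[ℂ⟦X⟧] offDiagTensors d n :=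
  (PiTensorProduct.reindex ℂ⟦X⟧ (fun _ : Fin n => LocalSeries d) π.symm).toLinearMap.restrict (by
    intro t ht
    induction ht using Submodule.span_induction with
    | mem t ht =>
      obtain ⟨F, hF, rfl⟩ := ht
      exact Submodule.subset_span ⟨F ∘ π, hF.perm π, (reindex_tensor π F).symm⟩
    | zero =>
      rw [map_zero]
      exact Submodule.zero_mem _
    | add t t' _ _ ih ih' =>
      rw [map_add]
      exact Submodule.add_mem _ ih ih'
    | smul a t _ ih =>
      rw [map_smul]
      exact Submodule.smul_mem _ a ih)

theorem permTensor_offTensor (π : Equiv.Perm (Fin n)) (F : Fin n → LocalSeries d)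
    (hF : OffDiagonal F) (hFπ : OffDiagonal (F ∘ π)) :
    permTensor π (offTensor F hF) = offTensor (F ∘ π) hFπ :=
  Subtype.ext (reindex_tensor π F)

include hE in
theorem partE_perm (π : Equiv.Perm (Fin n)) (F : Fin n → LocalSeries d) {I : Finset (Fin n)}
    (hI : I.card < n) : partE E (I.map π.symm.toEmbedding) (F ∘ π) = partE E I F := by
  have hc : (I.map π.symm.toEmbedding).card < n := by rwa [Finset.card_map]
  refine (partE_eq hE F I hc (π ∘ (I.map π.symm.toEmbedding).orderEmbOfFin rfl)
    (π.injective.comp (Finset.orderEmbOfFin _ rfl).injective) fun i => ⟨fun hi => ?_, ?_⟩).symm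
  · have h1 : π.symm i ∈ I.map π.symm.toEmbedding := Finset.mem_map_of_mem _ hi
    rw [← Finset.mem_coe, ← Finset.range_orderEmbOfFin _ rfl] at h1
    obtain ⟨a, ha⟩ := h1
    exact ⟨a, by rw [Function.comp_apply, ha, Equiv.apply_symm_apply]⟩
  · rintro ⟨a, rfl⟩
    obtain ⟨j, hj, h1⟩ := Finset.mem_map.1 (Finset.orderEmbOfFin_mem (I.map π.symm.toEmbedding) rfl a)
    rw [Function.comp_apply, ← h1]
    simpa using hj

include hE in
-- Splittings of `F` and of `F ∘ π` correspond to each other under `π`, and by symmetry of the lower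
-- maps the factors are the same.
theorem factorizes_perm (π : Equiv.Perm (Fin n)) (F : Fin n → LocalSeries d) (A : CompactSeries d)
    (hA : Factorizes P E (F ∘ π) A) : Factorizes P E F A := by
  intro I hI hI' hsep
  have hc : (I.map π.symm.toEmbedding)ᶜ = Iᶜ.map π.symm.toEmbedding := by
    ext i
    simp [Finset.mem_map_equiv]
  have h1 := hA (I.map π.symm.toEmbedding) (hI.map) (by rw [hc]; exact hI'.map) fun i hi j hj => by
    rw [hc] at hj
    exact hsep _ (by simpa [Finset.mem_map_equiv] using hi) _
      (by simpa [Finset.mem_map_equiv] using hj)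
  have h2 : A.1 = timeProd P (partE E (I.map π.symm.toEmbedding) (F ∘ π)).1
    (partE E (I.map π.symm.toEmbedding)ᶜ (F ∘ π)).1 := h1
  rw [hc, partE_perm hE π F (card_lt_of_compl_nonempty hI'),
    partE_perm hE π F (card_lt_of_compl_nonempty (by rwa [compl_compl]))] at h2
  exact h2

end Main

end EuclideanEG

namespace EuclideanEG
open Filter MeasureTheory

/-! ### Weak solutions of linear ordinary differential equations of second order -/

/-- Test functions on the real line. -/
def testFn : Submodule ℝ (ℝ → ℝ) where
  carrier := {φ | ContDiff ℝ ∞ φ ∧ HasCompactSupport φ}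
  add_mem' := fun h h' => ⟨h.1.add h'.1, h.2.add h'.2⟩
  zero_mem' := ⟨contDiff_const, HasCompactSupport.zero⟩
  smul_mem' := fun c _ h => ⟨contDiff_const.mul h.1, h.2.mul_left (f := fun _ => c)⟩

theorem integrable_mul_testFn {w : ℝ → ℝ} (hw : Continuous w) (φ : testFn) :
    Integrable (fun x => w x * φ.1 x) :=
  (hw.mul φ.2.1.continuous).integrable_of_hasCompactSupport φ.2.2.mul_left

/-- Integration against a continuous function. -/
def pairing (w : ℝ → ℝ) (hw : Continuous w) : testFn →ₗ[ℝ] ℝ where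
  toFun φ := ∫ x, w x * φ.1 x
  map_add' φ ψ := by
    rw [← integral_add (integrable_mul_testFn hw φ) (integrable_mul_testFn hw ψ)]
    exact integral_congr_ae (Eventually.of_forall fun x => mul_add _ _ _)
  map_smul' c φ := by
    rw [RingHom.id_apply, smul_eq_mul, ← integral_const_mul]
    exact integral_congr_ae (Eventually.of_forall fun x => mul_left_comm _ _ _)

theorem eq_zero_of_integral_testFn {w : ℝ → ℝ} (hw : Continuous w)
    (h : ∀ φ : testFn, ∫ x, w x * φ.1 x = 0) (x : ℝ) : w x = 0 := by
  have h1 := ae_eq_zero_of_integral_contDiff_smul_eq_zero (μ := volume) hw.locallyIntegrable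
    fun g hg hg' => by simpa only [smul_eq_mul, mul_comm] using h ⟨g, hg, hg'⟩
  exact congrFun ((Continuous.ae_eq_iff_eq volume hw continuous_zero).1 h1) x

/-- The primitive from the left of the support vanishes again to its right exactly because the
integral is zero. -/
theorem exists_testFn_deriv (φ : testFn) (h : ∫ x, φ.1 x = 0) :
    ∃ k : testFn, ∀ x, HasDerivAt k.1 (φ.1 x) x := by
  obtain ⟨R, hR⟩ := φ.2.2.isCompact.isBounded.subset_ball 0
  have hcont := φ.2.1.continuous
  have hsupp : Function.support φ.1 ⊆ Set.Ioo (-R) R := fun x hx => by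
    have := hR (subset_tsupport _ hx)
    rwa [Real.ball_eq_Ioo, zero_sub, zero_add] at this
  have hd : ∀ x, HasDerivAt (fun x => ∫ y in (-R)..x, φ.1 y) (φ.1 x) x := fun x =>
    intervalIntegral.integral_hasDerivAt_right (hcont.intervalIntegrable _ _)
      (hcont.stronglyMeasurableAtFilter _ _) hcont.continuousAt
  refine ⟨⟨fun x => ∫ y in (-R)..x, φ.1 y, contDiff_infty_iff_deriv.2
    ⟨fun x => (hd x).differentiableAt, ?_⟩, ?_⟩, hd⟩
  · rw [show deriv (fun x => ∫ y in (-R)..x, φ.1 y) = φ.1 from funext fun x => (hd x).deriv]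
    exact φ.2.1
  · refine HasCompactSupport.intro (isCompact_Icc (a := -R) (b := R)) fun x hx => ?_
    rcases lt_or_ge x (-R) with hx' | hx'
    · rw [intervalIntegral.integral_symm, neg_eq_zero]
      refine intervalIntegral.integral_zero_ae (Eventually.of_forall fun y hy => ?_)
      rw [Set.uIoc_of_le hx'.le] at hy
      by_contra h0
      exact absurd (hsupp h0).1 (not_lt.2 hy.2)
    · have hxR : R < x := by
        by_contra hcon
        exact hx ⟨hx', not_lt.1 hcon⟩
      rw [intervalIntegral.integral_eq_integral_of_support_subset, h]
      exact hsupp.trans fun y hy => ⟨hy.1, (hy.2.trans hxR).le⟩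

theorem integral_mul_testFn_deriv {W w : ℝ → ℝ} (hW : ∀ x, HasDerivAt W (w x) x)
    (hw : Continuous w) (k φ : testFn) (hk : ∀ x, HasDerivAt k.1 (φ.1 x) x) :
    ∫ x, W x * φ.1 x = - ∫ x, w x * k.1 x := by
  have hWc : Continuous W := continuous_iff_continuousAt.2 fun x => (hW x).continuousAt
  exact integral_mul_deriv_eq_deriv_mul_of_integrable (fun x _ => hW x) (fun x _ => hk x)
    (integrable_mul_testFn hWc φ) (integrable_mul_testFn hw k) (integrable_mul_testFn hWc k)

theorem hasDerivAt_integral {w : ℝ → ℝ} (hw : Continuous w) (x : ℝ) :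
    HasDerivAt (fun x => ∫ y in (0 : ℝ)..x, w y) (w x) x :=
  intervalIntegral.integral_hasDerivAt_right (hw.intervalIntegrable _ _)
    (hw.stronglyMeasurableAtFilter _ _) hw.continuousAt

/-- A lemma of du Bois-Reymond type for `(a p')' = c`. With `A' = c`, `B' = A / a` and `S' = 1 / a`,
the function `B` is a particular solution, and `p - B` has to be a combination of the homogeneous
solutions `1` and `S`. -/
theorem hasDerivAt_of_weak_solution {a p c : ℝ → ℝ} (ha : ContDiff ℝ ∞ a) (ha0 : ∀ x, 0 < a x)
    (hp : Continuous p) (hc : Continuous c)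
    (h : ∀ η : testFn, ∫ x, p x * deriv (fun y => a y * deriv η.1 y) x = ∫ x, c x * η.1 x) :
    ∃ q : ℝ → ℝ, ∀ x, HasDerivAt p (q x / a x) x ∧ HasDerivAt q (c x) x := by
  let A : ℝ → ℝ := fun x => ∫ y in (0 : ℝ)..x, c y
  have hA : ∀ x, HasDerivAt A (c x) x := hasDerivAt_integral hc
  have hAc : Continuous A := continuous_iff_continuousAt.2 fun x => (hA x).continuousAt
  have hb : Continuous fun x => A x / a x := hAc.div ha.continuous fun x => (ha0 x).ne'
  let B : ℝ → ℝ := fun x => ∫ y in (0 : ℝ)..x, A y / a y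
  have hB : ∀ x, HasDerivAt B (A x / a x) x := hasDerivAt_integral hb
  have hBc : Continuous B := continuous_iff_continuousAt.2 fun x => (hB x).continuousAt
  have hs : Continuous fun x => 1 / a x := continuous_const.div ha.continuous fun x => (ha0 x).ne'
  let S : ℝ → ℝ := fun x => ∫ y in (0 : ℝ)..x, 1 / a y
  have hS : ∀ x, HasDerivAt S (1 / a x) x := hasDerivAt_integral hs
  have hSc : Continuous S := continuous_iff_continuousAt.2 fun x => (hS x).continuousAt
  have key : ∀ φ : testFn, (∫ x, φ.1 x = 0) → (∫ x, S x * φ.1 x = 0) →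
      ∫ x, (p x - B x) * φ.1 x = 0 := by
    intro φ h0 hS0
    obtain ⟨k, hk⟩ := exists_testFn_deriv φ h0
    -- Given `φ`, a test function `η` with `(a η')' = φ` is wanted: integrate `φ` to `k`, then `k /
    -- a` to `η`. The two integral conditions on `φ` make both primitives compactly supported.
    let k' : testFn := ⟨fun x => (1 / a x) * k.1 x,
      (contDiff_const.div ha fun x => (ha0 x).ne').mul k.2.1, k.2.2.mul_left⟩
    have h1 := integral_mul_testFn_deriv hS hs k φ hk
    rw [hS0, eq_comm, neg_eq_zero] at h1
    obtain ⟨η, hη⟩ := exists_testFn_deriv k' h1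
    have h2 : (fun y => a y * deriv η.1 y) = k.1 := by
      funext y
      rw [(hη y).deriv]
      change a y * (1 / a y * k.1 y) = k.1 y
      rw [← mul_assoc, mul_one_div_cancel (ha0 y).ne', one_mul]
    have h3 := h η
    rw [h2] at h3
    simp only [fun x => (hk x).deriv] at h3
    have h4 := integral_mul_testFn_deriv hA hc η k' hη
    have h5 := integral_mul_testFn_deriv hB hb k φ hk
    have h6 : ∀ x, A x / a x * k.1 x = A x * k'.1 x := fun x => by
      change _ = A x * (1 / a x * k.1 x)
      ring
    simp only [h6] at h5
    have h7 : ∫ x, (p x - B x) * φ.1 x = (∫ x, p x * φ.1 x) - ∫ x, B x * φ.1 x := by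
      rw [← integral_sub (integrable_mul_testFn hp φ) (integrable_mul_testFn hBc φ)]
      simp only [sub_mul]
    rw [h7]
    linarith
  -- A linear functional that vanishes on the common kernel of two others is a combination of them.
  have hspan := mem_span_of_iInf_ker_le_ker (K := pairing (fun x => p x - B x) (hp.sub hBc))
    (L := ![pairing (fun _ => 1) continuous_const, pairing S hSc]) fun φ hφ => by
      rw [Submodule.mem_iInf] at hφ
      refine key φ ?_ (hφ 1)
      have := hφ 0
      change ∫ x, (1 : ℝ) * φ.1 x = 0 at this
      simpa only [one_mul] using this
  rw [Matrix.range_cons, Matrix.range_cons, Matrix.range_empty, Set.union_empty,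
    Set.singleton_union, Submodule.mem_span_pair] at hspan
  obtain ⟨α, β, hαβ⟩ := hspan
  have hpe : ∀ x, p x = B x + α + β * S x := by
    intro x
    have hw : Continuous fun x => p x - B x - α - β * S x :=
      ((hp.sub hBc).sub continuous_const).sub (continuous_const.mul hSc)
    have := eq_zero_of_integral_testFn hw (fun φ => ?_) x
    · linarith
    · have h1 := LinearMap.congr_fun hαβ φ
      change α * (∫ x, (1 : ℝ) * φ.1 x) + β * (∫ x, S x * φ.1 x) =
        ∫ x, (p x - B x) * φ.1 x at h1
      have i1 : Integrable fun x => (p x - B x) * φ.1 x := integrable_mul_testFn (hp.sub hBc) φ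
      have i2 := (integrable_mul_testFn (w := fun _ => 1) continuous_const φ).const_mul α
      have i3 := (integrable_mul_testFn hSc φ).const_mul β
      rw [← integral_const_mul, ← integral_const_mul] at h1
      have h2 : ∀ x, (p x - B x - α - β * S x) * φ.1 x =
          (p x - B x) * φ.1 x - α * (1 * φ.1 x) - β * (S x * φ.1 x) := fun x => by ring
      simp only [h2]
      refine (integral_sub (i1.sub i2) i3).trans ?_
      have h3 : ∫ x, (p x - B x) * φ.1 x - α * (1 * φ.1 x) = _ := integral_sub i1 i2
      rw [sub_eq_zero]
      refine h3.trans ?_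
      rw [← h1, add_sub_cancel_left]
  refine ⟨fun x => A x + β, fun x => ⟨?_, (hA x).add_const β⟩⟩
  have h1 : HasDerivAt (fun x => B x + α + β * S x) (A x / a x + β * (1 / a x)) x :=
    ((hB x).add_const α).add ((hS x).const_mul β)
  rw [← funext hpe] at h1
  convert h1 using 1
  ring

/-- Bootstrap in the first order system for `p` and `q`: each round gains one derivative. -/
theorem contDiff_of_hasDerivAt {a p q c : ℝ → ℝ} (ha : ContDiff ℝ ∞ a) (ha0 : ∀ x, a x ≠ 0)
    (hc : ContDiff ℝ ∞ c)
    (h : ∀ x, HasDerivAt p (q x / a x) x ∧ HasDerivAt q (c x * p x) x) : ContDiff ℝ ∞ p := by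
  have hd : deriv p = fun x => q x / a x := funext fun x => (h x).1.deriv
  have hd' : deriv q = fun x => c x * p x := funext fun x => (h x).2.deriv
  have key : ∀ n : ℕ, ContDiff ℝ n p ∧ ContDiff ℝ n q := by
    intro n
    induction n with
    | zero =>
      exact ⟨contDiff_zero.2 (continuous_iff_continuousAt.2 fun x => (h x).1.continuousAt),
        contDiff_zero.2 (continuous_iff_continuousAt.2 fun x => (h x).2.continuousAt)⟩
    | succ n ih =>
      push_cast
      refine ⟨contDiff_succ_iff_deriv.2 ⟨fun x => (h x).1.differentiableAt, by simp, ?_⟩,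
        contDiff_succ_iff_deriv.2 ⟨fun x => (h x).2.differentiableAt, by simp, ?_⟩⟩
      · rw [hd]
        exact ih.2.div (ha.of_le (by exact_mod_cast le_top)) ha0
      · rw [hd']
        exact (hc.of_le (by exact_mod_cast le_top)).mul ih.1
  exact contDiff_infty.2 fun n => (key n).1

end EuclideanEG

namespace EuclideanEG
open Filter MeasureTheory

variable {d : ℕ}

/-! ### The kernel is smooth off the origin -/

theorem hasFDerivAt_log_norm {x : Space d} (hx : x ≠ 0) :
    HasFDerivAt (fun y : Space d => Real.log ‖y‖) ((‖x‖ ^ 2)⁻¹ • innerSL ℝ x) x := by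
  have h0 : ‖x‖ ^ 2 ≠ 0 := pow_ne_zero 2 (norm_ne_zero_iff.2 hx)
  have h1 : HasFDerivAt (fun y : Space d => 2⁻¹ * Real.log (‖y‖ ^ 2))
      ((2⁻¹ : ℝ) • (‖x‖ ^ 2)⁻¹ • (2 • innerSL ℝ x)) x :=
    (((hasStrictFDerivAt_norm_sq x).hasFDerivAt).log h0).const_mul _
  have h2 : (fun y : Space d => 2⁻¹ * Real.log (‖y‖ ^ 2)) = fun y => Real.log ‖y‖ := by
    funext y
    rw [Real.log_pow]
    push_cast
    ring
  rw [h2] at h1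
  refine h1.congr_fderiv ?_
  module

/-- The function `η(log ‖x‖)`, extended by `0` to the origin. -/
def radial (d : ℕ) (η : ℝ → ℝ) : Space d → ℝ := fun x =>
  open Classical in if x = 0 then 0 else η (Real.log ‖x‖)

theorem radial_eventuallyEq (η : ℝ → ℝ) {x : Space d} (hx : x ≠ 0) :
    radial d η =ᶠ[𝓝 x] fun y => η (Real.log ‖y‖) := by
  filter_upwards [isOpen_compl_singleton.mem_nhds hx] with y hy
  exact if_neg hy

theorem radial_eventuallyEq_zero (η : testFn) : radial d η.1 =ᶠ[𝓝 0] fun _ => 0 := by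
  obtain ⟨R, hR⟩ := η.2.2.isCompact.isBounded.subset_ball 0
  filter_upwards [Metric.ball_mem_nhds (0 : Space d) (Real.exp_pos (-R))] with x hx
  rw [mem_ball_zero_iff] at hx
  rw [radial]
  split_ifs with h0
  · rfl
  · refine image_eq_zero_of_notMem_tsupport fun h => ?_
    have h1 := hR h
    rw [Real.ball_eq_Ioo] at h1
    have h2 := Real.log_lt_log (norm_pos_iff.2 h0) hx
    rw [Real.log_exp] at h2
    linarith [h1.1]

theorem contDiff_radial (η : testFn) : ContDiff ℝ ∞ (radial d η.1) := by
  rw [contDiff_iff_contDiffAt]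
  intro x
  rcases eq_or_ne x 0 with rfl | hx
  · exact contDiffAt_const.congr_of_eventuallyEq (radial_eventuallyEq_zero η)
  · refine ContDiffAt.congr_of_eventuallyEq ?_ (radial_eventuallyEq η.1 hx)
    exact η.2.1.contDiffAt.comp x ((contDiffAt_norm ℝ hx).log (norm_ne_zero_iff.2 hx))

theorem hasCompactSupport_radial (η : testFn) : HasCompactSupport (radial d η.1) := by
  obtain ⟨R, hR⟩ := η.2.2.isCompact.isBounded.subset_ball 0
  refine HasCompactSupport.intro (isCompact_closedBall 0 (Real.exp R)) fun x hx => ?_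
  rw [mem_closedBall_zero_iff, not_le] at hx
  have h0 : x ≠ 0 := norm_pos_iff.1 ((Real.exp_pos R).trans hx)
  rw [radial, if_neg h0]
  refine image_eq_zero_of_notMem_tsupport fun h => ?_
  have h1 := hR h
  rw [Real.ball_eq_Ioo] at h1
  have h2 := Real.log_lt_log (Real.exp_pos R) hx
  rw [Real.log_exp] at h2
  linarith [h1.2]

/-- In the variable `t = log ‖x‖` the radial Laplacian is `‖x‖⁻² (∂ₜ² + (d - 2) ∂ₜ)`, with constant
coefficients inside the bracket. -/
theorem laplacian_radial (η : testFn) {x : Space d} (hx : x ≠ 0) :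
    Laplacian.laplacian (radial d η.1) x = (‖x‖ ^ 2)⁻¹ *
      (deriv (deriv η.1) (Real.log ‖x‖) + ((d : ℝ) - 2) * deriv η.1 (Real.log ‖x‖)) := by
  have h0 : ‖x‖ ^ 2 ≠ 0 := pow_ne_zero 2 (norm_ne_zero_iff.2 hx)
  have hη : ContDiff ℝ ∞ (deriv η.1) := (contDiff_infty_iff_deriv.1 η.2.1).2
  have hd : ∀ t, HasDerivAt η.1 (deriv η.1 t) t := fun t =>
    ((contDiff_infty_iff_deriv.1 η.2.1).1 t).hasDerivAt
  have hd' : ∀ t, HasDerivAt (deriv η.1) (deriv (deriv η.1) t) t := fun t =>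
    ((contDiff_infty_iff_deriv.1 hη).1 t).hasDerivAt
  have h1 : fderiv ℝ (radial d η.1) =ᶠ[𝓝 x] fun y =>
      (deriv η.1 (Real.log ‖y‖) * (‖y‖ ^ 2)⁻¹) • innerSL ℝ y := by
    filter_upwards [isOpen_compl_singleton.mem_nhds hx] with y hy
    rw [(radial_eventuallyEq η.1 hy).fderiv_eq]
    refine (((hd _).comp_hasFDerivAt y (hasFDerivAt_log_norm hy)).congr_fderiv ?_).fderiv
    rw [smul_smul]
  have h2 : HasFDerivAt (fun y : Space d => deriv η.1 (Real.log ‖y‖) * (‖y‖ ^ 2)⁻¹)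
      (deriv η.1 (Real.log ‖x‖) • (-(‖x‖ ^ 2) ^ 2)⁻¹ • (2 • innerSL ℝ x) +
        (‖x‖ ^ 2)⁻¹ • deriv (deriv η.1) (Real.log ‖x‖) • (‖x‖ ^ 2)⁻¹ • innerSL ℝ x) x := by
    have h3 := (hasDerivAt_inv h0).comp_hasFDerivAt x (hasStrictFDerivAt_norm_sq x).hasFDerivAt
    refine (((hd' _).comp_hasFDerivAt x (hasFDerivAt_log_norm hx)).mul h3).congr_fderiv ?_
    rw [inv_neg]
    rfl
  have h4 : HasFDerivAt (fun y : Space d =>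
      (deriv η.1 (Real.log ‖y‖) * (‖y‖ ^ 2)⁻¹) • innerSL ℝ y) _ x :=
    h2.smul (innerSL ℝ (E := Space d)).hasFDerivAt
  have h5 : ∀ v : Space d, iteratedFDeriv ℝ 2 (radial d η.1) x ![v, v] =
      deriv η.1 (Real.log ‖x‖) * (‖x‖ ^ 2)⁻¹ * ‖v‖ ^ 2 + ((‖x‖ ^ 2) ^ 2)⁻¹ *
        (deriv (deriv η.1) (Real.log ‖x‖) - 2 * deriv η.1 (Real.log ‖x‖)) * ‖inner ℝ x v‖ ^ 2 := by
    intro v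
    have e : innerSL ℝ v v = ‖v‖ ^ 2 := real_inner_self_eq_norm_sq v
    rw [iteratedFDeriv_two_apply, h1.fderiv_eq, h4.fderiv, Real.norm_eq_abs, sq_abs]
    simp [e]
    field_simp
    ring
  rw [congrFun (InnerProductSpace.laplacian_eq_iteratedFDeriv_orthonormalBasis _
    (EuclideanSpace.basisFun (Fin d) ℝ)) x]
  simp only [h5]
  rw [Finset.sum_add_distrib, ← Finset.mul_sum, ← Finset.mul_sum,
    OrthonormalBasis.sum_sq_norm_inner_left]
  simp only [OrthonormalBasis.norm_eq_one, one_pow, Finset.sum_const, Finset.card_univ,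
    Fintype.card_fin, nsmul_eq_mul, mul_one]
  field_simp
  ring

theorem integral_Ioi_eq_integral_exp (g : ℝ → ℝ) :
    ∫ r in Set.Ioi (0 : ℝ), g r = ∫ t, Real.exp t * g (Real.exp t) := by
  have h := integral_image_eq_integral_abs_deriv_smul (s := Set.univ) MeasurableSet.univ
    (fun t _ => (Real.hasDerivAt_exp t).hasDerivWithinAt) Real.exp_injective.injOn g
  rw [Set.image_univ, Real.range_exp, setIntegral_univ] at h
  simpa only [abs_of_pos (Real.exp_pos _), smul_eq_mul] using h

namespace IsHelmholtzKernel

variable {m : ℝ} {P : Space d → ℝ}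

/-- The reflection in the hyperplane orthogonal to `x - y` exchanges the two points. -/
theorem apply_eq_of_norm_eq (hP : IsHelmholtzKernel d m P) {x y : Space d} (h : ‖x‖ = ‖y‖) :
    P x = P y := by
  rw [← Submodule.reflection_sub h, hP.invariant]

/-- The fundamental solution is tested on radial functions that vanish near the origin, so there is
no contribution of the delta distribution. Polar coordinates with `r = exp t` turn the Helmholtz
equation into one in divergence form on the line. -/
theorem radial_equation (hP : IsHelmholtzKernel d m P) (hd : 0 < d) {u : ℝ → ℝ}
    (hu : ∀ x ≠ 0, P x = u (Real.log ‖x‖)) (huc : Continuous u) (η : testFn) :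
    ∫ t, u t * deriv (fun t => Real.exp (((d : ℝ) - 2) * t) * deriv η.1 t) t =
      ∫ t, (m ^ 2 * Real.exp (d * t) * u t) * η.1 t := by
  have : Nonempty (Fin d) := ⟨⟨0, hd⟩⟩
  have hη : ContDiff ℝ ∞ (deriv η.1) := (contDiff_infty_iff_deriv.1 η.2.1).2
  let Φ : ℝ → ℝ := fun r => u (Real.log r) * (-((r ^ 2)⁻¹ * (deriv (deriv η.1) (Real.log r) +
    ((d : ℝ) - 2) * deriv η.1 (Real.log r))) + m ^ 2 * η.1 (Real.log r))
  have h1 : ∫ x : Space d, Φ ‖x‖ = 0 := by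
    have h2 := hP.fundamental _ (contDiff_radial η) (hasCompactSupport_radial η)
    rw [show radial d η.1 0 = 0 from if_pos rfl] at h2
    rw [← h2]
    refine integral_congr_ae ?_
    filter_upwards [compl_mem_ae_iff.2 (measure_singleton (0 : Space d))] with x hx
    rw [hu x hx, laplacian_radial η hx, (radial_eventuallyEq η.1 hx).self_of_nhds]
  rw [integral_fun_norm_addHaar, finrank_euclideanSpace_fin, nsmul_eq_mul, smul_eq_mul] at h1
  have h3 : volume.real (Metric.ball (0 : Space d) 1) ≠ 0 :=
    (ENNReal.toReal_pos (Metric.measure_ball_pos volume _ one_pos).ne'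
      measure_ball_lt_top.ne).ne'
  have h4 := (mul_eq_zero.1 ((mul_eq_zero.1 h1).resolve_left
    (Nat.cast_ne_zero.2 hd.ne'))).resolve_left h3
  rw [integral_Ioi_eq_integral_exp] at h4
  have ha : ∀ t, HasDerivAt (fun t => Real.exp (((d : ℝ) - 2) * t) * deriv η.1 t)
      (Real.exp (((d : ℝ) - 2) * t) * (deriv (deriv η.1) t + ((d : ℝ) - 2) * deriv η.1 t)) t := by
    intro t
    have h5 := ((hasDerivAt_id t).const_mul ((d : ℝ) - 2)).exp.mul
      ((contDiff_infty_iff_deriv.1 hη).1 t).hasDerivAt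
    refine h5.congr_deriv ?_
    simp only [id]
    ring
  have h6 : ∀ t, Real.exp t * (Real.exp t ^ (d - 1) • Φ (Real.exp t)) =
      (m ^ 2 * Real.exp (d * t) * u t) * η.1 t -
        u t * deriv (fun t => Real.exp (((d : ℝ) - 2) * t) * deriv η.1 t) t := by
    intro t
    have e1 : Real.exp t * Real.exp t ^ (d - 1) = Real.exp (d * t) := by
      rw [← pow_succ', Nat.sub_add_cancel hd, ← Real.exp_nat_mul]
    have e2 : Real.exp (((d : ℝ) - 2) * t) = Real.exp (d * t) * (Real.exp t ^ 2)⁻¹ := by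
      rw [← Real.exp_nat_mul, ← Real.exp_neg, ← Real.exp_add]
      congr 1
      push_cast
      ring
    rw [(ha t).deriv, e2, smul_eq_mul, ← mul_assoc, e1]
    simp only [Φ, Real.log_exp]
    ring
  simp only [h6] at h4
  let κ : testFn := ⟨deriv (fun t => Real.exp (((d : ℝ) - 2) * t) * deriv η.1 t),
    (contDiff_infty_iff_deriv.1 ((contDiff_const.mul contDiff_id).exp.mul hη)).2,
    (η.2.2.deriv.mul_left).deriv⟩
  have i1 := integrable_mul_testFn (w := fun t => m ^ 2 * Real.exp (d * t) * u t)
    ((continuous_const.mul (Real.continuous_exp.comp (continuous_const.mul continuous_id))).mul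
      huc) η
  have i2 := integrable_mul_testFn huc κ
  have h7 := integral_sub i1 i2
  rw [sub_eq_iff_eq_add.1 (h7.symm.trans h4), zero_add]

/-- Invariance reduces `P` to its profile in `log ‖x‖`, a weak solution of a linear second order
equation with smooth coefficients, hence smooth. For `d = 0` there is no point off the origin. -/
theorem contDiffOn (hP : IsHelmholtzKernel d m P) : ContDiffOn ℝ ∞ P {0}ᶜ := by
  rcases Nat.eq_zero_or_pos d with rfl | hd
  · intro x hx
    exact absurd (Subsingleton.elim x 0) hx
  have : Nonempty (Fin d) := ⟨⟨0, hd⟩⟩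
  obtain ⟨e, he⟩ := exists_norm_eq (Space d) zero_le_one
  let u : ℝ → ℝ := fun t => P (Real.exp t • e)
  have hne : ∀ t, Real.exp t • e ∈ ({0}ᶜ : Set (Space d)) := fun t h0 => by
    have := congrArg norm (Set.mem_singleton_iff.1 h0)
    rw [norm_smul, he, mul_one, norm_zero, Real.norm_eq_abs, Real.abs_exp] at this
    exact (Real.exp_pos t).ne' this
  have hu : ∀ x ≠ 0, P x = u (Real.log ‖x‖) := fun x hx => hP.apply_eq_of_norm_eq (by
    rw [Real.exp_log (norm_pos_iff.2 hx), norm_smul, he, norm_norm, mul_one])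
  have huc : Continuous u := hP.continuousOn.comp_continuous
    (Real.continuous_exp.smul continuous_const) hne
  have hlin : ∀ c : ℝ, ContDiff ℝ ∞ fun t => Real.exp (c * t) := fun c =>
    (contDiff_const.mul contDiff_id).exp
  obtain ⟨q, hq⟩ := hasDerivAt_of_weak_solution (hlin ((d : ℝ) - 2)) (fun t => Real.exp_pos _) huc
    ((continuous_const.mul (hlin d).continuous).mul huc) (hP.radial_equation hd hu huc)
  have hus : ContDiff ℝ ∞ u := contDiff_of_hasDerivAt (hlin ((d : ℝ) - 2))
    (fun t => (Real.exp_pos _).ne') (contDiff_const.mul (hlin d)) hq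
  refine ContDiffOn.congr (f := fun x => u (Real.log ‖x‖)) (fun x hx => ?_) hu
  exact (hus.contDiffAt.comp x
    ((contDiffAt_norm ℝ hx).log (norm_ne_zero_iff.2 hx))).contDiffWithinAt

theorem neg (hP : IsHelmholtzKernel d m P) (x : Space d) : P (-x) = P x :=
  hP.invariant (LinearIsometryEquiv.neg ℝ) x

end IsHelmholtzKernel

end EuclideanEG

end

/-! ### The proposition -/

theorem mainTheorem2 (d : ℕ) (m : ℝ) (P : EuclideanEG.Space d → ℝ)
    (hP : EuclideanEG.IsHelmholtzKernel d m P) (n : ℕ) (hn : 2 ≤ n)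
    (E : (k : ℕ) → EuclideanEG.OrderMap d k) (hE : EuclideanEG.InductionHypothesis P n E) :
    ∃ E₀ : EuclideanEG.offDiagTensors d n →ₗ[PowerSeries ℂ] EuclideanEG.CompactSeries d,
      (∀ (F : Fin n → EuclideanEG.LocalSeries d) (hF : EuclideanEG.OffDiagonal F),
        EuclideanEG.Factorizes P E F (E₀ (EuclideanEG.offTensor F hF))) ∧
      (∀ (π : Equiv.Perm (Fin n)) (F : Fin n → EuclideanEG.LocalSeries d)
        (hF : EuclideanEG.OffDiagonal F) (hFπ : EuclideanEG.OffDiagonal (F ∘ π)),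
        E₀ (EuclideanEG.offTensor (F ∘ π) hFπ) = E₀ (EuclideanEG.offTensor F hF)) ∧
      (∀ (F : Fin n → EuclideanEG.LocalSeries d) (hF : EuclideanEG.OffDiagonal F),
        EuclideanEG.seriesSupport (E₀ (EuclideanEG.offTensor F hF)).1 ⊆
          ⋃ i, EuclideanEG.seriesSupport (F i).1) ∧
      (∀ E₀' : EuclideanEG.offDiagTensors d n →ₗ[PowerSeries ℂ] EuclideanEG.CompactSeries d,
        (∀ (F : Fin n → EuclideanEG.LocalSeries d) (hF : EuclideanEG.OffDiagonal F),
          EuclideanEG.Factorizes P E F (E₀' (EuclideanEG.offTensor F hF))) → E₀' = E₀) ∧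
      (∀ En : EuclideanEG.OrderMap d n,
        (∀ F : Fin n → EuclideanEG.LocalSeries d,
          EuclideanEG.Factorizes P E F (En (EuclideanEG.tensor F))) →
        ∀ t : EuclideanEG.offDiagTensors d n, En t.1 = E₀ t) := by
  have hs := hP.contDiffOn
  obtain ⟨T, hT, hsupp⟩ := EuclideanEG.exists_causal hE hs hP.neg hn
  refine ⟨T, hT, fun π F hF hFπ => ?_, hsupp,
    fun T' hT' => EuclideanEG.causal_unique hE hs hn hT' hT, fun En hEn t => ?_⟩
  -- The limit map composed with a permutation of the factors is again causal, so uniqueness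
  -- identifies it with the limit map.
  · rw [← EuclideanEG.permTensor_offTensor π F hF hFπ]
    refine LinearMap.congr_fun (EuclideanEG.causal_unique hE hs hn
      (T := T ∘ₗ EuclideanEG.permTensor π) (fun G hG => ?_) hT) _
    refine EuclideanEG.factorizes_perm hE π G _ ?_
    rw [LinearMap.comp_apply, EuclideanEG.permTensor_offTensor π G hG (hG.perm π)]
    exact hT _ _
  · exact LinearMap.congr_fun (EuclideanEG.causal_unique hE hs hn
      (T := En ∘ₗ (EuclideanEG.offDiagTensors d n).subtype) (fun G hG => hEn G) hT) t
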